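/- Let $\mathbb K$ be $\mathbb R$ or $\mathbb C$ and let $\theta\subset\{1,\dots,d-1\}$ be symmetric, i.e. $k\in\theta$ if and only if $d-k\in\theta$. For $g\in\mathsf{PGL}(d,\mathbb K)$ let $\kappa(g)=(\log\sigma_1(g),\dots,\log\sigma_d(g))$, where $\sigma_1(g)\ge\dots\ge\sigma_d(g)$ are the singular values of a representative of $g$ whose determinant has modulus $1$, and let $\alpha_k(A)=A_k-A_{k+1}$. Let $\mathcal F_\theta$ be the space of partial flags $F=(F^k)_{k\in\theta}$ in $\mathbb K^d$ with $\dim F^k=k$. Flags $F,G\in\mathcal F_\theta$ are transverse if $F^k\oplus G^{d-k}=\mathbb K^d$ for all $k\in\theta$; a subset of $\mathcal F_\theta$ is transverse if any two distinct elements of it are transverse. If $\alpha_k(\kappa(g))>0$ for all $k\in\theta$ and $g=\ell a m$ is a Cartan decomposition, with $\ell,m$ represented by orthogonal (unitary if $\mathbb K=\mathbb C$) matrices and $a$ by a positive diagonal matrix with decreasing entries, let $U_\theta(g)=(\ell\langle e_1,\dots,e_k\rangle)_{k\in\theta}$. A subgroup $\Gamma\subset\mathsf{PGL}(d,\mathbb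 K)$ is $P_\theta$-transverse if $\alpha_k(\kappa(\gamma_n))\to\infty$ for every $k\in\theta$ and every sequence $(\gamma_n)$ of pairwise distinct elements of $\Gamma$, and the limit set $\Lambda_\theta(\Gamma)$, consisting of all limits of $U_\theta(\gamma_n)$ for such sequences, is transverse. A properly convex domain $\Omega\subset\mathbb P(\mathbb R^{d_0})$ is a non-empty open set that is a bounded convex subset of some affine chart, and $\mathrm{Aut}(\Omega)\subset\mathsf{PGL}(d_0,\mathbb R)$ is its stabilizer. For $\Gamma_0\subset\mathrm{Aut}(\Omega)$ let $\Lambda_\Omega(\Gamma_0)$ be the set of $z\in\partial\Omega$ such that $z=\lim\gamma_n(x)$ for some $x\in\Omega$ and some sequence $(\gamma_n)$ in $\Gamma_0$. The group $\Gamma_0$ is a projectively visible subgroup of $\mathrm{Aut}(\Omega)$ if it is discrete in $\mathsf{PGL}(d_0,\mathbb R)$, for all $x,y\in\Lambda_\Omega(\Gamma_0)$ the open projective line segment in $\overline\Omega$ joining $x$ to $y$ (which is empty if $x=y$) lies in $\Omega$, and every $x\in\Lambda_\Omega(\Gamma_0)$ is contained in a unique supporting hyperplane to $\Omega$. A representation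 $\rho:\Gamma_0\to\mathsf{PGL}(d,\mathbb K)$ of such a group is $P_\theta$-transverse with limit map $\xi$ if $\xi:\Lambda_\Omega(\Gamma_0)\to\mathcal F_\theta$ is a topological embedding such that (a) $\xi$ is $\rho$-equivariant, (b) the image of $\xi$ is a transverse subset of $\mathcal F_\theta$, and (c) whenever $b_0\in\Omega$ and $(\gamma_n)$ is a sequence in $\Gamma_0$ with $\gamma_n(b_0)\to x\in\Lambda_\Omega(\Gamma_0)$ and $\gamma_n^{-1}(b_0)\to y\in\Lambda_\Omega(\Gamma_0)$, then $\rho(\gamma_n)(F)\to\xi(x)$ for every $F\in\mathcal F_\theta$ transverse to $\xi(y)$. **Theorem.** If $\Gamma\subset\mathsf{PGL}(d,\mathbb K)$ is $P_\theta$-transverse, then for every $k\in\theta$ with $k\le d-k$ there exist $d_0\ge 2$, a properly convex domain $\Omega\subset\mathbb P(\mathbb R^{d_0})$, a projectively visible subgroup $\Gamma_0\subset\mathrm{Aut}(\Omega)$, and a faithful $P_\theta$-transverse representation $\rho:\Gamma_0\to\mathsf{PGL}(d,\mathbb K)$ with limit map $\xi:\Lambda_\Omega(\Gamma_0)\to\mathcal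 F_\theta$ such that 1. $\rho(\Gamma_0)=\Gamma$; 2. $\xi(\Lambda_\Omega(\Gamma_0))=\Lambda_\theta(\Gamma)$; 3. $\alpha_1(\kappa(\gamma))=\alpha_k(\kappa(\rho(\gamma)))$ for all $\gamma\in\Gamma_0$. -/

import Mathlib

open Filter Topology
open scoped Pointwise LinearAlgebra.Projectivization

noncomputable section

namespace TransverseGroups

/-! ### The projective general linear group and the Cartan projection -/

/-- The group `PGL(d, K)`. -/
abbrev PGL (d : ℕ) (K : Type*) [CommRing K] : Type _ :=
  Matrix.ProjGenLinGroup (Fin d) K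

/-- The quotient topology on `PGL(d, K)`. -/
instance instTopologicalSpacePGL (d : ℕ) (K : Type*) [RCLike K] :
    TopologicalSpace (PGL d K) :=
  TopologicalSpace.coinduced
    (Matrix.ProjGenLinGroup.mk : Matrix.GeneralLinearGroup (Fin d) K → PGL d K) inferInstance

/-- Every element of `PGL(d, K)` has a representative whose determinant has modulus one. -/
theorem exists_unimodular_rep {d : ℕ} {K : Type*} [RCLike K] (g : PGL d K) :
    ∃ A : Matrix.GeneralLinearGroup (Fin d) K,
      Matrix.ProjGenLinGroup.mk A = g ∧ ‖(A : Matrix (Fin d) (Fin d) K).det‖ = 1 := by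
  obtain ⟨A, rfl⟩ := Matrix.ProjGenLinGroup.mk_surjective g
  rcases Nat.eq_zero_or_pos d with rfl | hd
  · exact ⟨A, rfl, by simp⟩
  have hdet : 0 < ‖(A : Matrix (Fin d) (Fin d) K).det‖ := by
    rw [norm_pos_iff]
    exact (Matrix.isUnits_det_units A).ne_zero
  set r : ℝ := ‖(A : Matrix (Fin d) (Fin d) K).det‖ with hr
  set c : ℝ := (r ^ ((d : ℝ)⁻¹))⁻¹ with hc
  have hcpos : 0 < c := by positivity
  have hc0 : (c : K) ≠ 0 := by exact_mod_cast hcpos.ne'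
  refine ⟨A * Matrix.GeneralLinearGroup.scalar (Fin d) (Units.mk0 (c : K) hc0), ?_, ?_⟩
  · rw [map_mul, Matrix.ProjGenLinGroup.mk_scalar, mul_one]
  · have h1 : ‖(c : K)‖ = c := by
      rw [RCLike.norm_ofReal, abs_of_pos hcpos]
    have h2 : c ^ d = r⁻¹ := by
      rw [hc, inv_pow, Real.rpow_inv_natCast_pow hdet.le hd.ne']
    simp only [Units.val_mul, Matrix.det_mul, norm_mul, ← hr]
    have h3 : ((Matrix.GeneralLinearGroup.scalar (Fin d) (Units.mk0 (c : K) hc0) :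
        Matrix.GeneralLinearGroup (Fin d) K) : Matrix (Fin d) (Fin d) K)
        = Matrix.scalar (Fin d) (c : K) := by
      rfl
    rw [h3, Matrix.scalar_apply, Matrix.det_diagonal, Finset.prod_const, norm_pow, h1,
      Finset.card_univ, Fintype.card_fin, h2, mul_inv_cancel₀ hdet.ne']

/-- A representative of `g` whose determinant has modulus one. It is unique up to multiplication by
a scalar of modulus one, which does not change its singular values. -/
def unimodularRep {d : ℕ} {K : Type*} [RCLike K] (g : PGL d K) :
    Matrix.GeneralLinearGroup (Fin d) K :=
  (exists_unimodular_rep g).choose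

/-- The Cartan projection `κ(g)`: the logarithms of the singular values, in decreasing order, of a
representative of `g` whose determinant has modulus one. -/
def cartanProjection {d : ℕ} {K : Type*} [RCLike K] (g : PGL d K) : Fin d → ℝ := fun i =>
  Real.log ((Matrix.toEuclideanLin
    (unimodularRep g : Matrix (Fin d) (Fin d) K)).singularValues i)

/-- The simple root `α_k(A) = A_k - A_{k+1}` for `1 ≤ k ≤ d - 1` (the entries `A_1, …, A_d` have the
Lean indices `0, …, d - 1`). There are no simple roots for the other values of `k`. -/
def simpleRoot {d : ℕ} (k : ℕ) (A : Fin d → ℝ) : ℝ :=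
  if h : 1 ≤ k ∧ k < d then A ⟨k - 1, by omega⟩ - A ⟨k, h.2⟩ else 0

/-! ### Partial flags -/

/-- The space `F_θ(K^d)` of partial flags with one subspace of dimension `k` for each `k ∈ θ`. -/
@[ext]
structure PartialFlag (K : Type*) [RCLike K] (d : ℕ) (θ : Finset ℕ) where
  /-- the subspace of dimension `k` -/
  space : θ → Submodule K (Fin d → K)
  finrank_space : ∀ k : θ, Module.finrank K (space k) = k
  mono : ∀ j k : θ, (j : ℕ) ≤ k → space j ≤ space k

variable {K : Type*} [RCLike K] {d : ℕ} {θ : Finset ℕ}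

/-- The orthogonal projection of Euclidean `K^d` onto a linear subspace. -/
def orthProj (V : Submodule K (Fin d → K)) :
    EuclideanSpace K (Fin d) →L[K] EuclideanSpace K (Fin d) :=
  (V.map (WithLp.linearEquiv 2 K (Fin d → K)).symm.toLinearMap).starProjection

/-- The topology of `F_θ(K^d)` as a subspace of a product of Grassmannians, where the Grassmannians
are embedded into the operators on Euclidean space by the orthogonal projections. -/
instance instTopologicalSpacePartialFlag : TopologicalSpace (PartialFlag K d θ) :=
  TopologicalSpace.induced (fun F (k : θ) => orthProj (F.space k)) inferInstance

/-- The linear action of `GL(d, K)` on flags. -/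
instance instMulActionGL :
    MulAction (Matrix.GeneralLinearGroup (Fin d) K) (PartialFlag K d θ) where
  smul g F :=
    { space := fun k => g • F.space k
      finrank_space := fun k => by
        rw [← F.finrank_space k]
        exact LinearEquiv.finrank_map_eq (DistribMulAction.toLinearEquiv K (Fin d → K) g) (F.space k)
      mono := fun j k h => Submodule.map_mono (F.mono j k h) }
  one_smul F := by
    ext1
    funext k
    exact one_smul _ (F.space k)
  mul_smul g h F := by
    ext1
    funext k
    exact mul_smul g h (F.space k)

/-- The action of `PGL(d, K)` on flags. -/
instance instMulActionPGL : MulAction (PGL d K) (PartialFlag K d θ) :=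
  Matrix.ProjGenLinGroup.mulActionOfGL fun u F => by
    ext1
    funext k
    have hu : ∀ x : Fin d → K,
        Matrix.GeneralLinearGroup.scalar (Fin d) u • x = (u : K) • x := fun x => by
      change (Matrix.scalar (Fin d) (u : K)).mulVec x = _
      simp
    change Matrix.GeneralLinearGroup.scalar (Fin d) u • F.space k = F.space k
    refine le_antisymm ?_ ?_
    · rintro _ ⟨x, hx, rfl⟩
      change Matrix.GeneralLinearGroup.scalar (Fin d) u • x ∈ F.space k
      rw [hu]
      exact (F.space k).smul_mem _ hx
    · intro x hx
      refine ⟨(u⁻¹ : Kˣ) • x, (F.space k).smul_mem _ hx, ?_⟩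
      change Matrix.GeneralLinearGroup.scalar (Fin d) u • ((u⁻¹ : Kˣ) • x) = x
      rw [hu, ← Units.smul_def, smul_inv_smul]

/-- Two flags `F, G` are transverse if `F^k ⊕ G^{d-k} = K^d` for all `k ∈ θ` (here `l = d - k`). -/
def PartialFlag.IsTransverse (F G : PartialFlag K d θ) : Prop :=
  ∀ k l : θ, (k : ℕ) + l = d → IsCompl (F.space k) (G.space l)

/-- A set of flags is transverse if any two distinct flags in it are transverse. -/
def IsTransverseSet (X : Set (PartialFlag K d θ)) : Prop :=
  ∀ F ∈ X, ∀ G ∈ X, F ≠ G → F.IsTransverse G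

/-! ### Transverse subgroups -/

/-- `F = U_θ(g)`: there is a Cartan decomposition `g = ℓ a m`, with `ℓ, m` unitary (orthogonal over
the reals) and `a = exp(A)` for a trace-zero real diagonal matrix `A` with decreasing entries, such
that `F^k` is spanned by `ℓ e_1, …, ℓ e_k` for all `k ∈ θ`. If `α_k(κ(g)) > 0` for all `k ∈ θ`,
then there is exactly one such flag `F`. -/
def IsCartanFlag (g : PGL d K) (F : PartialFlag K d θ) : Prop :=
  ∃ ℓ ∈ Matrix.unitaryGroup (Fin d) K, ∃ m ∈ Matrix.unitaryGroup (Fin d) K, ∃ A : Fin d → ℝ,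
    Antitone A ∧ ∑ i, A i = 0 ∧
    (∃ B : Matrix.GeneralLinearGroup (Fin d) K, Matrix.ProjGenLinGroup.mk B = g ∧
      (B : Matrix (Fin d) (Fin d) K) =
        ℓ * Matrix.diagonal (fun i => ((Real.exp (A i) : ℝ) : K)) * m) ∧
    ∀ k : θ, F.space k =
      Submodule.span K ((fun i : Fin d => ℓ.mulVec (Pi.single i 1)) '' {i | (i : ℕ) < k})

/-- `Γ` is `P_k`-divergent: `α_k(κ(γ_n)) → ∞` for all sequences of distinct elements of `Γ`. -/
def IsDivergent (k : ℕ) (Γ : Subgroup (PGL d K)) : Prop :=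
  ∀ γ : ℕ → PGL d K, (∀ n, γ n ∈ Γ) → Function.Injective γ →
    Tendsto (fun n => simpleRoot k (cartanProjection (γ n))) atTop atTop

/-- The limit set `Λ_θ(Γ)` of a group that is `P_k`-divergent for all `k ∈ θ`: the limits of
`U_θ(γ_n)` for sequences of distinct elements `γ_n` of `Γ`. -/
def flagLimitSet (θ : Finset ℕ) (Γ : Subgroup (PGL d K)) : Set (PartialFlag K d θ) :=
  {F | ∃ (γ : ℕ → PGL d K) (U : ℕ → PartialFlag K d θ), (∀ n, γ n ∈ Γ) ∧ Function.Injective γ ∧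
    (∀ n, IsCartanFlag (γ n) (U n)) ∧ Tendsto U atTop (𝓝 F)}

/-- `Γ` is a `P_θ`-transverse subgroup. -/
def IsTransverseSubgroup (θ : Finset ℕ) (Γ : Subgroup (PGL d K)) : Prop :=
  (∀ k ∈ θ, IsDivergent k Γ) ∧ IsTransverseSet (flagLimitSet θ Γ)

/-! ### Properly convex domains and projectively visible groups -/

/-- The real projective space `P(ℝ^d)`. -/
abbrev RealProj (d : ℕ) : Type := ℙ ℝ (Fin d → ℝ)

/-- The quotient topology on real projective space. -/
instance instTopologicalSpaceRealProj (d : ℕ) : TopologicalSpace (RealProj d) :=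
  TopologicalSpace.coinduced
    (fun v : {v : Fin d → ℝ // v ≠ 0} => Projectivization.mk ℝ v.1 v.2) inferInstance

/-- The part of `Ω` in the affine chart `{[v] | f v ≠ 0}`, which is identified with the affine
hyperplane `{v | f v = 1}`. -/
def chartImage (f : Module.Dual ℝ (Fin d → ℝ)) (Ω : Set (RealProj d)) : Set (Fin d → ℝ) :=
  {v | f v = 1 ∧ ∃ hv : v ≠ 0, Projectivization.mk ℝ v hv ∈ Ω}

/-- `Ω` is a properly convex domain: it is open, non-empty, and a bounded convex subset of some
affine chart. -/
def IsProperlyConvexDomain (Ω : Set (RealProj d)) : Prop :=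
  IsOpen Ω ∧ Ω.Nonempty ∧ ∃ f : Module.Dual ℝ (Fin d → ℝ),
    (∀ (v : Fin d → ℝ) (hv : v ≠ 0), Projectivization.mk ℝ v hv ∈ Ω → f v ≠ 0) ∧
    Convex ℝ (chartImage f Ω) ∧ Bornology.IsBounded (chartImage f Ω)

/-- `Aut(Ω)`: the elements of `PGL(d, ℝ)` that preserve `Ω`. -/
def autGroup (Ω : Set (RealProj d)) : Subgroup (PGL d ℝ) :=
  MulAction.stabilizer (PGL d ℝ) Ω

/-- The full orbital limit set `Λ_Ω(Γ)`. -/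
def orbitalLimitSet (Ω : Set (RealProj d)) (Γ : Subgroup (PGL d ℝ)) : Set (RealProj d) :=
  {z | z ∈ frontier Ω ∧ ∃ x ∈ Ω, ∃ γ : ℕ → PGL d ℝ, (∀ n, γ n ∈ Γ) ∧
    Tendsto (fun n => γ n • x) atTop (𝓝 z)}

/-- The closed projective line segment `[x, y]_Ω` in the closure of `Ω`: the projection of a segment
between a lift of `x` and a lift of `y`, provided that it lies in the closure of `Ω`. -/
def closedProjSegment (Ω : Set (RealProj d)) (x y : RealProj d) : Set (RealProj d) :=
  {p | ∃ (u v : Fin d → ℝ) (hu : u ≠ 0) (hv : v ≠ 0),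
    Projectivization.mk ℝ u hu = x ∧ Projectivization.mk ℝ v hv = y ∧
    (∀ w ∈ segment ℝ u v, ∃ hw : w ≠ 0, Projectivization.mk ℝ w hw ∈ closure Ω) ∧
    ∃ w ∈ segment ℝ u v, ∃ hw : w ≠ 0, Projectivization.mk ℝ w hw = p}

/-- The open projective line segment `(x, y)_Ω`. -/
def openProjSegment (Ω : Set (RealProj d)) (x y : RealProj d) : Set (RealProj d) :=
  closedProjSegment Ω x y \ {x, y}

/-- The projectivization of `H` is a supporting hyperplane to `Ω` at `x`. -/
def IsSupportingHyperplane (Ω : Set (RealProj d)) (x : RealProj d)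
    (H : Submodule ℝ (Fin d → ℝ)) : Prop :=
  Module.finrank ℝ H + 1 = d ∧ x.submodule ≤ H ∧ ∀ p ∈ Ω, ¬ p.submodule ≤ H

/-- `x` is a `C^1` point of the boundary of `Ω`. -/
def IsC1Point (Ω : Set (RealProj d)) (x : RealProj d) : Prop :=
  x ∈ frontier Ω ∧ ∃! H : Submodule ℝ (Fin d → ℝ), IsSupportingHyperplane Ω x H

/-- `Γ` is a projectively visible subgroup of `Aut(Ω)`, where `Ω` is a properly convex domain. -/
structure IsProjectivelyVisible (Ω : Set (RealProj d)) (Γ : Subgroup (PGL d ℝ)) : Prop where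
  discrete : DiscreteTopology Γ
  le_autGroup : Γ ≤ autGroup Ω
  visible : ∀ x ∈ orbitalLimitSet Ω Γ, ∀ y ∈ orbitalLimitSet Ω Γ, openProjSegment Ω x y ⊆ Ω
  isC1Point : ∀ x ∈ orbitalLimitSet Ω Γ, IsC1Point Ω x

/-! ### Transverse representations -/

/-- `ρ : Γ₀ → PGL(d, K)` is a `P_θ`-transverse representation with limit map `ξ`. -/
structure IsTransverseRepWithLimitMap {d₀ : ℕ} (Ω : Set (RealProj d₀)) (Γ₀ : Subgroup (PGL d₀ ℝ))
    (ρ : Γ₀ →* PGL d K) (ξ : orbitalLimitSet Ω Γ₀ → PartialFlag K d θ) : Prop where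
  isEmbedding : IsEmbedding ξ
  equivariant : ∀ (γ : Γ₀) (x : orbitalLimitSet Ω Γ₀),
    ∃ h : (γ : PGL d₀ ℝ) • (x : RealProj d₀) ∈ orbitalLimitSet Ω Γ₀,
      ξ ⟨(γ : PGL d₀ ℝ) • (x : RealProj d₀), h⟩ = ρ γ • ξ x
  transverse : IsTransverseSet (Set.range ξ)
  dynamics : ∀ b ∈ Ω, ∀ (γ : ℕ → Γ₀) (x y : orbitalLimitSet Ω Γ₀),
    Tendsto (fun n => (γ n : PGL d₀ ℝ) • b) atTop (𝓝 (x : RealProj d₀)) →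
    Tendsto (fun n => ((γ n)⁻¹ : PGL d₀ ℝ) • b) atTop (𝓝 (y : RealProj d₀)) →
    ∀ F : PartialFlag K d θ, F.IsTransverse (ξ y) →
      Tendsto (fun n => ρ (γ n) • F) atTop (𝓝 (ξ x))

end TransverseGroups

end

/-! Let a matrix `M` act on the hermitian forms on the `k`-th exterior power of `K^d` by `X ↦ Λ^k M
· X · (Λ^k M)ᴴ`, restricted to the real span of the rank one forms `v vᴴ` with `v` decomposable.
This representation `τ` is real even for `K = ℂ` and turns adjoints into transposes. On `exp(A)` its
highest weight `2(A_1 + … + A_k)` is simple, and the next one is smaller by exactly `A_k - A_{k+1}`.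
Hence the first simple root of `τ(g)` is the `k`-th simple root of `g`
(`PluckerRep.simpleRoot_one_toPGL`).

A `k`-plane gives a highest weight vector `v vᴴ`, and a `(d-k)`-plane gives a functional of the same
shape. Their pairing is a positive multiple of `|det|²`: it is never negative, and it vanishes
exactly when the planes are not complementary. So a flag `F` has a vector `vec F` and a functional
`dual F`. Transverse flags pair positively, while `dual F` kills `vec F` because `F^k ⊆ F^{d-k}`
when `k ≤ d - k`.

The domain comes from duality. The trace, and a whole box of functionals around it, is positive on
all highest weight vectors. Let `S` be the closure of the normalized `Γ`-translates of this box and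
`Ω` the projectivization of the cone where `S` is positive. The box makes `Ω` bounded in a chart,
the spanning property of the highest weight vectors makes it non-empty, and it is invariant by
construction.

Divergence controls `S`. Along distinct elements of `Γ` the rescaled `τ(γ_n)` subconverge to a rank
one matrix `vec F ⊗ dual G` with `F, G` in the limit set (`exists_subseq_isContracting`). So `S`
contains only translates of the box and multiples of functionals `dual G`
(`IsPositiveBox.mem_closure_translates`). Translates are strictly positive at `vec F`, and by
transversality so is `dual G` for `G ≠ F`. Thus `dual F` is, up to scale, the only element of `S`
vanishing at `vec F` (`IsPositiveBox.isStrictBoundary`). This gives both the unique supporting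
hyperplane and visibility.

The same dynamics give discreteness and identify the orbital limit set with the image of `F ↦ [vec
F]`, a continuous injection of a compact space. The limit map is its inverse, and `ρ` is the inverse
of `τ` on `Γ`, which exists since `τ` is injective on `PGL` (`PluckerRep.toPGL_injective`). -/

noncomputable section

namespace TransverseGroups

set_option linter.unusedSectionVars false

open Matrix

/-! ### Minors and tensor powers: Cauchy–Binet over unordered index sequences. -/

section Minors

variable {K : Type*} [RCLike K] {l m n : Type*} [Fintype l] [Fintype m] [Fintype n]
  [DecidableEq l] [DecidableEq m] [DecidableEq n]

/-- The `k`-th tensor power of a matrix. -/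
def tensorPow (k : ℕ) (M : Matrix m n K) : Matrix (Fin k → m) (Fin k → n) K :=
  Matrix.of fun i j => ∏ s, M (i s) (j s)

/-- The matrix of all `k × k` minors, indexed by sequences of rows and columns. -/
def minors (k : ℕ) (M : Matrix m n K) : Matrix (Fin k → m) (Fin k → n) K :=
  Matrix.of fun i j => (M.submatrix i j).det

/-- The vector of maximal minors of a matrix with `k` columns. -/
def maxMinors {k : ℕ} (B : Matrix m (Fin k) K) : (Fin k → m) → K :=
  fun i => (B.submatrix i id).det

lemma tensorPow_mul (k : ℕ) (M : Matrix l m K) (N : Matrix m n K) :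
    tensorPow k (M * N) = tensorPow k M * tensorPow k N := by
  classical
  ext i j
  simp only [tensorPow, Matrix.mul_apply, Matrix.of_apply, Finset.prod_univ_sum,
    Fintype.piFinset_univ, Finset.prod_mul_distrib]

lemma tensorPow_diagonal (k : ℕ) (a : m → K) :
    tensorPow k (Matrix.diagonal a) = Matrix.diagonal fun i : Fin k → m => ∏ s, a (i s) := by
  ext i j
  by_cases h : i = j
  · subst h; simp [tensorPow]
  · obtain ⟨s, hs⟩ := Function.ne_iff.1 h
    rw [Matrix.diagonal_apply_ne _ h]
    exact Finset.prod_eq_zero (Finset.mem_univ s) (Matrix.diagonal_apply_ne _ hs)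

lemma tensorPow_one (k : ℕ) : tensorPow k (1 : Matrix m m K) = 1 := by
  rw [← Matrix.diagonal_one, tensorPow_diagonal]; simp

lemma tensorPow_conjTranspose (k : ℕ) (M : Matrix m n K) :
    tensorPow k Mᴴ = (tensorPow k M)ᴴ := by
  ext i j
  simp [tensorPow, Matrix.conjTranspose_apply]

/-- Each row of `A * M` is a combination of rows of `M`; expanding the determinant multilinearly in
its rows gives a sum over all sequences of row indices. Sequences with repetitions contribute zero,
so nothing has to be sorted. -/
lemma tensorPow_mul_minors (k : ℕ) (A : Matrix l m K) (M : Matrix m n K) :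
    tensorPow k A * minors k M = minors k (A * M) := by
  classical
  ext i j
  have h := (Matrix.detRowAlternating (n := Fin k) (R := K)).toMultilinearMap.map_sum
    (fun (s : Fin k) (p : m) => A (i s) p • fun t => M p (j t))
  have h2 : (minors k (A * M)) i j = Matrix.detRowAlternating
      (fun s => ∑ p : m, A (i s) p • fun t : Fin k => M p (j t)) := by
    change Matrix.det _ = Matrix.det _
    congr 1
    ext s t
    simp [Matrix.mul_apply, Finset.sum_apply]
  rw [h2]
  refine Eq.trans ?_ h.symm
  rw [Matrix.mul_apply]
  refine Finset.sum_congr rfl fun r _ => ?_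
  rw [MultilinearMap.map_smul_univ]
  rfl

lemma minors_conjTranspose (k : ℕ) (M : Matrix m n K) : minors k Mᴴ = (minors k M)ᴴ := by
  ext i j
  simp only [minors, Matrix.of_apply, Matrix.conjTranspose_apply]
  rw [← Matrix.det_conjTranspose]
  rfl

lemma minors_mul_tensorPow (k : ℕ) (M : Matrix l m K) (A : Matrix m n K) :
    minors k M * tensorPow k A = minors k (M * A) := by
  have h := congrArg Matrix.conjTranspose (tensorPow_mul_minors k Aᴴ Mᴴ)
  rwa [Matrix.conjTranspose_mul, tensorPow_conjTranspose, minors_conjTranspose,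
    Matrix.conjTranspose_conjTranspose, Matrix.conjTranspose_conjTranspose,
    ← Matrix.conjTranspose_mul, minors_conjTranspose, Matrix.conjTranspose_conjTranspose] at h

/-- As `B` has exactly `k` columns, each `k × k` minor of `B * Bᴴ` is a product of two maximal
minors. This is the source of the rank one forms `v vᴴ`. -/
lemma minors_mul_conjTranspose {k : ℕ} (B : Matrix m (Fin k) K) :
    minors k (B * Bᴴ) = Matrix.vecMulVec (maxMinors B) (star (maxMinors B)) := by
  ext i j
  simp only [minors, Matrix.of_apply, Matrix.vecMulVec_apply, Pi.star_apply, maxMinors]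
  rw [← Matrix.det_conjTranspose, ← Matrix.det_mul]
  rfl

lemma maxMinors_mul {k : ℕ} (B : Matrix m (Fin k) K) (C : Matrix (Fin k) (Fin k) K) :
    maxMinors (B * C) = C.det • maxMinors B := by
  ext i
  simp only [maxMinors, Pi.smul_apply, smul_eq_mul]
  rw [mul_comm, ← Matrix.det_mul]
  rfl

lemma tensorPow_mulVec_maxMinors {k : ℕ} (A : Matrix m m K) (B : Matrix m (Fin k) K) :
    tensorPow k A *ᵥ maxMinors B = maxMinors (A * B) := by
  ext i
  have h := congrFun (congrFun (tensorPow_mul_minors k A B) i) id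
  rw [Matrix.mul_apply] at h
  exact h

/-- This is Cauchy–Binet; the sum runs over all index sequences, which counts each `k`-subset `k!`
times. Expanding the first determinant by the Leibniz formula, the term of `σ` is a row-permuted
determinant whose sign cancels that of `σ`. -/
lemma star_maxMinors_dotProduct {k : ℕ} (B C : Matrix m (Fin k) K) :
    star (maxMinors B) ⬝ᵥ maxMinors C = (k.factorial : K) * (Bᴴ * C).det := by
  have h : ∀ σ : Equiv.Perm (Fin k), ∑ i : Fin k → m,
      (∏ s, star (B (i (σ s)) s)) * maxMinors C i
        = ((Equiv.Perm.sign σ : ℤ) : K) * (Bᴴ * C).det := by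
    intro σ
    have h2 := congrFun (congrFun (tensorPow_mul_minors k Bᴴ C) (σ⁻¹ : Equiv.Perm (Fin k))) id
    rw [Matrix.mul_apply] at h2
    have h3 : minors k (Bᴴ * C) (σ⁻¹ : Equiv.Perm (Fin k)) id
        = ((Equiv.Perm.sign σ : ℤ) : K) * (Bᴴ * C).det := by
      have := Matrix.det_permute (σ⁻¹) (Bᴴ * C)
      rw [Equiv.Perm.sign_inv] at this
      exact this
    rw [← h3, ← h2]
    refine Finset.sum_congr rfl fun i _ => ?_
    congr 1
    simp only [tensorPow, Matrix.of_apply, Matrix.conjTranspose_apply]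
    rw [← Equiv.prod_comp σ (fun s => star (B (i s) ((σ⁻¹ : Equiv.Perm (Fin k)) s)))]
    simp
  have h1 : star (maxMinors B) ⬝ᵥ maxMinors C = ∑ i : Fin k → m, ∑ σ : Equiv.Perm (Fin k),
      ((Equiv.Perm.sign σ : ℤ) : K) * ((∏ s, star (B (i (σ s)) s)) * maxMinors C i) := by
    refine Finset.sum_congr rfl fun i _ => ?_
    simp only [Pi.star_apply]
    conv_lhs => rw [maxMinors, Matrix.det_apply']
    simp [Finset.sum_mul, mul_assoc]
  rw [h1, Finset.sum_comm]
  simp_rw [← Finset.mul_sum, h, ← mul_assoc, ← Int.cast_mul, ← Units.val_mul, Int.units_mul_self]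
  simp [Fintype.card_perm]

end Minors

end TransverseGroups

namespace TransverseGroups

open Matrix

/-! ### The Plücker representation -/

section TensorSpace

variable (K : Type*) [RCLike K] (d k : ℕ)

/-- The space of sesquilinear forms on the `k`-th tensor power of `K^d`. -/
abbrev TensorSpace := EuclideanSpace K ((Fin k → Fin d) × (Fin k → Fin d))

/-- The matrix of an element of `TensorSpace`. -/
def tensorMat : TensorSpace K d k ≃ₗ[ℝ] Matrix (Fin k → Fin d) (Fin k → Fin d) K where
  toFun X := Matrix.of fun i j => X (i, j)
  invFun Y := WithLp.toLp 2 fun p => Y p.1 p.2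
  map_add' _ _ := rfl
  map_smul' _ _ := rfl
  left_inv _ := rfl
  right_inv _ := rfl

variable {K d k}

lemma inner_tensor (X Y : TensorSpace K d k) :
    inner ℝ X Y = RCLike.re (Matrix.trace ((tensorMat K d k X)ᴴ * tensorMat K d k Y)) := by
  rw [PiLp.inner_apply, Fintype.sum_prod_type, Finset.sum_comm]
  simp only [Matrix.trace, Matrix.diag_apply, Matrix.mul_apply, map_sum,
    Matrix.conjTranspose_apply]
  refine Finset.sum_congr rfl fun i _ => Finset.sum_congr rfl fun j _ => ?_
  change RCLike.re (inner K _ _) = _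
  rw [RCLike.inner_apply, mul_comm]
  rfl

/-- The action of `d × d` matrices on `TensorSpace`. -/
def tensorAction (M : Matrix (Fin d) (Fin d) K) : TensorSpace K d k →ₗ[ℝ] TensorSpace K d k where
  toFun X := (tensorMat K d k).symm (tensorPow k M * tensorMat K d k X * (tensorPow k M)ᴴ)
  map_add' X Y := by rw [map_add, Matrix.mul_add, Matrix.add_mul, map_add]
  map_smul' c X := by
    rw [map_smul, Matrix.mul_smul, Matrix.smul_mul, map_smul, RingHom.id_apply]

lemma tensorMat_tensorAction (M : Matrix (Fin d) (Fin d) K) (X : TensorSpace K d k) :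
    tensorMat K d k (tensorAction M X)
      = tensorPow k M * tensorMat K d k X * (tensorPow k M)ᴴ :=
  (tensorMat K d k).apply_symm_apply _

lemma tensorAction_mul (M N : Matrix (Fin d) (Fin d) K) (X : TensorSpace K d k) :
    tensorAction (M * N) X = tensorAction M (tensorAction N X) := by
  apply (tensorMat K d k).injective
  simp only [tensorMat_tensorAction, tensorPow_mul, Matrix.conjTranspose_mul, Matrix.mul_assoc]

lemma tensorAction_one (X : TensorSpace K d k) : tensorAction 1 X = X := by
  apply (tensorMat K d k).injective
  simp [tensorMat_tensorAction, tensorPow_one]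

lemma inner_tensorAction_left (M : Matrix (Fin d) (Fin d) K) (X Y : TensorSpace K d k) :
    inner ℝ (tensorAction M X) Y = inner ℝ X (tensorAction Mᴴ Y) := by
  rw [inner_tensor, inner_tensor, tensorMat_tensorAction, tensorMat_tensorAction,
    tensorPow_conjTranspose]
  congr 1
  simp only [Matrix.conjTranspose_mul, Matrix.conjTranspose_conjTranspose]
  rw [Matrix.mul_assoc, Matrix.trace_mul_comm]
  simp only [Matrix.mul_assoc]

lemma continuous_tensorAction (X : TensorSpace K d k) :
    Continuous fun M : Matrix (Fin d) (Fin d) K => tensorAction M X := by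
  have h : Continuous fun M : Matrix (Fin d) (Fin d) K => tensorPow k M := by
    refine continuous_matrix fun i j => ?_
    change Continuous fun M : Matrix (Fin d) (Fin d) K => ∏ s, M (i s) (j s)
    exact continuous_finsetProd _ fun s _ =>
      (continuous_id (X := Matrix (Fin d) (Fin d) K)).matrix_elem (i s) (j s)
  have h2 : Continuous fun M : Matrix (Fin d) (Fin d) K =>
      tensorPow k M * tensorMat K d k X * (tensorPow k M)ᴴ :=
    (h.matrix_mul continuous_const).matrix_mul h.matrix_conjTranspose
  refine (PiLp.continuous_toLp 2 _).comp ?_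
  exact continuous_pi fun p => h2.matrix_elem _ _

/-- The hermitian rank one tensor given by the minors of a matrix. -/
def minorTensor (M : Matrix (Fin d) (Fin d) K) : TensorSpace K d k :=
  (tensorMat K d k).symm (minors k M)

lemma tensorMat_minorTensor (M : Matrix (Fin d) (Fin d) K) :
    tensorMat K d k (minorTensor M) = minors k M :=
  (tensorMat K d k).apply_symm_apply _

lemma tensorAction_minorTensor (g M : Matrix (Fin d) (Fin d) K) :
    tensorAction g (minorTensor (k := k) M) = minorTensor (g * M * gᴴ) := by
  apply (tensorMat K d k).injective
  rw [tensorMat_tensorAction, tensorMat_minorTensor, tensorMat_minorTensor, tensorPow_mul_minors,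
    ← tensorPow_conjTranspose, minors_mul_tensorPow]

lemma continuous_minorTensor :
    Continuous fun M : Matrix (Fin d) (Fin d) K => minorTensor (k := k) M := by
  refine (PiLp.continuous_toLp 2 _).comp (continuous_pi fun p => ?_)
  exact (continuous_id.matrix_submatrix _ _).matrix_det

/-- For `v vᴴ` and `w wᴴ` the trace form is `|⟨v, w⟩|²`. This is never negative and vanishes exactly
when `Cᴴ * B` is singular, so transversality of subspaces can be read off as positivity. -/
lemma inner_minorTensor (B C : Matrix (Fin d) (Fin k) K) :
    inner ℝ (minorTensor (k := k) (B * Bᴴ)) (minorTensor (C * Cᴴ))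
      = (k.factorial : ℝ) ^ 2 * ‖(Cᴴ * B).det‖ ^ 2 := by
  rw [inner_tensor, tensorMat_minorTensor, tensorMat_minorTensor, minors_mul_conjTranspose,
    minors_mul_conjTranspose, Matrix.conjTranspose_vecMulVec, star_star,
    Matrix.vecMulVec_mul_vecMulVec, Matrix.vecMulVec_smul, Matrix.trace_smul, Matrix.trace_vecMulVec,
    dotProduct_comm (maxMinors B), star_maxMinors_dotProduct, star_maxMinors_dotProduct,
    smul_eq_mul]
  have h : (Bᴴ * C).det = star (Cᴴ * B).det := by
    rw [← Matrix.det_conjTranspose, Matrix.conjTranspose_mul, Matrix.conjTranspose_conjTranspose]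
  rw [h]
  have : (k.factorial : K) * star (Cᴴ * B).det * (k.factorial * (Cᴴ * B).det)
      = (((k.factorial : ℝ) ^ 2 * ‖(Cᴴ * B).det‖ ^ 2 : ℝ) : K) := by
    push_cast
    rw [← RCLike.conj_mul]
    simp only [RCLike.star_def]
    ring
  rw [this, RCLike.ofReal_re]

variable (K d k) in
/-- The Plücker representation: the real span of the tensors `minorTensor (B * Bᴴ)`. -/
def pluckerSpace : Submodule ℝ (TensorSpace K d k) :=
  Submodule.span ℝ (Set.range fun B : Matrix (Fin d) (Fin k) K => minorTensor (B * Bᴴ))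

lemma minorTensor_mem (B : Matrix (Fin d) (Fin k) K) :
    minorTensor (B * Bᴴ) ∈ pluckerSpace K d k :=
  Submodule.subset_span ⟨B, rfl⟩

lemma mul_mul_conjTranspose_mul (M : Matrix (Fin d) (Fin d) K) (B : Matrix (Fin d) (Fin k) K) :
    M * (B * Bᴴ) * Mᴴ = (M * B) * (M * B)ᴴ := by
  rw [Matrix.conjTranspose_mul]; simp only [Matrix.mul_assoc]

lemma tensorAction_mem (M : Matrix (Fin d) (Fin d) K) {X : TensorSpace K d k}
    (hX : X ∈ pluckerSpace K d k) : tensorAction M X ∈ pluckerSpace K d k := by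
  induction hX using Submodule.span_induction with
  | mem X h =>
    obtain ⟨B, rfl⟩ := h
    rw [tensorAction_minorTensor, mul_mul_conjTranspose_mul]
    exact minorTensor_mem _
  | zero => rw [map_zero]; exact zero_mem _
  | add X Y _ _ hX hY => rw [map_add]; exact add_mem hX hY
  | smul c X _ hX => rw [map_smul]; exact Submodule.smul_mem _ _ hX

variable (K) in
/-- The selection matrix whose columns are the standard basis vectors `e_{f s}`. -/
def selMat {m : ℕ} (f : Fin m → Fin d) : Matrix (Fin d) (Fin m) K :=
  Matrix.of fun i s => if i = f s then 1 else 0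

lemma selMat_submatrix {f : Fin k → Fin d} (hf : Function.Injective f) :
    (selMat K f).submatrix f id = 1 := by
  ext s t
  simp [selMat, Matrix.one_apply, hf.eq_iff]

lemma diagonal_mul_selMat (f : Fin k → Fin d) (a : Fin d → K) :
    Matrix.diagonal a * selMat K f = selMat K f * Matrix.diagonal (a ∘ f) := by
  ext i s
  rw [Matrix.diagonal_mul, Matrix.mul_diagonal]
  by_cases h : i = f s <;> simp [selMat, h]

lemma selMat_conjTranspose_mul_self {m : ℕ} {f : Fin m → Fin d} (hf : Function.Injective f) :
    (selMat K f)ᴴ * selMat K f = 1 := by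
  ext s t
  simp [selMat, Matrix.mul_apply, Matrix.conjTranspose_apply, Matrix.one_apply, hf.eq_iff,
    eq_comm]

end TensorSpace

end TransverseGroups

namespace TransverseGroups

open Matrix

/-! ### The highest weight and the gap below it. -/

section HighestWeight

variable {K : Type*} [RCLike K] {d k : ℕ}

/-- Sums of `k` distinct entries of a decreasing sequence, compared with the sum of the first
`k` entries. -/
lemma sum_comp_add_le {A : Fin d → ℝ} (hA : Antitone A) (hk : 1 ≤ k) (hkd : k < d)
    {i : Fin k → Fin d} (hi : Function.Injective i) :
    ∃ m : ℕ, (m = 0 → ∀ s, (i s : ℕ) < k) ∧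
      ∑ s, A (i s) ≤ ∑ s : Fin k, A (Fin.castLE hkd.le s) + m * (A ⟨k, hkd⟩ - A ⟨k - 1, by omega⟩) := by
  classical
  set J := Finset.univ.image i with hJ
  set T := Finset.univ.image (Fin.castLE hkd.le) with hT
  have hιinj : Function.Injective (Fin.castLE hkd.le) := Fin.castLE_injective _
  have memT : ∀ p : Fin d, p ∈ T ↔ (p : ℕ) < k := by
    intro p
    simp only [hT, Finset.mem_image, Finset.mem_univ, true_and]
    constructor
    · rintro ⟨s, rfl⟩; exact s.2
    · intro h; exact ⟨⟨p, h⟩, rfl⟩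
  have hcard : (J \ T).card = (T \ J).card := by
    apply Finset.card_sdiff_comm
    rw [hJ, hT, Finset.card_image_of_injective _ hi, Finset.card_image_of_injective _ hιinj]
  have e1 : ∑ s, A (i s) = ∑ p ∈ J, A p := by
    rw [hJ, Finset.sum_image fun x _ y _ h => hi h]
  have e2 : ∑ s, A (Fin.castLE hkd.le s) = ∑ p ∈ T, A p := by
    rw [hT, Finset.sum_image fun x _ y _ h => hιinj h]
  have l1 : ∑ p ∈ J \ T, A p ≤ (J \ T).card • A ⟨k, hkd⟩ := by
    refine Finset.sum_le_card_nsmul _ _ _ fun p hp => hA ?_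
    have := (Finset.mem_sdiff.1 hp).2
    rw [memT] at this
    exact Fin.le_def.2 (not_lt.1 this)
  have l2 : (T \ J).card • A ⟨k - 1, by omega⟩ ≤ ∑ p ∈ T \ J, A p := by
    refine Finset.card_nsmul_le_sum _ _ _ fun p hp => hA ?_
    have := (Finset.mem_sdiff.1 hp).1
    rw [memT] at this
    exact Fin.le_def.2 (by simp only; omega)
  -- The count is the number of chosen indices outside the first `k`. Each of them replaces an index
  -- among the first `k`, which costs at least the gap between the consecutive entries `k - 1` and
  -- `k` (indices from zero).
  refine ⟨(J \ T).card, ?_, ?_⟩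
  · intro h s
    rw [Finset.card_eq_zero, Finset.sdiff_eq_empty_iff_subset] at h
    exact (memT _).1 (h (Finset.mem_image_of_mem i (Finset.mem_univ s)))
  · rw [e1, e2, ← Finset.sum_inter_add_sum_sdiff J T, ← Finset.sum_inter_add_sum_sdiff T J,
      Finset.inter_comm T J]
    rw [← hcard] at l2
    simp only [nsmul_eq_mul] at l1 l2
    linarith

variable (K) in
/-- The vectors of the first `k` standard basis vectors. -/
def topMat (hkd : k ≤ d) : Matrix (Fin d) (Fin k) K := selMat K (Fin.castLE hkd)

lemma topMat_conjTranspose_mul_self (hkd : k ≤ d) : (topMat K hkd)ᴴ * topMat K hkd = 1 :=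
  selMat_conjTranspose_mul_self (Fin.castLE_injective _)

lemma topMat_conjTranspose_mul (hkd : k ≤ d) (B : Matrix (Fin d) (Fin k) K) :
    (topMat K hkd)ᴴ * B = B.submatrix (Fin.castLE hkd) id := by
  ext s t
  simp [topMat, selMat, Matrix.mul_apply, Matrix.conjTranspose_apply]

/-- Rows chosen among the first `k` only see the top square block of `B`, and they are obtained from
it by multiplication with a `k × k` selection matrix. -/
lemma maxMinors_eq_mul (hkd : k ≤ d) (B : Matrix (Fin d) (Fin k) K) {i : Fin k → Fin d}
    (hi : ∀ s, (i s : ℕ) < k) :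
    maxMinors B i = maxMinors (topMat K hkd) i * maxMinors B (Fin.castLE hkd) := by
  rw [maxMinors, maxMinors, maxMinors, ← Matrix.det_mul]
  congr 1
  ext s t
  have : ∀ u : Fin k, i s = Fin.castLE hkd u ↔ u = ⟨i s, hi s⟩ := by
    intro u; rw [Fin.ext_iff, Fin.ext_iff]; exact eq_comm
  simp only [Matrix.mul_apply, Matrix.submatrix_apply, topMat, selMat, Matrix.of_apply, id, this,
    ite_mul, one_mul, zero_mul, Finset.sum_ite_eq', Finset.mem_univ, if_true]
  rfl

lemma maxMinors_eq_zero (B : Matrix (Fin d) (Fin k) K) {i : Fin k → Fin d}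
    (hi : ¬ Function.Injective i) : maxMinors B i = 0 := by
  simp only [Function.Injective, not_forall] at hi
  obtain ⟨s, t, h, hst⟩ := hi
  refine Matrix.det_zero_of_row_eq hst ?_
  ext u
  simp [h]

/-- The properties of the coordinates of elements of the Plücker representation. -/
lemma tensorMat_pluckerSpace (hkd : k ≤ d) {X : TensorSpace K d k} (hX : X ∈ pluckerSpace K d k) :
    (∀ i j, tensorMat K d k X i j ≠ 0 → Function.Injective i ∧ Function.Injective j) ∧
    (∀ i j, (∀ s, (i s : ℕ) < k) → (∀ s, (j s : ℕ) < k) → tensorMat K d k X i j =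
      maxMinors (topMat K hkd) i * star (maxMinors (topMat K hkd) j) *
        RCLike.re (tensorMat K d k X (Fin.castLE hkd) (Fin.castLE hkd))) ∧
    inner ℝ (minorTensor (topMat K hkd * (topMat K hkd)ᴴ)) X = (k.factorial : ℝ) ^ 2 *
      RCLike.re (tensorMat K d k X (Fin.castLE hkd) (Fin.castLE hkd)) := by
  -- All three properties are linear over `ℝ`, so only the generators matter. There the entry at the
  -- top index is a squared modulus, hence real; this is what makes the highest weight space
  -- one-dimensional over `ℝ` also when `K = ℂ`.
  induction hX using Submodule.span_induction with
  | mem X h =>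
    obtain ⟨B, rfl⟩ := h
    have hre : RCLike.re (maxMinors B (Fin.castLE hkd) * star (maxMinors B (Fin.castLE hkd)))
        = ‖maxMinors B (Fin.castLE hkd)‖ ^ 2 := by
      rw [RCLike.star_def, RCLike.mul_conj, ← RCLike.ofReal_pow, RCLike.ofReal_re]
    simp only [tensorMat_minorTensor, minors_mul_conjTranspose, Matrix.vecMulVec_apply,
      Pi.star_apply, hre]
    refine ⟨fun i j hij => ⟨?_, ?_⟩, fun i j hi hj => ?_, ?_⟩
    · by_contra h; exact hij (by rw [maxMinors_eq_zero B h, zero_mul])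
    · by_contra h; exact hij (by rw [maxMinors_eq_zero B h, star_zero, mul_zero])
    · rw [maxMinors_eq_mul hkd B hi, maxMinors_eq_mul hkd B hj, star_mul', RCLike.ofReal_pow,
        ← RCLike.mul_conj, RCLike.star_def]
      ring
    · rw [inner_minorTensor, ← norm_star (Bᴴ * topMat K hkd).det, ← Matrix.det_conjTranspose, Matrix.conjTranspose_mul,
        Matrix.conjTranspose_conjTranspose, topMat_conjTranspose_mul]
      rfl
  | zero => simp
  | add X Y _ _ hX hY =>
    refine ⟨fun i j hij => ?_, fun i j hi hj => ?_, ?_⟩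
    · by_cases h : tensorMat K d k X i j = 0
      · refine hY.1 i j fun h' => hij ?_
        rw [map_add, Matrix.add_apply, h, h', add_zero]
      · exact hX.1 i j h
    · rw [map_add, Matrix.add_apply, hX.2.1 i j hi hj, hY.2.1 i j hi hj, Matrix.add_apply, map_add,
        RCLike.ofReal_add, mul_add]
    · rw [inner_add_right, hX.2.2, hY.2.2, map_add, Matrix.add_apply, map_add, mul_add]
  | smul c X _ hX =>
    refine ⟨fun i j hij => ?_, fun i j hi hj => ?_, ?_⟩
    · refine hX.1 i j fun h => hij ?_
      rw [map_smul, Matrix.smul_apply, h, smul_zero]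
    · rw [map_smul, Matrix.smul_apply, hX.2.1 i j hi hj, Matrix.smul_apply, RCLike.smul_re,
        RCLike.ofReal_mul, RCLike.real_smul_eq_coe_mul]
      ring
    · rw [inner_smul_right, hX.2.2, map_smul, Matrix.smul_apply, RCLike.smul_re]
      ring

/-- The matrix `exp(A)`, for a real diagonal matrix `A`. -/
def expDiag (K : Type*) [RCLike K] {d : ℕ} (A : Fin d → ℝ) : Matrix (Fin d) (Fin d) K :=
  Matrix.diagonal fun i => ((Real.exp (A i) : ℝ) : K)

lemma expDiag_conjTranspose (A : Fin d → ℝ) : (expDiag K A)ᴴ = expDiag K A := by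
  rw [expDiag, Matrix.diagonal_conjTranspose]
  congr 1
  ext i
  simp

lemma tensorPow_expDiag (A : Fin d → ℝ) : tensorPow k (expDiag K A)
    = Matrix.diagonal fun i : Fin k → Fin d => ((Real.exp (∑ s, A (i s)) : ℝ) : K) := by
  rw [expDiag, tensorPow_diagonal]
  congr 1
  ext i
  rw [Real.exp_sum, RCLike.ofReal_prod]

lemma tensorMat_expDiag (A : Fin d → ℝ) (X : TensorSpace K d k) (i j : Fin k → Fin d) :
    tensorMat K d k (tensorAction (expDiag K A) X) i j
      = ((Real.exp (∑ s, A (i s) + ∑ s, A (j s)) : ℝ) : K) * tensorMat K d k X i j := by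
  rw [tensorMat_tensorAction, ← tensorPow_conjTranspose, expDiag_conjTranspose, tensorPow_expDiag,
    Matrix.mul_diagonal, Matrix.diagonal_mul, Real.exp_add, RCLike.ofReal_mul]
  ring

/-- The entries of `X` are weight coordinates. Orthogonality to the top tensor kills every entry
whose two index sequences both lie in the first `k`; any other non-zero entry uses at least one
exchange, so its weight is at most the highest weight minus one gap. -/
lemma norm_tensorAction_expDiag_le {A : Fin d → ℝ} (hA : Antitone A) (hk : 1 ≤ k) (hkd : k < d)
    {X : TensorSpace K d k} (hX : X ∈ pluckerSpace K d k)
    (hX0 : inner ℝ (minorTensor (topMat K hkd.le * (topMat K hkd.le)ᴴ)) X = 0) :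
    ‖tensorAction (expDiag K A) X‖ ≤ Real.exp (2 * ∑ s : Fin k, A (Fin.castLE hkd.le s) +
      (A ⟨k, hkd⟩ - A ⟨k - 1, by omega⟩)) * ‖X‖ := by
  obtain ⟨h1, h2, h3⟩ := tensorMat_pluckerSpace hkd.le hX
  have hX00 : RCLike.re (tensorMat K d k X (Fin.castLE hkd.le) (Fin.castLE hkd.le)) = 0 := by
    rw [hX0] at h3
    have : (k.factorial : ℝ) ^ 2 ≠ 0 := by positivity
    exact (mul_eq_zero.1 h3.symm).resolve_left this
  set c := Real.exp (2 * ∑ s : Fin k, A (Fin.castLE hkd.le s) +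
      (A ⟨k, hkd⟩ - A ⟨k - 1, by omega⟩)) with hc
  have hδ : A ⟨k, hkd⟩ - A ⟨k - 1, by omega⟩ ≤ 0 :=
    sub_nonpos.2 (hA (Fin.le_def.2 (by simp)))
  have key : ∀ i j, ‖tensorMat K d k (tensorAction (expDiag K A) X) i j‖
      ≤ c * ‖tensorMat K d k X i j‖ := by
    intro i j
    rw [tensorMat_expDiag, norm_mul, RCLike.norm_ofReal, abs_of_pos (Real.exp_pos _)]
    by_cases h0 : tensorMat K d k X i j = 0
    · simp [h0]
    refine mul_le_mul_of_nonneg_right (Real.exp_le_exp.2 ?_) (norm_nonneg _)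
    obtain ⟨hi, hj⟩ := h1 i j h0
    obtain ⟨m, hm, hm2⟩ := sum_comp_add_le hA hk hkd hi
    obtain ⟨n, hn, hn2⟩ := sum_comp_add_le hA hk hkd hj
    have hmn : 1 ≤ m + n := by
      by_contra hlt
      refine h0 ?_
      rw [h2 i j (hm (by omega)) (hn (by omega)), hX00, RCLike.ofReal_zero, mul_zero]
    have hmn' : (1 : ℝ) ≤ m + n := by exact_mod_cast hmn
    nlinarith
  have hc0 : 0 ≤ c := (Real.exp_pos _).le
  refine le_of_sq_le_sq ?_ (by positivity)
  rw [mul_pow, EuclideanSpace.norm_sq_eq, EuclideanSpace.norm_sq_eq, Finset.mul_sum]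
  refine Finset.sum_le_sum fun p _ => ?_
  rw [← mul_pow]
  exact pow_le_pow_left₀ (norm_nonneg _) (key p.1 p.2) 2

end HighestWeight

end TransverseGroups

namespace TransverseGroups

open Matrix

/-! ### The second highest weight. -/

section SecondWeight

variable {K : Type*} [RCLike K] {d k : ℕ}

/-- The indices of the second highest weight: `1, …, k - 1, k + 1`. -/
def nextIdx (hkd : k < d) : Fin k → Fin d := fun s =>
  if (s : ℕ) + 1 = k then ⟨k, hkd⟩ else Fin.castLE hkd.le s

lemma nextIdx_injective (hkd : k < d) : Function.Injective (nextIdx hkd) := by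
  intro s t h
  unfold nextIdx at h
  ext
  have := s.2
  have := t.2
  split_ifs at h <;> simp [Fin.ext_iff] at h <;> omega

lemma sum_nextIdx (hk : 1 ≤ k) (hkd : k < d) (A : Fin d → ℝ) :
    ∑ s, A (nextIdx hkd s) = ∑ s : Fin k, A (Fin.castLE hkd.le s) +
      (A ⟨k, hkd⟩ - A ⟨k - 1, by omega⟩) := by
  rw [← sub_eq_iff_eq_add', ← Finset.sum_sub_distrib,
    Finset.sum_eq_single (⟨k - 1, by omega⟩ : Fin k)]
  · rw [nextIdx, if_pos (by simp only; omega)]; rfl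
  · intro s _ hs
    rw [nextIdx, if_neg, sub_self]
    intro h
    exact hs (Fin.ext (by simp only; omega))
  · simp

lemma tensorPow_expDiag_mulVec (A : Fin d → ℝ) (f : Fin k → Fin d) :
    tensorPow k (expDiag K A) *ᵥ maxMinors (selMat K f)
      = ((Real.exp (∑ s, A (f s)) : ℝ) : K) • maxMinors (selMat K f) := by
  rw [tensorPow_mulVec_maxMinors, expDiag, diagonal_mul_selMat, maxMinors_mul, Matrix.det_diagonal,
    Real.exp_sum, RCLike.ofReal_prod]
  rfl

lemma tensorPow_expDiag_vecMulVec (A : Fin d → ℝ) (f g : Fin k → Fin d) :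
    tensorPow k (expDiag K A) *
        Matrix.vecMulVec (maxMinors (selMat K f)) (star (maxMinors (selMat K g))) *
        (tensorPow k (expDiag K A))ᴴ
      = Real.exp (∑ s, A (f s) + ∑ s, A (g s)) •
        Matrix.vecMulVec (maxMinors (selMat K f)) (star (maxMinors (selMat K g))) := by
  rw [Matrix.mul_vecMulVec, Matrix.vecMulVec_mul, ← Matrix.star_mulVec, tensorPow_expDiag_mulVec,
    tensorPow_expDiag_mulVec]
  ext i j
  simp only [Matrix.vecMulVec_apply, Pi.smul_apply, Pi.star_apply, smul_eq_mul, Matrix.smul_apply,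
    star_mul', RCLike.star_def, RCLike.conj_ofReal, Real.exp_add, RCLike.real_smul_eq_coe_mul,
    RCLike.ofReal_mul]
  ring

variable (K) in
/-- A matrix whose maximal minors are the sum of the two highest weight vectors. -/
def mixMat (hkd : k < d) : Matrix (Fin d) (Fin k) K := Matrix.of fun i s =>
  topMat K hkd.le i s + if (s : ℕ) + 1 = k then selMat K (nextIdx hkd) i s else 0

/-- The last column of `mixMat` is the sum of two consecutive basis vectors, and a determinant is
additive in that column. -/
lemma maxMinors_mixMat (hk : 1 ≤ k) (hkd : k < d) : maxMinors (mixMat K hkd)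
    = maxMinors (topMat K hkd.le) + maxMinors (selMat K (nextIdx hkd)) := by
  ext i
  set p : Fin k := ⟨k - 1, by omega⟩ with hp
  have hpe : ∀ s : Fin k, (s : ℕ) + 1 = k ↔ s = p := by
    intro s; rw [Fin.ext_iff, hp]; simp only; omega
  have e1 : (mixMat K hkd).submatrix i id = ((topMat K hkd.le).submatrix i id).updateCol p
      ((fun r => topMat K hkd.le (i r) p) + fun r => selMat K (nextIdx hkd) (i r) p) := by
    ext r s
    by_cases h : s = p
    · subst h; simp [mixMat, hpe]
    · simp [mixMat, hpe, h]
  have e2 : ((topMat K hkd.le).submatrix i id).updateCol p (fun r => topMat K hkd.le (i r) p)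
      = (topMat K hkd.le).submatrix i id := by
    ext r s
    by_cases h : s = p
    · subst h; simp
    · simp [Matrix.updateCol_ne h]
  have e3 : ((topMat K hkd.le).submatrix i id).updateCol p
      (fun r => selMat K (nextIdx hkd) (i r) p) = (selMat K (nextIdx hkd)).submatrix i id := by
    ext r s
    by_cases h : s = p
    · subst h; simp
    · have : nextIdx hkd s = Fin.castLE hkd.le s := by
        rw [nextIdx, if_neg]; rwa [hpe]
      simp [Matrix.updateCol_ne h, topMat, selMat, this]
  change ((mixMat K hkd).submatrix i id).det = ((topMat K hkd.le).submatrix i id).det +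
    ((selMat K (nextIdx hkd)).submatrix i id).det
  rw [e1, Matrix.det_updateCol_add, e2, e3]

variable (K) in
/-- A vector of the second highest weight. -/
def secondVector (hkd : k < d) : TensorSpace K d k :=
  minorTensor (mixMat K hkd * (mixMat K hkd)ᴴ)
    - minorTensor (topMat K hkd.le * (topMat K hkd.le)ᴴ)
    - minorTensor (selMat K (nextIdx hkd) * (selMat K (nextIdx hkd))ᴴ)

lemma secondVector_mem (hkd : k < d) : secondVector K hkd ∈ pluckerSpace K d k :=
  sub_mem (sub_mem (minorTensor_mem _) (minorTensor_mem _)) (minorTensor_mem _)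

/-- Polarization: `(v + w)(v + w)ᴴ - v vᴴ - w wᴴ = v wᴴ + w vᴴ`. The cross terms mix the two largest
weights on `Λ^k`, and this is how they enter the real span of the rank one forms. -/
lemma tensorMat_secondVector (hk : 1 ≤ k) (hkd : k < d) : tensorMat K d k (secondVector K hkd) =
    Matrix.vecMulVec (maxMinors (topMat K hkd.le)) (star (maxMinors (selMat K (nextIdx hkd)))) +
    Matrix.vecMulVec (maxMinors (selMat K (nextIdx hkd))) (star (maxMinors (topMat K hkd.le))) := by
  simp only [secondVector, map_sub, tensorMat_minorTensor, minors_mul_conjTranspose,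
    maxMinors_mixMat hk hkd]
  rw [star_add, Matrix.add_vecMulVec, Matrix.vecMulVec_add, Matrix.vecMulVec_add]
  abel

lemma tensorAction_secondVector (hk : 1 ≤ k) (hkd : k < d) (A : Fin d → ℝ) :
    tensorAction (expDiag K A) (secondVector K hkd) =
      Real.exp (2 * ∑ s : Fin k, A (Fin.castLE hkd.le s) +
        (A ⟨k, hkd⟩ - A ⟨k - 1, by omega⟩)) • secondVector K hkd := by
  apply (tensorMat K d k).injective
  rw [tensorMat_tensorAction, map_smul, tensorMat_secondVector hk, Matrix.mul_add, Matrix.add_mul,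
    topMat, tensorPow_expDiag_vecMulVec, tensorPow_expDiag_vecMulVec, sum_nextIdx hk, smul_add]
  congr 3 <;> ring

lemma tensorAction_topTensor (hkd : k ≤ d) (A : Fin d → ℝ) :
    tensorAction (expDiag K A) (minorTensor (k := k) (topMat K hkd * (topMat K hkd)ᴴ)) =
      Real.exp (2 * ∑ s : Fin k, A (Fin.castLE hkd s)) •
        minorTensor (topMat K hkd * (topMat K hkd)ᴴ) := by
  apply (tensorMat K d k).injective
  rw [tensorMat_tensorAction, map_smul, tensorMat_minorTensor, minors_mul_conjTranspose,
    topMat, tensorPow_expDiag_vecMulVec, two_mul]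

lemma maxMinors_nextIdx_top (hk : 1 ≤ k) (hkd : k < d) :
    maxMinors (selMat K (nextIdx hkd)) (Fin.castLE hkd.le) = 0 := by
  refine Matrix.det_eq_zero_of_row_eq_zero ⟨k - 1, by omega⟩ fun t => ?_
  have : (⟨k - 1, by omega⟩ : Fin d) ≠ nextIdx hkd t := by
    unfold nextIdx
    intro h
    split_ifs at h <;> simp [Fin.ext_iff] at h <;> omega
  simp only [selMat, Matrix.submatrix_apply, Matrix.of_apply, id]
  exact if_neg this

lemma inner_secondVector (hk : 1 ≤ k) (hkd : k < d) :
    inner ℝ (minorTensor (topMat K hkd.le * (topMat K hkd.le)ᴴ)) (secondVector K hkd) = 0 := by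
  rw [(tensorMat_pluckerSpace hkd.le (secondVector_mem hkd)).2.2, tensorMat_secondVector hk]
  simp [Matrix.vecMulVec_apply, maxMinors_nextIdx_top hk]

lemma secondVector_ne_zero (hk : 1 ≤ k) (hkd : k < d) : secondVector K hkd ≠ 0 := by
  intro h
  have h2 := congrArg (fun Y => tensorMat K d k Y (Fin.castLE hkd.le) (nextIdx hkd)) h
  simp only [tensorMat_secondVector hk, Matrix.add_apply, Matrix.vecMulVec_apply, Pi.star_apply,
    maxMinors_nextIdx_top hk, zero_mul, add_zero, map_zero, Matrix.zero_apply] at h2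
  rw [maxMinors, maxMinors, selMat_submatrix (nextIdx_injective hkd), topMat,
    selMat_submatrix (Fin.castLE_injective _)] at h2
  simp at h2

end SecondWeight

end TransverseGroups

namespace TransverseGroups

open Matrix

/-- A proximal orthogonal representation of `d × d` matrices, with a compatible family of highest
weight vectors indexed by the positive semidefinite matrices of rank at most `k`, such that the
gap between its two highest weights is the `k`-th simple root. -/
structure PluckerRep (K : Type*) [RCLike K] (d k : ℕ) (hkd : k < d) where
  /-- the dimension -/
  n : ℕ
  /-- the representation -/
  τ : Matrix (Fin d) (Fin d) K →* Matrix (Fin n) (Fin n) ℝ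
  /-- the highest weight vectors -/
  x : Matrix (Fin d) (Fin d) K → (Fin n → ℝ)
  continuous_τ : Continuous τ
  τ_conjTranspose : ∀ M, τ Mᴴ = (τ M)ᵀ
  continuous_x : Continuous x
  τ_x : ∀ (M : Matrix (Fin d) (Fin d) K) (B : Matrix (Fin d) (Fin k) K),
    τ M *ᵥ x (B * Bᴴ) = x (M * (B * Bᴴ) * Mᴴ)
  x_dotProduct : ∃ c : ℝ, 0 < c ∧ ∀ B C : Matrix (Fin d) (Fin k) K,
    x (B * Bᴴ) ⬝ᵥ x (C * Cᴴ) = c * ‖(Cᴴ * B).det‖ ^ 2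
  τ_smul_one : ∀ u : K, τ (u • 1) = (‖u‖ ^ (2 * k)) • 1
  τ_top : ∀ A : Fin d → ℝ, τ (expDiag K A) *ᵥ x (topMat K hkd.le * (topMat K hkd.le)ᴴ) =
    Real.exp (2 * ∑ s : Fin k, A (Fin.castLE hkd.le s)) •
      x (topMat K hkd.le * (topMat K hkd.le)ᴴ)
  τ_le : ∀ A : Fin d → ℝ, Antitone A → ∀ v : Fin n → ℝ,
    x (topMat K hkd.le * (topMat K hkd.le)ᴴ) ⬝ᵥ v = 0 →
    (τ (expDiag K A) *ᵥ v) ⬝ᵥ (τ (expDiag K A) *ᵥ v) ≤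
      Real.exp (2 * ∑ s : Fin k, A (Fin.castLE hkd.le s) +
        (A ⟨k, hkd⟩ - A ⟨k - 1, by omega⟩)) ^ 2 * (v ⬝ᵥ v)
  exists_second : ∃ w : Fin n → ℝ, w ≠ 0 ∧ x (topMat K hkd.le * (topMat K hkd.le)ᴴ) ⬝ᵥ w = 0 ∧
    ∀ A : Fin d → ℝ, τ (expDiag K A) *ᵥ w =
      Real.exp (2 * ∑ s : Fin k, A (Fin.castLE hkd.le s) +
        (A ⟨k, hkd⟩ - A ⟨k - 1, by omega⟩)) • w
  eq_zero_of_dotProduct : ∀ v : Fin n → ℝ,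
    (∀ B : Matrix (Fin d) (Fin k) K, v ⬝ᵥ x (B * Bᴴ) = 0) → v = 0
  -- A full box, rather than one positive functional, is required: the openness of the box is what
  -- later bounds the domain in an affine chart.
  exists_pos : ∃ (t : Fin n → ℝ) (ε : ℝ), 0 < ε ∧ ∀ b : Fin n → ℝ, (∀ i, |b i - t i| ≤ ε) →
    ∀ B : Matrix (Fin d) (Fin k) K, x (B * Bᴴ) ≠ 0 → 0 < b ⬝ᵥ x (B * Bᴴ)

/-! ### The representation in orthonormal coordinates. -/

section Construction

variable {K : Type*} [RCLike K] {d k : ℕ}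

/-- The scalar `u^k` appears on the left and its conjugate on the right. The resulting factor is
positive, so the action on cones, and not only on lines, does not depend on the representative up to
positive scaling. -/
lemma tensorAction_smul_one (u : K) (X : TensorSpace K d k) :
    tensorAction (u • 1) X = (‖u‖ ^ (2 * k)) • X := by
  apply (tensorMat K d k).injective
  have h : tensorPow k (u • (1 : Matrix (Fin d) (Fin d) K)) = u ^ k • 1 := by
    have : u • (1 : Matrix (Fin d) (Fin d) K) = Matrix.diagonal fun _ => u := by
      ext i j; simp [Matrix.one_apply, Matrix.diagonal_apply]
    rw [this, tensorPow_diagonal]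
    ext i j
    by_cases hij : i = j
    · subst hij; simp
    · simp [hij]
  rw [tensorMat_tensorAction, h, map_smul, Matrix.conjTranspose_smul, Matrix.conjTranspose_one,
    Matrix.smul_mul, Matrix.one_mul, Matrix.mul_smul, Matrix.mul_one, smul_smul]
  ext i j
  rw [Matrix.smul_apply, Matrix.smul_apply, RCLike.real_smul_eq_coe_mul, smul_eq_mul, pow_mul,
    RCLike.ofReal_pow, RCLike.ofReal_pow, ← RCLike.conj_mul, mul_pow, RCLike.star_def, map_pow]

/-- For a form `v vᴴ` both the trace and the Hilbert–Schmidt norm equal `|v|²`. Hence the trace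
functional is uniformly positive on the highest weight vectors. -/
lemma re_trace_minorTensor (B : Matrix (Fin d) (Fin k) K) :
    RCLike.re (Matrix.trace (tensorMat K d k (minorTensor (B * Bᴴ))))
      = ‖minorTensor (k := k) (B * Bᴴ)‖ := by
  have h1 : Matrix.trace (tensorMat K d k (minorTensor (B * Bᴴ)))
      = star (maxMinors B) ⬝ᵥ maxMinors B := by
    rw [tensorMat_minorTensor, minors_mul_conjTranspose, Matrix.trace_vecMulVec, dotProduct_comm]
  have h2 : ‖minorTensor (k := k) (B * Bᴴ)‖ ^ 2
      = ‖Matrix.trace (tensorMat K d k (minorTensor (B * Bᴴ)))‖ ^ 2 := by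
    rw [← real_inner_self_eq_norm_sq, inner_minorTensor, h1, star_maxMinors_dotProduct, norm_mul,
      mul_pow, RCLike.norm_natCast]
  have h3 : Matrix.trace (tensorMat K d k (minorTensor (B * Bᴴ)))
      = ((∑ i, ‖maxMinors B i‖ ^ 2 : ℝ) : K) := by
    rw [h1, dotProduct, RCLike.ofReal_sum]
    refine Finset.sum_congr rfl fun i _ => ?_
    rw [Pi.star_apply, RCLike.star_def, RCLike.conj_mul, RCLike.ofReal_pow]
  have h4 : 0 ≤ ∑ i, ‖maxMinors B i‖ ^ 2 := Finset.sum_nonneg fun i _ => by positivity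
  rw [h3, RCLike.norm_ofReal, abs_of_nonneg h4] at h2
  rw [h3, RCLike.ofReal_re]
  exact ((sq_eq_sq₀ (norm_nonneg _) h4).1 h2).symm

instance instFiniteDimensionalTensorSpace : FiniteDimensional ℝ (TensorSpace K d k) :=
  have : FiniteDimensional ℝ K := FiniteDimensional.rclike_to_real
  (WithLp.linearEquiv 2 ℝ (((Fin k → Fin d) × (Fin k → Fin d)) → K)).symm.finiteDimensional

variable (K d k) in
/-- An orthonormal basis of the Plücker representation. -/
def pluckerBasis :
    OrthonormalBasis (Fin (Module.finrank ℝ (pluckerSpace K d k))) ℝ (pluckerSpace K d k) :=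
  stdOrthonormalBasis ℝ (pluckerSpace K d k)

variable (K d k) in
/-- The coordinates with respect to `pluckerBasis`. -/
def pluckerCoord : pluckerSpace K d k ≃ₗ[ℝ] (Fin (Module.finrank ℝ (pluckerSpace K d k)) → ℝ) :=
  (pluckerBasis K d k).toBasis.equivFun

lemma pluckerCoord_apply (X : pluckerSpace K d k) (i) :
    pluckerCoord K d k X i = inner ℝ (pluckerBasis K d k i : TensorSpace K d k) X := by
  rw [pluckerCoord, Module.Basis.equivFun_apply, OrthonormalBasis.coe_toBasis_repr_apply,
    OrthonormalBasis.repr_apply_apply]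
  rfl

lemma pluckerCoord_dotProduct (X Y : pluckerSpace K d k) :
    pluckerCoord K d k X ⬝ᵥ pluckerCoord K d k Y = inner ℝ (X : TensorSpace K d k) Y := by
  have := (pluckerBasis K d k).sum_inner_mul_inner X Y
  rw [← Submodule.coe_inner, ← this]
  refine Finset.sum_congr rfl fun i _ => ?_
  rw [pluckerCoord_apply, pluckerCoord_apply, real_inner_comm]
  rfl

/-- The action of matrices on the Plücker representation. -/
def pluckerAction : Matrix (Fin d) (Fin d) K →* Module.End ℝ (pluckerSpace K d k) where
  toFun M := (tensorAction M).restrict fun _ h => tensorAction_mem M h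
  map_one' := by ext1 X; exact Subtype.ext (tensorAction_one _)
  map_mul' M N := by ext1 X; exact Subtype.ext (tensorAction_mul _ _ _)

variable (K d k) in
/-- The action of matrices on the Plücker representation, in coordinates. -/
def pluckerMatrix : Matrix (Fin d) (Fin d) K →* Matrix (Fin (Module.finrank ℝ (pluckerSpace K d k)))
    (Fin (Module.finrank ℝ (pluckerSpace K d k))) ℝ where
  toFun M := LinearMap.toMatrix (pluckerBasis K d k).toBasis (pluckerBasis K d k).toBasis
    (pluckerAction M)
  map_one' := by rw [map_one]; exact LinearMap.toMatrix_one _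
  map_mul' M N := by rw [map_mul]; exact LinearMap.toMatrix_mul _ _ _

lemma pluckerMatrix_mulVec (M : Matrix (Fin d) (Fin d) K) (X : pluckerSpace K d k) :
    pluckerMatrix K d k M *ᵥ pluckerCoord K d k X = pluckerCoord K d k (pluckerAction M X) :=
  LinearMap.toMatrix_mulVec_repr (pluckerBasis K d k).toBasis (pluckerBasis K d k).toBasis
    (pluckerAction M) X

lemma pluckerMatrix_apply (M : Matrix (Fin d) (Fin d) K) (i j) : pluckerMatrix K d k M i j =
    inner ℝ (pluckerBasis K d k i : TensorSpace K d k)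
      (tensorAction M (pluckerBasis K d k j : TensorSpace K d k)) := by
  have h : pluckerMatrix K d k M i j = pluckerCoord K d k
      (pluckerAction M ((pluckerBasis K d k).toBasis j)) i :=
    LinearMap.toMatrix_apply _ _ _ _ _
  rw [h, pluckerCoord_apply, OrthonormalBasis.coe_toBasis]
  rfl

/-- The highest weight vectors in coordinates. -/
def pluckerVector (M : Matrix (Fin d) (Fin d) K) :
    Fin (Module.finrank ℝ (pluckerSpace K d k)) → ℝ := fun i =>
  inner ℝ (pluckerBasis K d k i : TensorSpace K d k) (minorTensor M)

lemma pluckerVector_eq (M : Matrix (Fin d) (Fin d) K)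
    (hM : minorTensor M ∈ pluckerSpace K d k) :
    pluckerVector (k := k) M = pluckerCoord K d k ⟨_, hM⟩ := by
  ext i; rw [pluckerCoord_apply]; rfl

/-- The Plücker representation. -/
def pluckerRep (K : Type*) [RCLike K] {d k : ℕ} (hk : 1 ≤ k) (hkd : k < d) :
    PluckerRep K d k hkd where
  n := Module.finrank ℝ (pluckerSpace K d k)
  τ := pluckerMatrix K d k
  x := pluckerVector
  continuous_τ := continuous_matrix fun i j => by
    simp_rw [pluckerMatrix_apply]
    exact continuous_const.inner (continuous_tensorAction _)
  τ_conjTranspose M := by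
    ext i j
    rw [Matrix.transpose_apply, pluckerMatrix_apply, pluckerMatrix_apply, ← inner_tensorAction_left,
      real_inner_comm]
  continuous_x := continuous_pi fun i => continuous_const.inner continuous_minorTensor
  τ_x M B := by
    have h : minorTensor (k := k) (M * (B * Bᴴ) * Mᴴ) ∈ pluckerSpace K d k := by
      rw [mul_mul_conjTranspose_mul]; exact minorTensor_mem _
    rw [pluckerVector_eq _ (minorTensor_mem B), pluckerVector_eq _ h, pluckerMatrix_mulVec]
    congr 1
    exact Subtype.ext (tensorAction_minorTensor _ _)
  x_dotProduct := ⟨(k.factorial : ℝ) ^ 2, by positivity, fun B C => by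
    rw [pluckerVector_eq _ (minorTensor_mem B), pluckerVector_eq _ (minorTensor_mem C),
      pluckerCoord_dotProduct, inner_minorTensor]⟩
  τ_smul_one u := by
    ext i j
    rw [pluckerMatrix_apply, tensorAction_smul_one, inner_smul_right, Matrix.smul_apply,
      Matrix.one_apply, smul_eq_mul, ← Submodule.coe_inner]
    congr 1
    exact OrthonormalBasis.inner_eq_ite _ _ _
  τ_top A := by
    rw [pluckerVector_eq _ (minorTensor_mem _), pluckerMatrix_mulVec, ← map_smul]
    congr 1
    exact Subtype.ext (tensorAction_topTensor hkd.le A)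
  τ_le A hA v hv := by
    obtain ⟨X, rfl⟩ := (pluckerCoord K d k).surjective v
    rw [pluckerVector_eq _ (minorTensor_mem _), pluckerCoord_dotProduct] at hv
    rw [pluckerMatrix_mulVec, pluckerCoord_dotProduct, pluckerCoord_dotProduct,
      real_inner_self_eq_norm_sq, real_inner_self_eq_norm_sq, ← mul_pow]
    exact pow_le_pow_left₀ (norm_nonneg _) (norm_tensorAction_expDiag_le hA hk hkd X.2 hv) 2
  exists_second := by
    refine ⟨pluckerCoord K d k ⟨_, secondVector_mem hkd⟩, ?_, ?_, fun A => ?_⟩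
    · rw [Ne, LinearEquiv.map_eq_zero_iff, Submodule.mk_eq_zero]
      exact secondVector_ne_zero hk hkd
    · rw [pluckerVector_eq _ (minorTensor_mem _), pluckerCoord_dotProduct]
      exact inner_secondVector hk hkd
    · rw [pluckerMatrix_mulVec, ← map_smul]
      congr 1
      exact Subtype.ext (tensorAction_secondVector hk hkd A)
  eq_zero_of_dotProduct v hv := by
    obtain ⟨X, rfl⟩ := (pluckerCoord K d k).surjective v
    rw [LinearEquiv.map_eq_zero_iff, ← Submodule.coe_eq_zero, ← inner_self_eq_zero (𝕜 := ℝ)]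
    have : ∀ Y ∈ pluckerSpace K d k, inner ℝ (X : TensorSpace K d k) Y = 0 := by
      intro Y hY
      induction hY using Submodule.span_induction with
      | mem Y h =>
        obtain ⟨B, rfl⟩ := h
        have := hv B
        rwa [pluckerVector_eq _ (minorTensor_mem _), pluckerCoord_dotProduct] at this
      | zero => exact inner_zero_right _
      | add Y Z _ _ hY hZ => rw [inner_add_right, hY, hZ, add_zero]
      | smul c Y _ hY => rw [inner_smul_right, hY, mul_zero]
    exact this _ X.2
  exists_pos := by
    set n := Module.finrank ℝ (pluckerSpace K d k) with hn
    -- The centre is the trace functional in coordinates, whose value at a highest weight vector is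
    -- its norm. A perturbation of size `1 / (n + 1)` in each of the `n` coordinates changes this
    -- value by at most `n / (n + 1)` times the norm, so positivity survives.
    refine ⟨fun i => RCLike.re (Matrix.trace (tensorMat K d k (pluckerBasis K d k i))),
      1 / (n + 1), by positivity, fun b hb B hB => ?_⟩
    set t : Fin n → ℝ := fun i => RCLike.re (Matrix.trace (tensorMat K d k (pluckerBasis K d k i)))
      with ht
    rw [pluckerVector_eq _ (minorTensor_mem _)] at hB ⊢
    set X : pluckerSpace K d k := ⟨_, minorTensor_mem B⟩ with hX
    have h1 : t ⬝ᵥ pluckerCoord K d k X = ‖(X : TensorSpace K d k)‖ := by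
      have e : (X : TensorSpace K d k)
          = ∑ i, pluckerCoord K d k X i • (pluckerBasis K d k i : TensorSpace K d k) := by
        conv_lhs => rw [← (pluckerBasis K d k).toBasis.sum_equivFun X]
        simp [pluckerCoord]
      have e2 := re_trace_minorTensor B
      change RCLike.re (Matrix.trace (tensorMat K d k (X : TensorSpace K d k)))
        = ‖(X : TensorSpace K d k)‖ at e2
      rw [← e2]
      conv_rhs => rw [e]
      rw [map_sum, Matrix.trace_sum, map_sum]
      refine Finset.sum_congr rfl fun i _ => ?_
      rw [map_smul, Matrix.trace_smul, RCLike.smul_re, mul_comm]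
    have h2 : ∀ i, |pluckerCoord K d k X i| ≤ ‖(X : TensorSpace K d k)‖ := by
      intro i
      rw [pluckerCoord_apply]
      refine (abs_real_inner_le_norm _ _).trans ?_
      have : ‖(pluckerBasis K d k i : TensorSpace K d k)‖ = 1 :=
        (pluckerBasis K d k).orthonormal.1 i
      rw [this, one_mul]
    have hXpos : 0 < ‖(X : TensorSpace K d k)‖ := by
      rw [norm_pos_iff]
      intro h
      exact hB (by rw [(Submodule.coe_eq_zero).1 h, map_zero])
    have h3 : |(b - t) ⬝ᵥ pluckerCoord K d k X| ≤ n * (1 / (n + 1) * ‖(X : TensorSpace K d k)‖) := by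
      refine (Finset.abs_sum_le_sum_abs _ _).trans ?_
      refine (Finset.sum_le_card_nsmul _ _ (1 / (n + 1) * ‖(X : TensorSpace K d k)‖)
        fun i _ => ?_).trans ?_
      · rw [abs_mul]
        exact mul_le_mul (hb i) (h2 i) (abs_nonneg _) (by positivity)
      · simp [hn]
    have h4 : b ⬝ᵥ pluckerCoord K d k X = t ⬝ᵥ pluckerCoord K d k X
        + (b - t) ⬝ᵥ pluckerCoord K d k X := by
      rw [← add_dotProduct]; congr 1; abel
    have h5 : (n : ℝ) * (1 / (n + 1) * ‖(X : TensorSpace K d k)‖) < ‖(X : TensorSpace K d k)‖ := by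
      rw [← mul_assoc, mul_one_div]
      have : (n : ℝ) / (n + 1) < 1 := by rw [div_lt_one (by positivity)]; linarith
      nlinarith
    have h6 := (abs_le.1 h3).1
    rw [h4, h1]
    linarith

end Construction

end TransverseGroups

namespace TransverseGroups

open Matrix

/-! ### Singular values by the min-max principle. -/

section CourantFischer

variable {𝕜 E F : Type*} [RCLike 𝕜] [NormedAddCommGroup E] [InnerProductSpace 𝕜 E]
  [FiniteDimensional 𝕜 E] [NormedAddCommGroup F] [InnerProductSpace 𝕜 F] [FiniteDimensional 𝕜 F]

lemma norm_sq_apply_eq_sum (T : E →ₗ[𝕜] F) {n : ℕ} (hn : Module.finrank 𝕜 E = n) (v : E) :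
    ‖T v‖ ^ 2 = ∑ p : Fin n, T.singularValues p ^ 2 *
      ‖inner 𝕜 (T.isSymmetric_adjoint_comp_self.eigenvectorBasis hn p) v‖ ^ 2 := by
  set b := T.isSymmetric_adjoint_comp_self.eigenvectorBasis hn with hb
  have h1 : ((‖T v‖ ^ 2 : ℝ) : 𝕜) = inner 𝕜 v ((LinearMap.adjoint T ∘ₗ T) v) := by
    rw [LinearMap.comp_apply, LinearMap.adjoint_inner_right, inner_self_eq_norm_sq_to_K]
    simp
  rw [← b.sum_inner_mul_inner] at h1
  apply RCLike.ofReal_injective (K := 𝕜)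
  rw [h1, RCLike.ofReal_sum]
  refine Finset.sum_congr rfl fun p _ => ?_
  have h2 : inner 𝕜 (b p) ((LinearMap.adjoint T ∘ₗ T) v)
      = ((T.singularValues p ^ 2 : ℝ) : 𝕜) * inner 𝕜 (b p) v := by
    rw [← T.isSymmetric_adjoint_comp_self (b p) v, hb,
      T.isSymmetric_adjoint_comp_self.apply_eigenvectorBasis hn p, inner_smul_left,
      T.sq_singularValues_fin hn p, RCLike.conj_ofReal]
  rw [h2, ← inner_conj_symm v (b p), RCLike.ofReal_mul, RCLike.ofReal_pow (‖inner 𝕜 (b p) v‖),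
    ← RCLike.conj_mul]
  ring

/-- One half of the Courant-Fischer principle. -/
lemma singularValues_le (T : E →ₗ[𝕜] F) {i : ℕ} (hi : i < Module.finrank 𝕜 E)
    (φ : E →ₗ[𝕜] (Fin i → 𝕜)) {s : ℝ} (hs : 0 ≤ s) (h : ∀ v, φ v = 0 → ‖T v‖ ≤ s * ‖v‖) :
    T.singularValues i ≤ s := by
  set b := T.isSymmetric_adjoint_comp_self.eigenvectorBasis rfl with hb
  -- The first `i + 1` eigenvectors of `T* T` span a space on which `T` expands by at least its
  -- `i`-th singular value; for dimension reasons it meets the kernel of the `i` functionals in `φ`.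
  let ψ : (Fin (i + 1) → 𝕜) →ₗ[𝕜] E := Fintype.linearCombination 𝕜 fun p => b (Fin.castLE hi p)
  have hker : (φ ∘ₗ ψ).ker ≠ ⊥ := LinearMap.ker_ne_bot_of_finrank_lt (by simp)
  obtain ⟨c, hc, hc0⟩ := Submodule.exists_mem_ne_zero_of_ne_bot hker
  have hin : ∀ p, inner 𝕜 (b p) (ψ c) = if h : (p : ℕ) < i + 1 then c ⟨p, h⟩ else 0 := by
    intro p
    rw [Fintype.linearCombination_apply, inner_sum]
    simp_rw [inner_smul_right, orthonormal_iff_ite.1 b.orthonormal]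
    split_ifs with hp
    · rw [Finset.sum_eq_single (⟨p, hp⟩ : Fin (i + 1))]
      · simp
      · intro q _ hq
        rw [if_neg, mul_zero]
        intro h
        exact hq (Fin.ext (congrArg Fin.val h).symm)
      · simp
    · refine Finset.sum_eq_zero fun q _ => ?_
      rw [if_neg, mul_zero]
      intro h
      exact hp (by rw [h]; exact q.2)
  have hv0 : ψ c ≠ 0 := by
    intro h0
    apply hc0
    ext q
    have := hin (Fin.castLE hi q)
    rw [h0, inner_zero_right, dif_pos (show (Fin.castLE hi q : ℕ) < i + 1 from q.2)] at this
    exact this.symm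
  have h1 := norm_sq_apply_eq_sum T rfl (ψ c)
  have h2 : ‖ψ c‖ ^ 2 = ∑ p, ‖inner 𝕜 (b p) (ψ c)‖ ^ 2 := (b.sum_sq_norm_inner_right (ψ c)).symm
  have h3 : T.singularValues i ^ 2 * ‖ψ c‖ ^ 2 ≤ ‖T (ψ c)‖ ^ 2 := by
    rw [h1, h2, Finset.mul_sum]
    refine Finset.sum_le_sum fun p _ => ?_
    by_cases hp : (p : ℕ) < i + 1
    · refine mul_le_mul_of_nonneg_right ?_ (by positivity)
      exact pow_le_pow_left₀ (T.singularValues_nonneg _) (T.singularValues_antitone (by omega)) 2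
    · rw [← hb, hin, dif_neg hp]; simp
  have h4 := h _ (show φ (ψ c) = 0 from hc)
  have h5 : T.singularValues i ^ 2 * ‖ψ c‖ ^ 2 ≤ s ^ 2 * ‖ψ c‖ ^ 2 := by
    rw [← mul_pow s]; exact h3.trans (pow_le_pow_left₀ (norm_nonneg _) h4 2)
  have h6 : 0 < ‖ψ c‖ ^ 2 := by have := norm_pos_iff.2 hv0; positivity
  exact le_of_sq_le_sq (le_of_mul_le_mul_right h5 h6) hs

/-- One half of the Courant-Fischer principle. -/
lemma le_singularValues (T : E →ₗ[𝕜] F) {i : ℕ} (φ : (Fin (i + 1) → 𝕜) →ₗ[𝕜] E)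
    (hφ : Function.Injective φ) {s : ℝ} (hs : 0 ≤ s) (h : ∀ c, s * ‖φ c‖ ≤ ‖T (φ c)‖) :
    s ≤ T.singularValues i := by
  set b := T.isSymmetric_adjoint_comp_self.eigenvectorBasis rfl with hb
  have hi : i < Module.finrank 𝕜 E := by
    have := LinearMap.finrank_le_finrank_of_injective hφ
    simp at this
    omega
  -- Dually, the `(i + 1)`-dimensional image of `φ` contains a non-zero vector orthogonal to the
  -- first `i` eigenvectors, where `T` expands by at most its `i`-th singular value.
  let ψ : E →ₗ[𝕜] (Fin i → 𝕜) := LinearMap.pi fun p => (innerₛₗ 𝕜 (b (Fin.castLE hi.le p)))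
  have hker : (ψ ∘ₗ φ).ker ≠ ⊥ := LinearMap.ker_ne_bot_of_finrank_lt (by simp)
  obtain ⟨c, hc, hc0⟩ := Submodule.exists_mem_ne_zero_of_ne_bot hker
  have hv0 : φ c ≠ 0 := fun h0 => hc0 (hφ (by rw [h0, map_zero]))
  have hin : ∀ p : Fin (Module.finrank 𝕜 E), (p : ℕ) < i → inner 𝕜 (b p) (φ c) = 0 := fun p hp =>
    congrFun (show ψ (φ c) = 0 from hc) ⟨p, hp⟩
  have h1 := norm_sq_apply_eq_sum T rfl (φ c)
  have h2 : ‖φ c‖ ^ 2 = ∑ p, ‖inner 𝕜 (b p) (φ c)‖ ^ 2 := (b.sum_sq_norm_inner_right (φ c)).symm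
  have h3 : ‖T (φ c)‖ ^ 2 ≤ T.singularValues i ^ 2 * ‖φ c‖ ^ 2 := by
    rw [h1, h2, Finset.mul_sum]
    refine Finset.sum_le_sum fun p _ => ?_
    by_cases hp : (p : ℕ) < i
    · rw [← hb, hin p hp]; simp
    · refine mul_le_mul_of_nonneg_right ?_ (by positivity)
      exact pow_le_pow_left₀ (T.singularValues_nonneg _) (T.singularValues_antitone (by omega)) 2
  have h5 : s ^ 2 * ‖φ c‖ ^ 2 ≤ T.singularValues i ^ 2 * ‖φ c‖ ^ 2 := by
    rw [← mul_pow s]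
    exact (pow_le_pow_left₀ (mul_nonneg hs (norm_nonneg _)) (h c) 2).trans h3
  have h6 : 0 < ‖φ c‖ ^ 2 := by have := norm_pos_iff.2 hv0; positivity
  exact le_of_sq_le_sq (le_of_mul_le_mul_right h5 h6) (T.singularValues_nonneg _)

end CourantFischer

/-! ### The Cartan projection computed from a Cartan decomposition. -/

section CartanSingularValues

variable {K : Type*} [RCLike K] {d : ℕ}

lemma norm_toLp_sq (v : Fin d → K) : ‖WithLp.toLp 2 v‖ ^ 2 = ∑ i, ‖v i‖ ^ 2 := by
  rw [EuclideanSpace.norm_sq_eq]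

lemma norm_toLp_mulVec_unitary {ℓ : Matrix (Fin d) (Fin d) K}
    (hℓ : ℓ ∈ Matrix.unitaryGroup (Fin d) K) (v : Fin d → K) :
    ‖WithLp.toLp 2 (ℓ *ᵥ v)‖ = ‖WithLp.toLp 2 v‖ := by
  have key : ∀ w : Fin d → K, ((‖WithLp.toLp 2 w‖ ^ 2 : ℝ) : K) = star w ⬝ᵥ w := by
    intro w
    rw [norm_toLp_sq, dotProduct, RCLike.ofReal_sum]
    refine Finset.sum_congr rfl fun i _ => ?_
    rw [Pi.star_apply, RCLike.star_def, RCLike.conj_mul, RCLike.ofReal_pow]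
  have h2 : ‖WithLp.toLp 2 (ℓ *ᵥ v)‖ ^ 2 = ‖WithLp.toLp 2 v‖ ^ 2 := by
    apply RCLike.ofReal_injective (K := K)
    rw [key, key, Matrix.star_mulVec, Matrix.dotProduct_mulVec, Matrix.vecMul_vecMul,
      ← Matrix.star_eq_conjTranspose, Matrix.mem_unitaryGroup_iff'.1 hℓ, Matrix.vecMul_one]
  exact (sq_eq_sq₀ (norm_nonneg _) (norm_nonneg _)).1 h2

/-- The singular values of a matrix with a given Cartan decomposition. -/
lemma singularValues_cartan {ℓ m : Matrix (Fin d) (Fin d) K}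
    (hℓ : ℓ ∈ Matrix.unitaryGroup (Fin d) K) (hm : m ∈ Matrix.unitaryGroup (Fin d) K)
    {A : Fin d → ℝ} (hA : Antitone A) (c : K) (i : Fin d) :
    (Matrix.toEuclideanLin (c • (ℓ * expDiag K A * m))).singularValues i
      = ‖c‖ * Real.exp (A i) := by
  have hT : ∀ v : EuclideanSpace K (Fin d), ‖Matrix.toEuclideanLin (c • (ℓ * expDiag K A * m)) v‖ =
      ‖c‖ * ‖WithLp.toLp 2 (expDiag K A *ᵥ (m *ᵥ v.ofLp))‖ := by
    intro v
    rw [Matrix.toLpLin_apply, Matrix.smul_mulVec, WithLp.toLp_smul, norm_smul,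
      Matrix.mul_assoc, ← Matrix.mulVec_mulVec, norm_toLp_mulVec_unitary hℓ, Matrix.mulVec_mulVec]
  have hD : ∀ (u : Fin d → K) p, ‖(expDiag K A *ᵥ u) p‖ ^ 2 = Real.exp (A p) ^ 2 * ‖u p‖ ^ 2 := by
    intro u p
    rw [expDiag, Matrix.mulVec_diagonal, norm_mul, RCLike.norm_ofReal,
      abs_of_pos (Real.exp_pos _), mul_pow]
  apply le_antisymm
  -- The test functionals are the first `i` coordinates of `m v`; where they vanish, the diagonal
  -- matrix expands by at most `exp (A i)`.
  · refine singularValues_le _ (by simp) (LinearMap.funLeft K K (Fin.castLE i.2.le) ∘ₗ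
      m.mulVecLin ∘ₗ (WithLp.linearEquiv 2 K (Fin d → K)).toLinearMap) (by positivity) ?_
    intro v hv
    rw [hT, mul_assoc]
    refine mul_le_mul_of_nonneg_left ?_ (norm_nonneg _)
    have : ‖v‖ = ‖WithLp.toLp 2 (m *ᵥ v.ofLp)‖ := (norm_toLp_mulVec_unitary hm _).symm
    rw [this]
    refine le_of_sq_le_sq ?_ (by positivity)
    rw [mul_pow, norm_toLp_sq, norm_toLp_sq, Finset.mul_sum]
    refine Finset.sum_le_sum fun p _ => ?_
    rw [hD]
    by_cases hp : p < i
    · have : (m *ᵥ v.ofLp) p = 0 := congrFun hv ⟨p, hp⟩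
      simp [this]
    · refine mul_le_mul_of_nonneg_right ?_ (by positivity)
      exact pow_le_pow_left₀ (Real.exp_pos _).le (Real.exp_le_exp.2 (hA (not_lt.1 hp))) 2
  · have hm' : m * mᴴ = 1 := Matrix.mem_unitaryGroup_iff.1 hm
    have hE : ∀ u : Fin (i + 1) → K, m *ᵥ ((mᴴ * topMat K (Nat.succ_le_of_lt i.2)) *ᵥ u)
        = topMat K (Nat.succ_le_of_lt i.2) *ᵥ u := by
      intro u
      rw [Matrix.mulVec_mulVec, ← Matrix.mul_assoc, hm', Matrix.one_mul]
    -- The test space is the preimage under `m` of the span of the first `i + 1` basis vectors.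
    refine le_singularValues _ ((WithLp.linearEquiv 2 K (Fin d → K)).symm.toLinearMap ∘ₗ
      (mᴴ * topMat K (Nat.succ_le_of_lt i.2)).mulVecLin) ?_ (by positivity) ?_
    · refine (WithLp.linearEquiv 2 K (Fin d → K)).symm.injective.comp ?_
      intro u v huv
      have h1 : topMat K (Nat.succ_le_of_lt i.2) *ᵥ u = topMat K (Nat.succ_le_of_lt i.2) *ᵥ v := by
        rw [← hE, ← hE]; exact congrArg _ huv
      have h2 := congrArg (fun w => (topMat K (Nat.succ_le_of_lt i.2))ᴴ *ᵥ w) h1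
      simpa [Matrix.mulVec_mulVec, topMat_conjTranspose_mul_self] using h2
    · intro u
      rw [hT, mul_assoc]
      refine mul_le_mul_of_nonneg_left ?_ (norm_nonneg _)
      set v : EuclideanSpace K (Fin d) := ((WithLp.linearEquiv 2 K (Fin d → K)).symm.toLinearMap ∘ₗ
        (mᴴ * topMat K (Nat.succ_le_of_lt i.2)).mulVecLin) u with hv
      have : ‖v‖ = ‖WithLp.toLp 2 (m *ᵥ v.ofLp)‖ := (norm_toLp_mulVec_unitary hm _).symm
      rw [this]
      refine le_of_sq_le_sq ?_ (by positivity)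
      rw [mul_pow, norm_toLp_sq, norm_toLp_sq, Finset.mul_sum]
      refine Finset.sum_le_sum fun p _ => ?_
      rw [hD]
      by_cases hp : p ≤ i
      · refine mul_le_mul_of_nonneg_right ?_ (by positivity)
        exact pow_le_pow_left₀ (Real.exp_pos _).le (Real.exp_le_exp.2 (hA hp)) 2
      · have : (m *ᵥ v.ofLp) p = 0 := by
          have e : m *ᵥ v.ofLp = topMat K (Nat.succ_le_of_lt i.2) *ᵥ u := hE u
          rw [e, Matrix.mulVec, dotProduct]
          refine Finset.sum_eq_zero fun q _ => ?_
          rw [topMat, selMat, Matrix.of_apply, if_neg, zero_mul]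
          rintro rfl
          exact hp (Fin.le_def.2 (Nat.lt_succ_iff.1 q.2))
        simp [this]

lemma coe_scalar_units (u : Kˣ) :
    ((Matrix.GeneralLinearGroup.scalar (Fin d) u : Matrix.GeneralLinearGroup (Fin d) K) :
      Matrix (Fin d) (Fin d) K) = (u : K) • 1 := by
  change Matrix.scalar (Fin d) (u : K) = _
  rw [Matrix.scalar_apply, ← Matrix.smul_one_eq_diagonal]

lemma exists_smul_of_mk_eq {B C : Matrix.GeneralLinearGroup (Fin d) K}
    (h : Matrix.ProjGenLinGroup.mk B = Matrix.ProjGenLinGroup.mk C) :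
    ∃ u : K, u ≠ 0 ∧ (C : Matrix (Fin d) (Fin d) K) = u • (B : Matrix (Fin d) (Fin d) K) := by
  obtain ⟨u, hu⟩ := Matrix.ProjGenLinGroup.mk_eq_mk_iff.1 h
  refine ⟨u, u.ne_zero, ?_⟩
  rw [← hu, Units.val_mul, coe_scalar_units, Matrix.mul_smul, Matrix.mul_one]

/-- The simple roots of the Cartan projection can be read off from a Cartan decomposition of
any representative. -/
lemma simpleRoot_cartanProjection {g : PGL d K} {B : Matrix.GeneralLinearGroup (Fin d) K}
    (hB : Matrix.ProjGenLinGroup.mk B = g) {ℓ m : Matrix (Fin d) (Fin d) K}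
    (hℓ : ℓ ∈ Matrix.unitaryGroup (Fin d) K) (hm : m ∈ Matrix.unitaryGroup (Fin d) K)
    {A : Fin d → ℝ} (hA : Antitone A) (hBA : (B : Matrix (Fin d) (Fin d) K) = ℓ * expDiag K A * m)
    {k : ℕ} (hk : 1 ≤ k) (hkd : k < d) :
    simpleRoot k (cartanProjection g) = A ⟨k - 1, by omega⟩ - A ⟨k, hkd⟩ := by
  obtain ⟨u, hu, hC⟩ := exists_smul_of_mk_eq
    (hB.trans (exists_unimodular_rep g).choose_spec.1.symm)
  have key : ∀ i : Fin d, cartanProjection g i = Real.log ‖u‖ + A i := by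
    intro i
    rw [cartanProjection, unimodularRep, hC, hBA, singularValues_cartan hℓ hm hA,
      Real.log_mul (norm_ne_zero_iff.2 hu) (Real.exp_pos _).ne', Real.log_exp]
  rw [simpleRoot, dif_pos ⟨hk, hkd⟩, key, key]
  ring

end CartanSingularValues

end TransverseGroups

namespace TransverseGroups

open Matrix

lemma norm_toLp_sq_real {n : ℕ} (v : Fin n → ℝ) : ‖WithLp.toLp 2 v‖ ^ 2 = v ⬝ᵥ v := by
  rw [norm_toLp_sq, dotProduct]
  exact Finset.sum_congr rfl fun i _ => by rw [Real.norm_eq_abs, sq_abs, sq]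

/-! ### The two largest singular values in the Plücker representation. -/

namespace PluckerRep

variable {K : Type*} [RCLike K] {d k : ℕ} {hkd : k < d} (R : PluckerRep K d k hkd)

/-- The top weight vector. -/
def top : Fin R.n → ℝ := R.x (topMat K hkd.le * (topMat K hkd.le)ᴴ)

lemma top_dotProduct_self_pos : 0 < R.top ⬝ᵥ R.top := by
  obtain ⟨c, hc, h⟩ := R.x_dotProduct
  rw [top, h, topMat_conjTranspose_mul_self]
  simpa using hc

lemma τ_mem_unitaryGroup {ℓ : Matrix (Fin d) (Fin d) K} (hℓ : ℓ ∈ Matrix.unitaryGroup (Fin d) K) :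
    R.τ ℓ ∈ Matrix.unitaryGroup (Fin R.n) ℝ := by
  rw [Matrix.mem_unitaryGroup_iff, Matrix.star_eq_conjTranspose,
    Matrix.conjTranspose_eq_transpose_of_trivial, ← R.τ_conjTranspose, ← map_mul,
    ← Matrix.star_eq_conjTranspose, Matrix.mem_unitaryGroup_iff.1 hℓ, map_one]

/-- The exponent of the highest weight. -/
def topExp (_ : PluckerRep K d k hkd) (A : Fin d → ℝ) : ℝ :=
  2 * ∑ s : Fin k, A (Fin.castLE hkd.le s)

/-- The `k`-th simple root. -/
def gap (_ : PluckerRep K d k hkd) (A : Fin d → ℝ) : ℝ := A ⟨k - 1, by omega⟩ - A ⟨k, hkd⟩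

lemma gap_nonneg {A : Fin d → ℝ} (hA : Antitone A) : 0 ≤ R.gap A :=
  sub_nonneg.2 (hA (Fin.le_def.2 (by simp)))

lemma τ_expDiag_top (A : Fin d → ℝ) :
    R.τ (expDiag K A) *ᵥ R.top = Real.exp (R.topExp A) • R.top := R.τ_top A

/-- The matrix `τ(exp A)` is symmetric, so its eigenvector `top` has an invariant orthogonal
complement. -/
lemma top_dotProduct_τ_expDiag (A : Fin d → ℝ) (v : Fin R.n → ℝ) :
    R.top ⬝ᵥ R.τ (expDiag K A) *ᵥ v = Real.exp (R.topExp A) * (R.top ⬝ᵥ v) := by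
  rw [Matrix.dotProduct_mulVec, ← Matrix.mulVec_transpose, ← R.τ_conjTranspose,
    expDiag_conjTranspose, τ_expDiag_top, smul_dotProduct, smul_eq_mul]

lemma τ_expDiag_le {A : Fin d → ℝ} (hA : Antitone A) {v : Fin R.n → ℝ} (hv : R.top ⬝ᵥ v = 0) :
    (R.τ (expDiag K A) *ᵥ v) ⬝ᵥ (R.τ (expDiag K A) *ᵥ v)
      ≤ Real.exp (R.topExp A - R.gap A) ^ 2 * (v ⬝ᵥ v) := by
  have := R.τ_le A hA v hv
  rwa [show R.topExp A - R.gap A = 2 * ∑ s : Fin k, A (Fin.castLE hkd.le s) +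
      (A ⟨k, hkd⟩ - A ⟨k - 1, by omega⟩) by rw [topExp, gap]; ring]

lemma exists_orthogonal (u : Fin R.n → ℝ) :
    ∃ (α : ℝ) (v : Fin R.n → ℝ), u = α • R.top + v ∧ R.top ⬝ᵥ v = 0 := by
  refine ⟨(R.top ⬝ᵥ u) / (R.top ⬝ᵥ R.top), u - ((R.top ⬝ᵥ u) / (R.top ⬝ᵥ R.top)) • R.top, by simp,
    ?_⟩
  rw [dotProduct_sub, dotProduct_smul, smul_eq_mul, div_mul_cancel₀ _ R.top_dotProduct_self_pos.ne',
    sub_self]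

lemma add_dotProduct_self (α β : ℝ) {v : Fin R.n → ℝ} (hv : R.top ⬝ᵥ v = 0) :
    (α • R.top + β • v) ⬝ᵥ (α • R.top + β • v)
      = α ^ 2 * (R.top ⬝ᵥ R.top) + β ^ 2 * (v ⬝ᵥ v) := by
  simp only [dotProduct_add, add_dotProduct, dotProduct_smul, smul_dotProduct, smul_eq_mul,
    dotProduct_comm v R.top, hv]
  ring

lemma τ_expDiag_le_top {A : Fin d → ℝ} (hA : Antitone A) (u : Fin R.n → ℝ) :
    (R.τ (expDiag K A) *ᵥ u) ⬝ᵥ (R.τ (expDiag K A) *ᵥ u)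
      ≤ Real.exp (R.topExp A) ^ 2 * (u ⬝ᵥ u) := by
  obtain ⟨α, v, rfl, hv⟩ := R.exists_orthogonal u
  have h1 : R.top ⬝ᵥ R.τ (expDiag K A) *ᵥ v = 0 := by rw [top_dotProduct_τ_expDiag, hv, mul_zero]
  have h2 := R.add_dotProduct_self (α * Real.exp (R.topExp A)) 1 h1
  have h3 := R.add_dotProduct_self α 1 hv
  rw [one_smul] at h2 h3
  rw [Matrix.mulVec_add, Matrix.mulVec_smul, τ_expDiag_top, smul_smul, h2, h3]
  have h4 := R.τ_expDiag_le hA hv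
  have h5 : Real.exp (R.topExp A - R.gap A) ^ 2 ≤ Real.exp (R.topExp A) ^ 2 :=
    pow_le_pow_left₀ (Real.exp_pos _).le (Real.exp_le_exp.2 (by linarith [R.gap_nonneg hA])) 2
  have h6 : 0 ≤ v ⬝ᵥ v := by rw [← norm_toLp_sq_real]; positivity
  have h7 := mul_le_mul_of_nonneg_right h5 h6
  nlinarith

lemma norm_toEuclideanLin_τ {ℓ m : Matrix (Fin d) (Fin d) K}
    (hℓ : ℓ ∈ Matrix.unitaryGroup (Fin d) K) (A : Fin d → ℝ) (c : ℝ)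
    (v : EuclideanSpace ℝ (Fin R.n)) :
    ‖Matrix.toEuclideanLin (c • R.τ (ℓ * expDiag K A * m)) v‖ =
      |c| * ‖WithLp.toLp 2 (R.τ (expDiag K A) *ᵥ (R.τ m *ᵥ v.ofLp))‖ := by
  rw [Matrix.toLpLin_apply, Matrix.smul_mulVec, WithLp.toLp_smul, norm_smul, map_mul, map_mul,
    Matrix.mul_assoc, ← Matrix.mulVec_mulVec, norm_toLp_mulVec_unitary (R.τ_mem_unitaryGroup hℓ),
    Matrix.mulVec_mulVec, Real.norm_eq_abs]

variable {ℓ m : Matrix (Fin d) (Fin d) K}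

/-- The min-max lower bound is tested on the preimage under `τ(m)` of the image of `ψ`. As `τ` of a
unitary matrix is orthogonal, only the diagonal factor matters. -/
lemma le_singularValues_τ (hℓ : ℓ ∈ Matrix.unitaryGroup (Fin d) K)
    (hm : m ∈ Matrix.unitaryGroup (Fin d) K)
    {A : Fin d → ℝ} (c : ℝ) {i : ℕ} (ψ : (Fin (i + 1) → ℝ) →ₗ[ℝ] (Fin R.n → ℝ))
    (hψ : Function.Injective ψ) {s : ℝ} (hs : 0 ≤ s)
    (h : ∀ u, s ^ 2 * (ψ u ⬝ᵥ ψ u)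
      ≤ (R.τ (expDiag K A) *ᵥ ψ u) ⬝ᵥ (R.τ (expDiag K A) *ᵥ ψ u)) :
    |c| * s ≤ (Matrix.toEuclideanLin (c • R.τ (ℓ * expDiag K A * m))).singularValues i := by
  have hm' : R.τ m * R.τ mᴴ = 1 := by
    rw [← map_mul, ← Matrix.star_eq_conjTranspose, Matrix.mem_unitaryGroup_iff.1 hm, map_one]
  have hE : ∀ u, R.τ m *ᵥ (R.τ mᴴ *ᵥ ψ u) = ψ u := by
    intro u
    rw [Matrix.mulVec_mulVec, hm', Matrix.one_mulVec]
  refine le_singularValues _ ((WithLp.linearEquiv 2 ℝ (Fin R.n → ℝ)).symm.toLinearMap ∘ₗ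
      (R.τ mᴴ).mulVecLin ∘ₗ ψ) ?_ (by positivity) ?_
  · refine (WithLp.linearEquiv 2 ℝ (Fin R.n → ℝ)).symm.injective.comp ?_
    intro u v huv
    apply hψ
    rw [← hE u, ← hE v]
    exact congrArg (fun w => R.τ m *ᵥ w) huv
  · intro u
    rw [R.norm_toEuclideanLin_τ hℓ, mul_assoc]
    refine mul_le_mul_of_nonneg_left ?_ (abs_nonneg _)
    set v : EuclideanSpace ℝ (Fin R.n) := ((WithLp.linearEquiv 2 ℝ (Fin R.n → ℝ)).symm.toLinearMap ∘ₗ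
      (R.τ mᴴ).mulVecLin ∘ₗ ψ) u with hv
    have e : R.τ m *ᵥ v.ofLp = ψ u := hE u
    have : ‖v‖ = ‖WithLp.toLp 2 (ψ u)‖ := by
      rw [← e]; exact (norm_toLp_mulVec_unitary (R.τ_mem_unitaryGroup hm) _).symm
    rw [this, e]
    refine le_of_sq_le_sq ?_ (norm_nonneg _)
    rw [mul_pow, norm_toLp_sq_real, norm_toLp_sq_real]
    exact h u

lemma singularValues_zero_τ (hℓ : ℓ ∈ Matrix.unitaryGroup (Fin d) K)
    (hm : m ∈ Matrix.unitaryGroup (Fin d) K)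
    {A : Fin d → ℝ} (hA : Antitone A) (c : ℝ) :
    (Matrix.toEuclideanLin (c • R.τ (ℓ * expDiag K A * m))).singularValues 0
      = |c| * Real.exp (R.topExp A) := by
  have htop := R.top_dotProduct_self_pos
  have hn : 0 < R.n := by
    rcases Nat.eq_zero_or_pos R.n with h | h
    · exfalso
      have : IsEmpty (Fin R.n) := by rw [h]; infer_instance
      simp [dotProduct] at htop
    · exact h
  apply le_antisymm
  · refine singularValues_le _ (by simpa using hn) 0 (by positivity) fun v _ => ?_
    rw [R.norm_toEuclideanLin_τ hℓ, mul_assoc]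
    refine mul_le_mul_of_nonneg_left ?_ (abs_nonneg _)
    have : ‖v‖ = ‖WithLp.toLp 2 (R.τ m *ᵥ v.ofLp)‖ :=
      (norm_toLp_mulVec_unitary (R.τ_mem_unitaryGroup hm) _).symm
    rw [this]
    refine le_of_sq_le_sq ?_ (by positivity)
    rw [mul_pow, norm_toLp_sq_real, norm_toLp_sq_real]
    exact R.τ_expDiag_le_top hA _
  · refine R.le_singularValues_τ hℓ hm c ((LinearMap.proj 0).smulRight R.top) ?_
      (Real.exp_pos _).le ?_
    · rw [← LinearMap.ker_eq_bot, LinearMap.ker_eq_bot']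
      intro u hu
      ext i
      rw [Fin.fin_one_eq_zero i]
      refine (smul_eq_zero.1 hu).resolve_right ?_
      rintro h
      simp [h] at htop
    · intro u
      simp only [LinearMap.smulRight_apply, LinearMap.proj_apply, Matrix.mulVec_smul, τ_expDiag_top,
        smul_dotProduct, dotProduct_smul, smul_eq_mul]
      exact le_of_eq (by ring)

/-- The hyperplane orthogonal to `top` gives the upper bound, and the plane spanned by `top` and the
vector of the second weight gives the matching lower bound. -/
lemma singularValues_one_τ (hℓ : ℓ ∈ Matrix.unitaryGroup (Fin d) K)
    (hm : m ∈ Matrix.unitaryGroup (Fin d) K)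
    {A : Fin d → ℝ} (hA : Antitone A) (c : ℝ) :
    (Matrix.toEuclideanLin (c • R.τ (ℓ * expDiag K A * m))).singularValues 1
      = |c| * Real.exp (R.topExp A - R.gap A) := by
  have htop := R.top_dotProduct_self_pos
  obtain ⟨w, hw0, hw, hAw⟩ := R.exists_second
  have hww : 0 < w ⬝ᵥ w := by
    rw [← norm_toLp_sq_real]
    have : (WithLp.toLp 2 w) ≠ 0 := by simpa using hw0
    have := norm_pos_iff.2 this
    positivity
  have hAw' : R.τ (expDiag K A) *ᵥ w = Real.exp (R.topExp A - R.gap A) • w := by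
    rw [hAw, topExp, gap]
    congr 2; ring
  set ψ : (Fin 2 → ℝ) →ₗ[ℝ] (Fin R.n → ℝ) :=
    (LinearMap.proj 0).smulRight R.top + (LinearMap.proj 1).smulRight w with hψ
  have hψu : ∀ u, ψ u = u 0 • R.top + u 1 • w := fun u => by simp [hψ]
  have hψi : Function.Injective ψ := by
    rw [← LinearMap.ker_eq_bot, LinearMap.ker_eq_bot']
    intro u hu
    have h1 := R.add_dotProduct_self (u 0) (u 1) hw
    rw [← hψu, hu, dotProduct_zero] at h1
    have h2 : 0 ≤ u 0 ^ 2 * (R.top ⬝ᵥ R.top) := by positivity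
    have h3 : 0 ≤ u 1 ^ 2 * (w ⬝ᵥ w) := by positivity
    have h4 : u 0 = 0 := by
      have : u 0 ^ 2 * (R.top ⬝ᵥ R.top) = 0 := by linarith
      simpa [htop.ne'] using this
    have h5 : u 1 = 0 := by
      have : u 1 ^ 2 * (w ⬝ᵥ w) = 0 := by linarith
      simpa [hww.ne'] using this
    ext i
    fin_cases i <;> assumption
  have hn : 1 < R.n := by
    have := LinearMap.finrank_le_finrank_of_injective hψi
    simp at this
    omega
  apply le_antisymm
  · refine singularValues_le _ (by simpa using hn)
      (LinearMap.pi fun _ => (dotProductBilin ℝ ℝ R.top) ∘ₗ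
        (R.τ m).mulVecLin ∘ₗ (WithLp.linearEquiv 2 ℝ (Fin R.n → ℝ)).toLinearMap)
      (by positivity) fun v hv => ?_
    rw [R.norm_toEuclideanLin_τ hℓ, mul_assoc]
    refine mul_le_mul_of_nonneg_left ?_ (abs_nonneg _)
    have : ‖v‖ = ‖WithLp.toLp 2 (R.τ m *ᵥ v.ofLp)‖ :=
      (norm_toLp_mulVec_unitary (R.τ_mem_unitaryGroup hm) _).symm
    rw [this]
    refine le_of_sq_le_sq ?_ (by positivity)
    rw [mul_pow, norm_toLp_sq_real, norm_toLp_sq_real]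
    refine R.τ_expDiag_le hA ?_
    have := congrFun hv 0
    simpa using this
  · refine R.le_singularValues_τ hℓ hm c ψ hψi (Real.exp_pos _).le fun u => ?_
    have h1 := R.add_dotProduct_self (u 0) (u 1) hw
    have h2 := R.add_dotProduct_self (u 0 * Real.exp (R.topExp A))
      (u 1 * Real.exp (R.topExp A - R.gap A)) hw
    rw [hψu, Matrix.mulVec_add, Matrix.mulVec_smul, Matrix.mulVec_smul, τ_expDiag_top, hAw',
      smul_smul, smul_smul, h1, h2]
    have h5 : Real.exp (R.topExp A - R.gap A) ^ 2 ≤ Real.exp (R.topExp A) ^ 2 :=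
      pow_le_pow_left₀ (Real.exp_pos _).le (Real.exp_le_exp.2 (by linarith [R.gap_nonneg hA])) 2
    have h6 := mul_le_mul_of_nonneg_right h5 (mul_nonneg (sq_nonneg (u 0)) htop.le)
    nlinarith

/-! ### The induced homomorphism of projective groups -/

/-- The homomorphism of general linear groups induced by a Plücker representation. -/
def toGL : Matrix.GeneralLinearGroup (Fin d) K →* Matrix.GeneralLinearGroup (Fin R.n) ℝ :=
  Units.map R.τ

lemma coe_toGL (g : Matrix.GeneralLinearGroup (Fin d) K) :
    (R.toGL g : Matrix (Fin R.n) (Fin R.n) ℝ) = R.τ g := rfl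

lemma mk_toGL_scalar (u : Kˣ) :
    Matrix.ProjGenLinGroup.mk (R.toGL (Matrix.GeneralLinearGroup.scalar (Fin d) u)) = 1 := by
  have hr : ‖(u : K)‖ ^ (2 * k) ≠ 0 := pow_ne_zero _ (norm_ne_zero_iff.2 u.ne_zero)
  have : R.toGL (Matrix.GeneralLinearGroup.scalar (Fin d) u)
      = Matrix.GeneralLinearGroup.scalar (Fin R.n) (Units.mk0 _ hr) := by
    ext1
    rw [coe_toGL, coe_scalar_units, coe_scalar_units, R.τ_smul_one, Units.val_mk0]
  rw [this, Matrix.ProjGenLinGroup.mk_scalar]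

/-- The homomorphism of projective linear groups induced by a Plücker representation. -/
def toPGL : PGL d K →* PGL R.n ℝ :=
  Matrix.ProjGenLinGroup.lift (Matrix.ProjGenLinGroup.mk.comp R.toGL) (by
    ext1 u
    exact R.mk_toGL_scalar u)

lemma toPGL_mk (g : Matrix.GeneralLinearGroup (Fin d) K) :
    R.toPGL (Matrix.ProjGenLinGroup.mk g) = Matrix.ProjGenLinGroup.mk (R.toGL g) := rfl

/-- The first simple root of the image is the `k`-th simple root. -/
lemma simpleRoot_one_toPGL {g : PGL d K} {B : Matrix.GeneralLinearGroup (Fin d) K}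
    (hB : Matrix.ProjGenLinGroup.mk B = g) {ℓ m : Matrix (Fin d) (Fin d) K}
    (hℓ : ℓ ∈ Matrix.unitaryGroup (Fin d) K) (hm : m ∈ Matrix.unitaryGroup (Fin d) K)
    {A : Fin d → ℝ} (hA : Antitone A) (hBA : (B : Matrix (Fin d) (Fin d) K) = ℓ * expDiag K A * m)
    (hn : 2 ≤ R.n) : simpleRoot 1 (cartanProjection (R.toPGL g)) = R.gap A := by
  obtain ⟨u, hu, hC⟩ := exists_smul_of_mk_eq (B := R.toGL B)
    (((R.toPGL_mk B).symm.trans (by rw [hB])).trans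
      (exists_unimodular_rep (R.toPGL g)).choose_spec.1.symm)
  rw [coe_toGL, hBA] at hC
  rw [simpleRoot, dif_pos ⟨le_rfl, hn⟩]
  simp only [cartanProjection, unimodularRep]
  rw [hC]
  have h0 := R.singularValues_zero_τ hℓ hm hA u
  have h1 := R.singularValues_one_τ hℓ hm hA u
  simp only [Nat.sub_self]
  rw [h0, h1, Real.log_mul (abs_ne_zero.2 hu) (Real.exp_pos _).ne',
    Real.log_mul (abs_ne_zero.2 hu) (Real.exp_pos _).ne', Real.log_exp, Real.log_exp]
  ring

lemma two_le_n : 2 ≤ R.n := by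
  obtain ⟨w, hw0, hw, -⟩ := R.exists_second
  have htop := R.top_dotProduct_self_pos
  by_contra hlt
  obtain ⟨α, hα⟩ : ∃ α : ℝ, w = α • R.top := by
    have hn : R.n = 0 ∨ R.n = 1 := by omega
    rcases hn with h | h
    · have : IsEmpty (Fin R.n) := by rw [h]; infer_instance
      exact ⟨0, Subsingleton.elim _ _⟩
    · have : Subsingleton (Fin R.n) := by rw [h]; infer_instance
      have hf : Module.finrank ℝ (Fin R.n → ℝ) = 1 := by simp [h]
      obtain ⟨α, hα⟩ := exists_smul_eq_of_finrank_eq_one hf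
        (show R.top ≠ 0 by rintro h; simp [h] at htop) w
      exact ⟨α, hα.symm⟩
  rw [hα] at hw
  change R.top ⬝ᵥ (α • R.top) = 0 at hw
  rw [dotProduct_smul, smul_eq_mul] at hw
  rcases mul_eq_zero.1 hw with h | h
  · exact hw0 (by rw [hα, h, zero_smul])
  · exact htop.ne' h

end PluckerRep

end TransverseGroups

namespace TransverseGroups

open Matrix

/-! ### Existence of singular value and Cartan decompositions. -/

variable {K : Type*} [RCLike K] {d : ℕ}

/-- The matrix whose columns are given vectors of Euclidean space. -/
def colMat {j : ℕ} (b : Fin j → EuclideanSpace K (Fin d)) : Matrix (Fin d) (Fin j) K :=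
  Matrix.of fun i s => b s i

lemma colMat_conjTranspose_mul {j : ℕ} (b c : Fin j → EuclideanSpace K (Fin d)) (s t : Fin j) :
    ((colMat b)ᴴ * colMat c) s t = inner K (b s) (c t) := by
  rw [EuclideanSpace.inner_eq_star_dotProduct, dotProduct_comm]
  rfl

lemma colMat_conjTranspose_mul_self {j : ℕ} {b : Fin j → EuclideanSpace K (Fin d)}
    (hb : Orthonormal K b) : (colMat b)ᴴ * colMat b = 1 := by
  ext s t
  rw [colMat_conjTranspose_mul, orthonormal_iff_ite.1 hb, Matrix.one_apply]

lemma mul_colMat {j : ℕ} (B : Matrix (Fin d) (Fin d) K) (b : Fin j → EuclideanSpace K (Fin d)) :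
    B * colMat b = colMat fun s => Matrix.toEuclideanLin B (b s) := by
  ext i s
  rfl

lemma expDiag_mul_expDiag (A A' : Fin d → ℝ) :
    expDiag K A * expDiag K A' = expDiag K (A + A') := by
  rw [expDiag, expDiag, Matrix.diagonal_mul_diagonal, expDiag]
  congr 1
  ext i
  rw [← RCLike.ofReal_mul, ← Real.exp_add]
  rfl

lemma expDiag_zero : expDiag K (0 : Fin d → ℝ) = 1 := by
  simp [expDiag]

lemma expDiag_neg_mul (A : Fin d → ℝ) : expDiag K (-A) * expDiag K A = 1 := by
  rw [expDiag_mul_expDiag, neg_add_cancel, expDiag_zero]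

/-- Existence of singular value decompositions. -/
lemma exists_svd (B : Matrix.GeneralLinearGroup (Fin d) K) :
    ∃ ℓ ∈ Matrix.unitaryGroup (Fin d) K, ∃ m ∈ Matrix.unitaryGroup (Fin d) K, ∃ A : Fin d → ℝ,
      Antitone A ∧ (B : Matrix (Fin d) (Fin d) K) = ℓ * expDiag K A * m := by
  set T := Matrix.toEuclideanLin (B : Matrix (Fin d) (Fin d) K) with hT
  have hn : Module.finrank K (EuclideanSpace K (Fin d)) = d := by simp
  set b := T.isSymmetric_adjoint_comp_self.eigenvectorBasis hn with hb
  have hinj : Function.Injective T := by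
    intro v w h
    have h2 : (B : Matrix (Fin d) (Fin d) K) *ᵥ v.ofLp = (B : Matrix (Fin d) (Fin d) K) *ᵥ w.ofLp :=
      congrArg WithLp.ofLp h
    have h3 := congrArg (fun u => ((B⁻¹ : Matrix.GeneralLinearGroup (Fin d) K) :
      Matrix (Fin d) (Fin d) K) *ᵥ u) h2
    simp only [Matrix.mulVec_mulVec, ← Units.val_mul, inv_mul_cancel, Units.val_one,
      Matrix.one_mulVec] at h3
    exact WithLp.ofLp_injective 2 h3
  have hpos : ∀ i : Fin d, 0 < T.singularValues i := fun i =>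
    T.injective_iff_forall_lt_finrank_singularValues_pos.1 hinj i (by rw [hn]; exact i.2)
  set A : Fin d → ℝ := fun i => Real.log (T.singularValues i) with hA
  have hexp : ∀ i, Real.exp (A i) = T.singularValues i := fun i => Real.exp_log (hpos i)
  set W := colMat b with hW
  have hWW : Wᴴ * W = 1 := colMat_conjTranspose_mul_self b.orthonormal
  have hWu : W ∈ Matrix.unitaryGroup (Fin d) K := Matrix.mem_unitaryGroup_iff'.2 hWW
  -- The columns of `W` are eigenvectors of `Bᴴ B`, so the columns of `B W` are orthogonal with the
  -- singular values as lengths. Dividing by these lengths gives the unitary factor `B W exp(-A)`.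
  have hgram : ((B : Matrix (Fin d) (Fin d) K) * W)ᴴ * ((B : Matrix (Fin d) (Fin d) K) * W)
      = expDiag K (A + A) := by
    ext i j
    rw [hW, mul_colMat, colMat_conjTranspose_mul, ← LinearMap.adjoint_inner_right]
    change inner K (b i) ((LinearMap.adjoint T ∘ₗ T) (b j)) = _
    rw [hb, T.isSymmetric_adjoint_comp_self.apply_eigenvectorBasis hn j, inner_smul_right,
      orthonormal_iff_ite.1 (T.isSymmetric_adjoint_comp_self.eigenvectorBasis hn).orthonormal,
      ← T.sq_singularValues_fin hn j, expDiag, Matrix.diagonal_apply]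
    by_cases h : i = j
    · subst h
      rw [if_pos rfl, if_pos rfl, Pi.add_apply, Real.exp_add, hexp, mul_one, sq]
    · rw [if_neg h, if_neg h, mul_zero]
  refine ⟨(B : Matrix (Fin d) (Fin d) K) * W * expDiag K (-A), ?_, Wᴴ, ?_, A, ?_, ?_⟩
  · rw [Matrix.mem_unitaryGroup_iff', Matrix.star_eq_conjTranspose, Matrix.conjTranspose_mul,
      expDiag_conjTranspose, Matrix.mul_assoc, ← Matrix.mul_assoc _ _ (expDiag K (-A)), hgram,
      expDiag_mul_expDiag, expDiag_mul_expDiag]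
    rw [show -A + (A + A + -A) = 0 by abel, expDiag_zero]
  · rw [← Matrix.star_eq_conjTranspose]; exact Unitary.star_mem hWu
  · intro i j hij
    exact Real.log_le_log (hpos j) (T.singularValues_antitone hij)
  · rw [Matrix.mul_assoc _ (expDiag K (-A)), expDiag_neg_mul, Matrix.mul_one, Matrix.mul_assoc,
      ← Matrix.star_eq_conjTranspose, Matrix.mem_unitaryGroup_iff.1 hWu, Matrix.mul_one]

/-- Existence of Cartan decompositions in `PGL(d, K)`. -/
lemma exists_cartan (g : PGL d K) : ∃ ℓ ∈ Matrix.unitaryGroup (Fin d) K,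
    ∃ m ∈ Matrix.unitaryGroup (Fin d) K, ∃ A : Fin d → ℝ, Antitone A ∧ ∑ i, A i = 0 ∧
    ∃ B : Matrix.GeneralLinearGroup (Fin d) K, Matrix.ProjGenLinGroup.mk B = g ∧
      (B : Matrix (Fin d) (Fin d) K) = ℓ * expDiag K A * m := by
  obtain ⟨C, rfl⟩ := Matrix.ProjGenLinGroup.mk_surjective g
  obtain ⟨ℓ, hℓ, m, hm, A, hA, hC⟩ := exists_svd C
  -- Subtracting the mean makes the exponents sum to zero; on matrices this is multiplication by a
  -- scalar, invisible in `PGL`.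
  set c : ℝ := (∑ i, A i) / d with hc
  have hc0 : ((Real.exp (-c) : ℝ) : K) ≠ 0 := by exact_mod_cast (Real.exp_pos _).ne'
  refine ⟨ℓ, hℓ, m, hm, fun i => A i - c, fun i j hij => sub_le_sub_right (hA hij) c, ?_,
    C * Matrix.GeneralLinearGroup.scalar (Fin d) (Units.mk0 _ hc0), ?_, ?_⟩
  · rw [Finset.sum_sub_distrib]
    rcases Nat.eq_zero_or_pos d with h | h
    · subst h; simp
    · have : (d : ℝ) ≠ 0 := by exact_mod_cast h.ne'
      simp [hc]; field_simp; ring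
  · rw [map_mul, Matrix.ProjGenLinGroup.mk_scalar, mul_one]
  · have h1 : expDiag K (fun i => A i - c) = ((Real.exp (-c) : ℝ) : K) • expDiag K A := by
      rw [expDiag, expDiag, ← Matrix.diagonal_smul]
      congr 1
      ext i
      rw [Pi.smul_apply, smul_eq_mul, ← RCLike.ofReal_mul, ← Real.exp_add]
      congr 2; ring
    rw [Units.val_mul, coe_scalar_units, Units.val_mk0, h1, hC, Matrix.mul_smul, Matrix.mul_one,
      Matrix.mul_smul, Matrix.smul_mul]

/-! ### Matrices of orthogonal projections -/

/-- The matrix of the orthogonal projection to a subspace. -/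
def projMat (W : Submodule K (Fin d → K)) : Matrix (Fin d) (Fin d) K :=
  (Matrix.toEuclideanCLM (𝕜 := K) (n := Fin d)).symm (orthProj W)

lemma toEuclideanCLM_projMat (W : Submodule K (Fin d → K)) :
    Matrix.toEuclideanCLM (𝕜 := K) (n := Fin d) (projMat W) = orthProj W :=
  (Matrix.toEuclideanCLM (𝕜 := K) (n := Fin d)).apply_symm_apply _

lemma projMat_mulVec (W : Submodule K (Fin d → K)) (v : Fin d → K) :
    projMat W *ᵥ v = (orthProj W (WithLp.toLp 2 v)).ofLp := by
  rw [← toEuclideanCLM_projMat]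
  rfl

lemma mem_iff_projMat_mulVec (W : Submodule K (Fin d → K)) (v : Fin d → K) :
    v ∈ W ↔ projMat W *ᵥ v = v := by
  rw [projMat_mulVec, orthProj]
  constructor
  · intro h
    rw [Submodule.starProjection_eq_self_iff.2]
    exact ⟨v, h, rfl⟩
  · intro h
    have h2 := Submodule.starProjection_eq_self_iff.1 (WithLp.ofLp_injective 2 h)
    obtain ⟨w, hw, hwv⟩ := h2
    rwa [show w = v from WithLp.toLp_injective 2 hwv] at hw

lemma projMat_injective : Function.Injective (projMat (K := K) (d := d)) := by
  intro W W' h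
  ext v
  rw [mem_iff_projMat_mulVec, mem_iff_projMat_mulVec, h]

/-- The columns of `Y` need not be orthonormal. This generality serves limits of moving frames,
whose Gram matrix is only invertible. -/
lemma projMat_eq {j : ℕ} {Y : Matrix (Fin d) (Fin j) K} (hY : IsUnit (Yᴴ * Y).det) :
    projMat (LinearMap.range Y.mulVecLin) = Y * (Yᴴ * Y)⁻¹ * Yᴴ := by
  apply EquivLike.injective (Matrix.toEuclideanCLM (𝕜 := K) (n := Fin d))
  rw [toEuclideanCLM_projMat]
  ext1 v
  refine Submodule.eq_starProjection_of_mem_of_inner_eq_zero ?_ ?_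
  · refine ⟨_, ⟨((Yᴴ * Y)⁻¹ * Yᴴ) *ᵥ v.ofLp, rfl⟩, ?_⟩
    rw [Matrix.mulVecLin_apply, Matrix.mulVec_mulVec, ← Matrix.mul_assoc]
    rfl
  · rintro _ ⟨_, ⟨c, rfl⟩, rfl⟩
    have h : Yᴴ *ᵥ (v.ofLp - (Y * (Yᴴ * Y)⁻¹ * Yᴴ) *ᵥ v.ofLp) = 0 := by
      rw [Matrix.mulVec_sub, Matrix.mulVec_mulVec, ← Matrix.mul_assoc, ← Matrix.mul_assoc,
        Matrix.mul_nonsing_inv _ hY, Matrix.one_mul, sub_self]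
    rw [EuclideanSpace.inner_eq_star_dotProduct]
    change (Y *ᵥ c) ⬝ᵥ star (v.ofLp - (Y * (Yᴴ * Y)⁻¹ * Yᴴ) *ᵥ v.ofLp) = 0
    rw [dotProduct_comm, Matrix.dotProduct_mulVec, ← star_star (_ ᵥ* Y), Matrix.star_vecMul, star_star, h,
      star_zero, zero_dotProduct]

lemma projMat_eq_of_orthonormal {j : ℕ} {Y : Matrix (Fin d) (Fin j) K} (hY : Yᴴ * Y = 1) :
    projMat (LinearMap.range Y.mulVecLin) = Y * Yᴴ := by
  rw [projMat_eq (by simp [hY]), hY, inv_one, Matrix.mul_one]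

lemma exists_orthonormal_matrix {j : ℕ} {W : Submodule K (Fin d → K)}
    (hW : Module.finrank K W = j) :
    ∃ B : Matrix (Fin d) (Fin j) K, Bᴴ * B = 1 ∧ LinearMap.range B.mulVecLin = W := by
  set e := (WithLp.linearEquiv 2 K (Fin d → K)).symm with he
  set W' := W.map e.toLinearMap with hW'
  have hf : Module.finrank K W' = j := by rw [hW', LinearEquiv.finrank_map_eq, hW]
  set b := (stdOrthonormalBasis K W').reindex (finCongr hf) with hb
  set b' : Fin j → EuclideanSpace K (Fin d) := fun s => b s with hb'
  have hb'o : Orthonormal K b' := b.orthonormal.comp_linearIsometry W'.subtypeₗᵢ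
  have hB := colMat_conjTranspose_mul_self hb'o
  refine ⟨colMat b', hB, ?_⟩
  apply Submodule.eq_of_le_of_finrank_eq
  · rintro _ ⟨c, rfl⟩
    have : (colMat b').mulVecLin c = ∑ s, c s • (b' s).ofLp := by
      ext i
      rw [Matrix.mulVecLin_apply, Matrix.mulVec, dotProduct, Finset.sum_apply]
      refine Finset.sum_congr rfl fun s _ => ?_
      rw [Pi.smul_apply, smul_eq_mul, mul_comm]
      rfl
    rw [this]
    refine Submodule.sum_mem _ fun s _ => Submodule.smul_mem _ _ ?_
    obtain ⟨w, hw, hwb⟩ := (b s).2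
    have : (b' s).ofLp = w := by rw [hb']; simp only; rw [← hwb]; rfl
    rwa [this]
  · rw [LinearMap.finrank_range_of_inj, hW]
    · simp
    · intro u v huv
      have h2 := congrArg (fun w => (colMat b')ᴴ *ᵥ w) huv
      simpa [Matrix.mulVec_mulVec, hB] using h2

/-- The orthogonal complement with respect to the standard hermitian form. -/
def orthoCompl (W : Submodule K (Fin d → K)) : Submodule K (Fin d → K) :=
  ((W.map (WithLp.linearEquiv 2 K (Fin d → K)).symm.toLinearMap)ᗮ).map
    (WithLp.linearEquiv 2 K (Fin d → K)).toLinearMap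

lemma projMat_orthoCompl (W : Submodule K (Fin d → K)) : projMat (orthoCompl W) = 1 - projMat W := by
  apply EquivLike.injective (Matrix.toEuclideanCLM (𝕜 := K) (n := Fin d))
  rw [map_sub, map_one, toEuclideanCLM_projMat, toEuclideanCLM_projMat, orthProj, orthProj,
    ← Submodule.starProjection_orthogonal']
  have : (orthoCompl W).map (WithLp.linearEquiv 2 K (Fin d → K)).symm.toLinearMap
      = (W.map (WithLp.linearEquiv 2 K (Fin d → K)).symm.toLinearMap)ᗮ := by
    rw [orthoCompl, ← Submodule.map_comp, LinearEquiv.symm_comp, Submodule.map_id]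
  congr 1

lemma finrank_orthoCompl {W : Submodule K (Fin d → K)} {j : ℕ}
    (hW : Module.finrank K W + j = d) : Module.finrank K (orthoCompl W) = j := by
  rw [orthoCompl, LinearEquiv.finrank_map_eq]
  apply Submodule.finrank_add_finrank_orthogonal'
  rw [LinearEquiv.finrank_map_eq, hW, finrank_euclideanSpace_fin]

/-- A subspace given as the kernel of a matrix with orthonormal rows. -/
lemma exists_kernel_matrix {j : ℕ} {W : Submodule K (Fin d → K)}
    (hW : Module.finrank K W + j = d) : ∃ C : Matrix (Fin d) (Fin j) K, Cᴴ * C = 1 ∧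
      C * Cᴴ = 1 - projMat W ∧ ∀ v, v ∈ W ↔ Cᴴ *ᵥ v = 0 := by
  obtain ⟨C, hC, hC2⟩ := exists_orthonormal_matrix (finrank_orthoCompl hW)
  have hCC : C * Cᴴ = 1 - projMat W := by
    rw [← projMat_orthoCompl, ← hC2, projMat_eq_of_orthonormal hC]
  refine ⟨C, hC, hCC, fun v => ?_⟩
  have h1 : v ∈ W ↔ (C * Cᴴ) *ᵥ v = 0 := by
    rw [hCC, Matrix.sub_mulVec, Matrix.one_mulVec, mem_iff_projMat_mulVec, sub_eq_zero, eq_comm]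
  rw [h1]
  constructor
  · intro h
    have := congrArg (fun w => Cᴴ *ᵥ w) h
    simpa [Matrix.mulVec_mulVec, ← Matrix.mul_assoc, hC] using this
  · intro h
    rw [← Matrix.mulVec_mulVec, h, Matrix.mulVec_zero]

lemma mulVec_injective_of_orthonormal {j : ℕ} {B : Matrix (Fin d) (Fin j) K} (hB : Bᴴ * B = 1) :
    Function.Injective B.mulVec := by
  intro u v huv
  have h2 := congrArg (fun w => Bᴴ *ᵥ w) huv
  simpa [Matrix.mulVec_mulVec, hB] using h2

/-- Complementarity of subspaces, as the non-vanishing of a determinant. -/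
lemma isCompl_iff_det_ne_zero {j : ℕ} {W W' : Submodule K (Fin d → K)}
    (hW : Module.finrank K W = j) (hW' : Module.finrank K W' + j = d)
    {B C : Matrix (Fin d) (Fin j) K} (hB : Function.Injective B.mulVec)
    (hBW : LinearMap.range B.mulVecLin = W) (hC : ∀ v, v ∈ W' ↔ Cᴴ *ᵥ v = 0) :
    IsCompl W W' ↔ (Cᴴ * B).det ≠ 0 := by
  have h1 : (Cᴴ * B).det ≠ 0 ↔ Disjoint W W' := by
    rw [Ne, ← Matrix.exists_mulVec_eq_zero_iff, Submodule.disjoint_def]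
    constructor
    · intro h x hx hx'
      rw [← hBW] at hx
      obtain ⟨c, rfl⟩ := hx
      by_contra hne
      refine h ⟨c, fun h0 => hne (by rw [h0, map_zero]), ?_⟩
      rw [← Matrix.mulVec_mulVec]
      exact (hC _).1 hx'
    · rintro h ⟨c, hc, hc0⟩
      have h2 := h (B *ᵥ c) (by rw [← hBW]; exact ⟨c, rfl⟩)
        ((hC _).2 (by rw [Matrix.mulVec_mulVec]; exact hc0))
      exact hc (hB (by rw [h2, Matrix.mulVec_zero]))
  rw [h1]
  refine ⟨fun h => h.disjoint, fun h => ⟨h, ?_⟩⟩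
  rw [codisjoint_iff]
  apply Submodule.eq_top_of_finrank_eq
  have := Submodule.finrank_sup_add_finrank_inf_eq W W'
  rw [disjoint_iff.1 h, finrank_bot] at this
  rw [Module.finrank_fin_fun]
  omega

end TransverseGroups

namespace TransverseGroups

open Matrix

variable {K : Type*} [RCLike K] {d : ℕ} {θ : Finset ℕ}

/-! ### The topology of the flag space -/

lemma continuous_toEuclideanCLM :
    Continuous (Matrix.toEuclideanCLM (𝕜 := K) (n := Fin d)) :=
  LinearMap.continuous_of_finiteDimensional
    ((Matrix.toEuclideanCLM (𝕜 := K) (n := Fin d)).toAlgEquiv.toLinearMap)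

lemma continuous_toEuclideanCLM_symm :
    Continuous (Matrix.toEuclideanCLM (𝕜 := K) (n := Fin d)).symm :=
  LinearMap.continuous_of_finiteDimensional
    ((Matrix.toEuclideanCLM (𝕜 := K) (n := Fin d)).symm.toAlgEquiv.toLinearMap)

/-- With this, convergence of flags is convergence of the projection matrices, and hence of matrix
entries. -/
lemma isInducing_projMat :
    IsInducing fun (F : PartialFlag K d θ) (j : θ) => projMat (F.space j) := by
  have h1 : IsInducing fun (F : PartialFlag K d θ) (j : θ) => orthProj (F.space j) := ⟨rfl⟩
  have h2 : IsInducing fun (P : θ → Matrix (Fin d) (Fin d) K) (j : θ) =>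
      Matrix.toEuclideanCLM (𝕜 := K) (n := Fin d) (P j) := by
    refine IsInducing.of_comp (g := fun (Q : θ → EuclideanSpace K (Fin d) →L[K] EuclideanSpace K (Fin d))
      (j : θ) => (Matrix.toEuclideanCLM (𝕜 := K) (n := Fin d)).symm (Q j)) ?_ ?_ ?_
    · exact continuous_pi fun j => continuous_toEuclideanCLM.comp (continuous_apply j)
    · exact continuous_pi fun j => continuous_toEuclideanCLM_symm.comp (continuous_apply j)
    · convert IsInducing.id using 1
      ext P j
      simp
  rw [← h2.of_comp_iff]
  convert h1 using 1
  ext F j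
  simp only [Function.comp_apply, toEuclideanCLM_projMat]

lemma tendsto_flag_iff {ι : Type*} {l : Filter ι} {U : ι → PartialFlag K d θ}
    {F : PartialFlag K d θ} : Tendsto U l (𝓝 F) ↔
      ∀ j : θ, Tendsto (fun n => projMat ((U n).space j)) l (𝓝 (projMat (F.space j))) := by
  rw [isInducing_projMat.tendsto_nhds_iff, tendsto_pi_nhds]
  rfl

instance instT2SpacePartialFlag : T2Space (PartialFlag K d θ) := by
  refine T2Space.of_injective_continuous (fun F G h => ?_) isInducing_projMat.continuous
  ext1
  funext j
  exact projMat_injective (congrFun h j)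

/-! ### Standard flags -/

lemma unitary_mul_topMat {j : ℕ} (hj : j ≤ d) {ℓ : Matrix (Fin d) (Fin d) K}
    (hℓ : ℓ ∈ Matrix.unitaryGroup (Fin d) K) :
    (ℓ * topMat K hj)ᴴ * (ℓ * topMat K hj) = 1 := by
  rw [Matrix.conjTranspose_mul, Matrix.mul_assoc, ← Matrix.mul_assoc ℓᴴ,
    ← Matrix.star_eq_conjTranspose ℓ, Matrix.mem_unitaryGroup_iff'.1 hℓ, Matrix.one_mul,
    topMat_conjTranspose_mul_self]

/-- The image of the standard flag by a unitary matrix. -/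
def stdFlag (hθ : ∀ j ∈ θ, j ≤ d) {ℓ : Matrix (Fin d) (Fin d) K}
    (hℓ : ℓ ∈ Matrix.unitaryGroup (Fin d) K) : PartialFlag K d θ where
  space j := LinearMap.range (ℓ * topMat K (hθ j j.2)).mulVecLin
  finrank_space j := by
    rw [LinearMap.finrank_range_of_inj]
    · simp
    · exact mulVec_injective_of_orthonormal (unitary_mul_topMat _ hℓ)
  mono i j hij := by
    have : topMat K (hθ i i.2) = topMat K (hθ j j.2) * topMat K hij := by
      ext p s
      simp only [topMat, selMat, Matrix.mul_apply, Matrix.of_apply, mul_ite, mul_one, mul_zero,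
        Finset.sum_ite_eq', Finset.mem_univ, if_true]
      rfl
    rw [this, ← Matrix.mul_assoc, Matrix.mulVecLin_mul]
    exact LinearMap.range_comp_le_range _ _

lemma projMat_stdFlag (hθ : ∀ j ∈ θ, j ≤ d) {ℓ : Matrix (Fin d) (Fin d) K}
    (hℓ : ℓ ∈ Matrix.unitaryGroup (Fin d) K) (j : θ) : projMat ((stdFlag hθ hℓ).space j)
      = ℓ * (topMat K (hθ j j.2) * (topMat K (hθ j j.2))ᴴ) * ℓᴴ := by
  rw [stdFlag, projMat_eq_of_orthonormal (unitary_mul_topMat _ hℓ), mul_mul_conjTranspose_mul]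

lemma span_eq_range_topMat {j : ℕ} (hj : j ≤ d) (ℓ : Matrix (Fin d) (Fin d) K) :
    Submodule.span K ((fun i : Fin d => ℓ.mulVec (Pi.single i 1)) '' {i | (i : ℕ) < j})
      = LinearMap.range (ℓ * topMat K hj).mulVecLin := by
  rw [Matrix.range_mulVecLin]
  congr 1
  have h : ∀ s, (ℓ * topMat K hj).col s = ℓ.mulVec (Pi.single (Fin.castLE hj s) 1) := by
    intro s
    ext i
    simp [Matrix.col, topMat, selMat, Matrix.mul_apply]
  ext v
  constructor
  · rintro ⟨i, hi, rfl⟩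
    exact ⟨⟨i, hi⟩, h _⟩
  · rintro ⟨s, rfl⟩
    exact ⟨Fin.castLE hj s, s.2, (h s).symm⟩

lemma isCartanFlag_iff (hθ : ∀ j ∈ θ, j ≤ d) {g : PGL d K} {F : PartialFlag K d θ} :
    IsCartanFlag g F ↔ ∃ (ℓ : Matrix (Fin d) (Fin d) K) (hℓ : ℓ ∈ Matrix.unitaryGroup (Fin d) K),
      ∃ m ∈ Matrix.unitaryGroup (Fin d) K, ∃ A : Fin d → ℝ, Antitone A ∧ ∑ i, A i = 0 ∧
      (∃ B : Matrix.GeneralLinearGroup (Fin d) K, Matrix.ProjGenLinGroup.mk B = g ∧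
        (B : Matrix (Fin d) (Fin d) K) = ℓ * expDiag K A * m) ∧ F = stdFlag hθ hℓ := by
  constructor
  · rintro ⟨ℓ, hℓ, m, hm, A, hA, hA0, hB, hF⟩
    refine ⟨ℓ, hℓ, m, hm, A, hA, hA0, hB, ?_⟩
    ext1
    funext j
    rw [hF j, span_eq_range_topMat (hθ j j.2)]
    rfl
  · rintro ⟨ℓ, hℓ, m, hm, A, hA, hA0, hB, rfl⟩
    exact ⟨ℓ, hℓ, m, hm, A, hA, hA0, hB, fun j => (span_eq_range_topMat (hθ j j.2) ℓ).symm⟩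

lemma exists_isCartanFlag (hθ : ∀ j ∈ θ, j ≤ d) (g : PGL d K) :
    ∃ F : PartialFlag K d θ, IsCartanFlag g F := by
  obtain ⟨ℓ, hℓ, m, hm, A, hA, hA0, hB⟩ := exists_cartan g
  exact ⟨stdFlag hθ hℓ, (isCartanFlag_iff hθ).2 ⟨ℓ, hℓ, m, hm, A, hA, hA0, hB, rfl⟩⟩

lemma space_mk_smul (g : Matrix.GeneralLinearGroup (Fin d) K) (F : PartialFlag K d θ) (j : θ)
    {i : ℕ} {B : Matrix (Fin d) (Fin i) K} (hB : LinearMap.range B.mulVecLin = F.space j) :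
    (Matrix.ProjGenLinGroup.mk g • F).space j
      = LinearMap.range ((g : Matrix (Fin d) (Fin d) K) * B).mulVecLin := by
  change g • F.space j = _
  rw [← hB, Matrix.mulVecLin_mul, LinearMap.range_comp]
  rfl

/-- The permutation matrix reversing the standard basis. -/
def revMat (K : Type*) [RCLike K] (d : ℕ) : Matrix (Fin d) (Fin d) K := selMat K Fin.rev

lemma revMat_mem : revMat K d ∈ Matrix.unitaryGroup (Fin d) K :=
  Matrix.mem_unitaryGroup_iff'.2 (selMat_conjTranspose_mul_self Fin.rev_injective)

lemma topMat_mul_conjTranspose {j : ℕ} (hj : j ≤ d) : topMat K hj * (topMat K hj)ᴴ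
    = Matrix.diagonal fun i : Fin d => if (i : ℕ) < j then 1 else 0 := by
  ext p q
  rw [Matrix.mul_apply]
  simp only [topMat, selMat, Matrix.conjTranspose_apply, Matrix.of_apply, Matrix.diagonal_apply]
  by_cases hp : (p : ℕ) < j
  · rw [Finset.sum_eq_single (⟨p, hp⟩ : Fin j)]
    · have : p = Fin.castLE hj ⟨p, hp⟩ := rfl
      by_cases hpq : p = q
      · subst hpq; simp [hp]
      · rw [if_neg hpq, if_neg (show ¬ q = Fin.castLE hj ⟨p, hp⟩ from fun h => hpq h.symm)]
        simp
    · intro s _ hs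
      rw [if_neg, zero_mul]
      rintro rfl
      exact hs rfl
    · simp
  · rw [Finset.sum_eq_zero]
    · simp [hp]
    · intro s _
      rw [if_neg, zero_mul]
      rintro rfl
      exact hp s.2

lemma revMat_mul_diagonal_mul (a : Fin d → K) :
    revMat K d * Matrix.diagonal a * (revMat K d)ᴴ = Matrix.diagonal (a ∘ Fin.rev) := by
  have h : revMat K d * Matrix.diagonal a = Matrix.diagonal (a ∘ Fin.rev) * revMat K d := by
    rw [revMat, diagonal_mul_selMat]
    congr 2
    ext i; simp
  rw [h, Matrix.mul_assoc, ← Matrix.star_eq_conjTranspose,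
    Matrix.mem_unitaryGroup_iff.1 revMat_mem, Matrix.mul_one]

/-- The flag `U_θ(g⁻¹)`, for `g = ℓ a m`. -/
def repFlag (hθ : ∀ j ∈ θ, j ≤ d) {m : Matrix (Fin d) (Fin d) K}
    (hm : m ∈ Matrix.unitaryGroup (Fin d) K) : PartialFlag K d θ :=
  stdFlag hθ (mul_mem (Unitary.star_mem hm) (revMat_mem (K := K)))

/-- The `j`-dimensional part of `repFlag` is spanned by the `mᴴ`-images of the last `j` basis
vectors, so its orthogonal complement is spanned by the images of the first `d - j`. Thus its
`(d-k)`-part defines a functional given by a `k`-plane. -/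
lemma one_sub_projMat_repFlag (hθ : ∀ j ∈ θ, j ≤ d) {m : Matrix (Fin d) (Fin d) K}
    (hm : m ∈ Matrix.unitaryGroup (Fin d) K) {j : θ} {l : ℕ} (hl : (j : ℕ) + l = d) :
    1 - projMat ((repFlag hθ hm).space j)
      = mᴴ * (topMat K (show l ≤ d by omega) * (topMat K (show l ≤ d by omega))ᴴ) * m := by
  have h1 : mᴴ * m = 1 := Matrix.mem_unitaryGroup_iff'.1 hm
  rw [repFlag, projMat_stdFlag, topMat_mul_conjTranspose, topMat_mul_conjTranspose,
    Matrix.conjTranspose_mul, Matrix.star_eq_conjTranspose, Matrix.conjTranspose_conjTranspose]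
  have h2 : mᴴ * revMat K d * Matrix.diagonal (fun i : Fin d => if (i : ℕ) < j then (1 : K) else 0) *
      ((revMat K d)ᴴ * m) = mᴴ * (revMat K d *
        Matrix.diagonal (fun i : Fin d => if (i : ℕ) < j then (1 : K) else 0) * (revMat K d)ᴴ) * m := by
    simp only [Matrix.mul_assoc]
  rw [h2, revMat_mul_diagonal_mul, ← h1]
  have h3 : mᴴ * m = mᴴ * 1 * m := by rw [Matrix.mul_one]
  rw [h3, ← Matrix.sub_mul, ← Matrix.mul_sub, ← Matrix.diagonal_one, Matrix.diagonal_sub]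
  congr 3
  ext i
  simp only [Function.comp_apply, Fin.val_rev]
  have := i.2
  by_cases h : (i : ℕ) < l
  · rw [if_pos h, if_neg (by omega), sub_zero]
  · rw [if_neg h, if_pos (by omega), sub_self]

/-- The inverse is `mᴴ exp(-A) ℓᴴ` with increasing exponents; conjugation by the order-reversing
permutation puts them back in decreasing order. -/
lemma cartan_inv {ℓ m : Matrix (Fin d) (Fin d) K}
    (hℓ : ℓ ∈ Matrix.unitaryGroup (Fin d) K) (hm : m ∈ Matrix.unitaryGroup (Fin d) K)
    {A : Fin d → ℝ} {B : Matrix.GeneralLinearGroup (Fin d) K}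
    (hBA : (B : Matrix (Fin d) (Fin d) K) = ℓ * expDiag K A * m) :
    ((B⁻¹ : Matrix.GeneralLinearGroup (Fin d) K) : Matrix (Fin d) (Fin d) K)
      = star m * revMat K d * expDiag K (fun i => - A i.rev) * ((revMat K d)ᴴ * ℓᴴ) := by
  have h1 : revMat K d * expDiag K (fun i => - A i.rev) * (revMat K d)ᴴ = expDiag K (-A) := by
    rw [expDiag, revMat_mul_diagonal_mul, expDiag]
    congr 1
    ext i
    simp
  have h2 : star m * revMat K d * expDiag K (fun i => - A i.rev) * ((revMat K d)ᴴ * ℓᴴ)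
      = star m * (revMat K d * expDiag K (fun i => - A i.rev) * (revMat K d)ᴴ) * ℓᴴ := by
    simp only [Matrix.mul_assoc]
  rw [h2, h1]
  symm
  have h3 : (star m * expDiag K (-A) * ℓᴴ) * (B : Matrix (Fin d) (Fin d) K) = 1 := by
    rw [hBA]
    have : star m * expDiag K (-A) * ℓᴴ * (ℓ * expDiag K A * m)
        = star m * (expDiag K (-A) * (ℓᴴ * ℓ) * expDiag K A) * m := by
      simp only [Matrix.mul_assoc]
    rw [this, ← Matrix.star_eq_conjTranspose, Matrix.mem_unitaryGroup_iff'.1 hℓ, Matrix.mul_one,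
      expDiag_neg_mul, Matrix.mul_one, Matrix.mem_unitaryGroup_iff'.1 hm]
  calc star m * expDiag K (-A) * ℓᴴ
      = star m * expDiag K (-A) * ℓᴴ * ((B : Matrix (Fin d) (Fin d) K) *
        ((B⁻¹ : Matrix.GeneralLinearGroup (Fin d) K) : Matrix (Fin d) (Fin d) K)) := by
        rw [← Units.val_mul, mul_inv_cancel, Units.val_one, Matrix.mul_one]
    _ = _ := by rw [← Matrix.mul_assoc, h3, Matrix.one_mul]

lemma isCartanFlag_inv (hθ : ∀ j ∈ θ, j ≤ d) {g : PGL d K} {ℓ m : Matrix (Fin d) (Fin d) K}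
    (hℓ : ℓ ∈ Matrix.unitaryGroup (Fin d) K) (hm : m ∈ Matrix.unitaryGroup (Fin d) K)
    {A : Fin d → ℝ} (hA : Antitone A) (hA0 : ∑ i, A i = 0)
    {B : Matrix.GeneralLinearGroup (Fin d) K} (hB : Matrix.ProjGenLinGroup.mk B = g)
    (hBA : (B : Matrix (Fin d) (Fin d) K) = ℓ * expDiag K A * m) :
    IsCartanFlag g⁻¹ (repFlag hθ hm) := by
  refine (isCartanFlag_iff hθ).2 ⟨_, mul_mem (Unitary.star_mem hm) (revMat_mem (K := K)),
    (revMat K d)ᴴ * ℓᴴ, mul_mem (Unitary.star_mem revMat_mem) (Unitary.star_mem hℓ),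
    fun i => - A i.rev, fun i j hij => neg_le_neg (hA (Fin.rev_le_rev.2 hij)), ?_,
    ⟨B⁻¹, by rw [map_inv, hB], cartan_inv hℓ hm hBA⟩, rfl⟩
  have h : ∑ i, A (Fin.rev i) = ∑ i, A i := Equiv.sum_comp Fin.revPerm A
  rw [Finset.sum_neg_distrib, h, hA0, neg_zero]

end TransverseGroups

namespace TransverseGroups

open Matrix

variable {K : Type*} [RCLike K] {d : ℕ} {θ : Finset ℕ}

/-! ### Convergence of the action on Grassmannians -/

lemma tendsto_matrix_inv {j : ℕ} {M : ℕ → Matrix (Fin j) (Fin j) K} {N : Matrix (Fin j) (Fin j) K}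
    (h : Tendsto M atTop (𝓝 N)) (hN : N.det ≠ 0) :
    Tendsto (fun n => (M n)⁻¹) atTop (𝓝 N⁻¹) := by
  have hdet : Tendsto (fun n => (M n).det) atTop (𝓝 N.det) :=
    ((continuous_id (X := Matrix (Fin j) (Fin j) K)).matrix_det.tendsto N).comp h
  have hadj : Tendsto (fun n => (M n).adjugate) atTop (𝓝 N.adjugate) :=
    ((continuous_id (X := Matrix (Fin j) (Fin j) K)).matrix_adjugate.tendsto N).comp h
  simp only [Matrix.inv_def, Ring.inverse_eq_inv']
  exact (hdet.inv₀ hN).smul hadj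

lemma tendsto_matrix_iff {l m : Type*} {M : ℕ → Matrix l m K} {M' : Matrix l m K} :
    Tendsto M atTop (𝓝 M') ↔ ∀ i j, Tendsto (fun n => M n i j) atTop (𝓝 (M' i j)) := by
  refine tendsto_pi_nhds.trans (forall_congr' fun i => tendsto_pi_nhds)

lemma tendsto_matrix_mul {l m n : ℕ} {M : ℕ → Matrix (Fin l) (Fin m) K}
    {N : ℕ → Matrix (Fin m) (Fin n) K} {M' : Matrix (Fin l) (Fin m) K}
    {N' : Matrix (Fin m) (Fin n) K} (hM : Tendsto M atTop (𝓝 M')) (hN : Tendsto N atTop (𝓝 N')) :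
    Tendsto (fun n => M n * N n) atTop (𝓝 (M' * N')) := by
  rw [tendsto_matrix_iff] at hM hN ⊢
  intro i j
  simp only [Matrix.mul_apply]
  exact tendsto_finsetSum _ fun s _ => (hM i s).mul (hN s j)

lemma tendsto_matrix_conjTranspose {l m : ℕ} {M : ℕ → Matrix (Fin l) (Fin m) K}
    {M' : Matrix (Fin l) (Fin m) K} (hM : Tendsto M atTop (𝓝 M')) :
    Tendsto (fun n => (M n)ᴴ) atTop (𝓝 M'ᴴ) :=
  ((continuous_id (X := Matrix (Fin l) (Fin m) K)).matrix_conjTranspose.tendsto M').comp hM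

lemma tendsto_projMat_range {j : ℕ} {Z : ℕ → Matrix (Fin d) (Fin j) K}
    {Y : Matrix (Fin d) (Fin j) K} (h : Tendsto Z atTop (𝓝 Y)) (hY : Yᴴ * Y = 1) :
    Tendsto (fun n => projMat (LinearMap.range (Z n).mulVecLin)) atTop (𝓝 (Y * Yᴴ)) := by
  have h1 : Tendsto (fun n => (Z n)ᴴ * Z n) atTop (𝓝 (Yᴴ * Y)) :=
    tendsto_matrix_mul (tendsto_matrix_conjTranspose h) h
  have hd : (Yᴴ * Y).det ≠ 0 := by rw [hY]; simp
  have hdet : Tendsto (fun n => ((Z n)ᴴ * Z n).det) atTop (𝓝 (Yᴴ * Y).det) :=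
    ((continuous_id (X := Matrix (Fin j) (Fin j) K)).matrix_det.tendsto _).comp h1
  have h2 : Tendsto (fun n => Z n * ((Z n)ᴴ * Z n)⁻¹ * (Z n)ᴴ) atTop
      (𝓝 (Y * (Yᴴ * Y)⁻¹ * Yᴴ)) :=
    tendsto_matrix_mul (tendsto_matrix_mul h (tendsto_matrix_inv h1 hd))
      (tendsto_matrix_conjTranspose h)
  rw [hY, inv_one, Matrix.mul_one] at h2
  refine h2.congr' ?_
  filter_upwards [hdet.eventually_ne hd] with n hn
  rw [projMat_eq (isUnit_iff_ne_zero.2 hn)]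

lemma range_mul_of_isUnit {j : ℕ} (Y : Matrix (Fin d) (Fin j) K) {M : Matrix (Fin j) (Fin j) K}
    (hM : IsUnit M.det) :
    LinearMap.range (Y * M).mulVecLin = LinearMap.range Y.mulVecLin := by
  apply le_antisymm
  · rw [Matrix.mulVecLin_mul]; exact LinearMap.range_comp_le_range _ _
  · have : Y = (Y * M) * M⁻¹ := by
      rw [Matrix.mul_assoc, Matrix.mul_nonsing_inv _ hM, Matrix.mul_one]
    conv_lhs => rw [this]
    rw [Matrix.mulVecLin_mul _ M⁻¹]
    exact LinearMap.range_comp_le_range _ _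

/-- Column operations do not change the range. After dividing `m Y` by its top square block `C` and
compensating the diagonal by `D'`, the entry `(i, s)` is multiplied by `exp (A i - A s)`. The top
block stays the identity, and the rows below decay because the gap tends to infinity, so the frame
converges to `topMat`. The hypothesis on the determinant says that this block is invertible in the
limit. -/
lemma tendsto_projMat_cartan {j : ℕ} (hj : 1 ≤ j) (hjd : j < d)
    {ℓ m : ℕ → Matrix (Fin d) (Fin d) K} {A : ℕ → Fin d → ℝ}
    {ℓ' m' : Matrix (Fin d) (Fin d) K} (hA : ∀ n, Antitone (A n))
    (hℓ' : ℓ' ∈ Matrix.unitaryGroup (Fin d) K)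
    (hℓ : Tendsto ℓ atTop (𝓝 ℓ')) (hm : Tendsto m atTop (𝓝 m'))
    (hgap : Tendsto (fun n => A n ⟨j - 1, by omega⟩ - A n ⟨j, hjd⟩) atTop atTop)
    {Y : Matrix (Fin d) (Fin j) K} (hY : ((topMat K hjd.le)ᴴ * (m' * Y)).det ≠ 0) :
    Tendsto (fun n => projMat (LinearMap.range (ℓ n * expDiag K (A n) * m n * Y).mulVecLin)) atTop
      (𝓝 (ℓ' * (topMat K hjd.le * (topMat K hjd.le)ᴴ) * ℓ'ᴴ)) := by
  set E := topMat K hjd.le with hE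
  set C : ℕ → Matrix (Fin j) (Fin j) K := fun n => Eᴴ * (m n * Y) with hC
  have hCt : Tendsto C atTop (𝓝 (Eᴴ * (m' * Y))) :=
    tendsto_matrix_mul tendsto_const_nhds (tendsto_matrix_mul hm tendsto_const_nhds)
  have hCdet : ∀ᶠ n in atTop, (C n).det ≠ 0 :=
    (((continuous_id (X := Matrix (Fin j) (Fin j) K)).matrix_det.tendsto _).comp hCt).eventually_ne hY
  set N : ℕ → Matrix (Fin d) (Fin j) K := fun n => m n * Y * (C n)⁻¹ with hN
  have hNt : Tendsto N atTop (𝓝 (m' * Y * (Eᴴ * (m' * Y))⁻¹)) :=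
    tendsto_matrix_mul (tendsto_matrix_mul hm tendsto_const_nhds) (tendsto_matrix_inv hCt hY)
  set D' : ℕ → Matrix (Fin j) (Fin j) K := fun n =>
    expDiag K (fun s => - A n (Fin.castLE hjd.le s)) with hD'
  set Z : ℕ → Matrix (Fin d) (Fin j) K := fun n => expDiag K (A n) * N n * D' n with hZ
  have hZe : ∀ n i s, Z n i s
      = ((Real.exp (A n i - A n (Fin.castLE hjd.le s)) : ℝ) : K) * N n i s := by
    intro n i s
    rw [hZ, hD']
    simp only [expDiag, Matrix.mul_diagonal, Matrix.diagonal_mul]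
    rw [sub_eq_add_neg, Real.exp_add, RCLike.ofReal_mul]
    ring
  have hZt : Tendsto Z atTop (𝓝 E) := by
    rw [tendsto_matrix_iff]
    intro i s
    simp only [hZe]
    by_cases hi : (i : ℕ) < j
    · refine tendsto_const_nhds.congr' ?_
      filter_upwards [hCdet] with n hn
      have h1 : Eᴴ * N n = 1 := by
        rw [hN]; simp only
        rw [← Matrix.mul_assoc]
        exact Matrix.mul_nonsing_inv _ (isUnit_iff_ne_zero.2 hn)
      rw [hE, topMat_conjTranspose_mul] at h1
      have h2 := congrFun (congrFun h1 ⟨i, hi⟩) s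
      have h3 : N n i s = (1 : Matrix (Fin j) (Fin j) K) ⟨i, hi⟩ s := h2
      rw [h3, hE, topMat, selMat, Matrix.of_apply, Matrix.one_apply]
      by_cases his : i = Fin.castLE hjd.le s
      · subst his
        simp
      · rw [if_neg his, if_neg, mul_zero]
        intro h
        exact his (by rw [← h]; rfl)
    · have h0 : E i s = 0 := by
        rw [hE, topMat, selMat, Matrix.of_apply, if_neg]
        rintro rfl
        exact hi s.2
      rw [h0]
      have hexp : Tendsto (fun n => Real.exp (A n i - A n (Fin.castLE hjd.le s))) atTop (𝓝 0) := by
        refine Real.tendsto_exp_atBot.comp ?_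
        refine tendsto_atBot_mono (fun n => ?_) (tendsto_neg_atTop_atBot.comp hgap)
        have h1 := hA n (show (⟨j, hjd⟩ : Fin d) ≤ i from Fin.le_def.2 (not_lt.1 hi))
        have h2 := hA n (show Fin.castLE hjd.le s ≤ (⟨j - 1, by omega⟩ : Fin d) from
          Fin.le_def.2 (by have := s.2; simp; omega))
        simp only [Function.comp_apply]
        linarith
      have h1 := ((RCLike.continuous_ofReal (K := K)).tendsto 0).comp hexp
      have h2 := h1.mul (tendsto_matrix_iff.1 hNt i s)
      simpa using h2
  have hfin := tendsto_projMat_range (tendsto_matrix_mul hℓ hZt) (unitary_mul_topMat hjd.le hℓ')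
  rw [← mul_mul_conjTranspose_mul] at hfin
  refine hfin.congr' ?_
  filter_upwards [hCdet] with n hn
  have h1 : ℓ n * Z n = ℓ n * expDiag K (A n) * m n * Y * ((C n)⁻¹ * D' n) := by
    rw [hZ, hN]; simp only [Matrix.mul_assoc]
  rw [h1, range_mul_of_isUnit]
  have h2 : (D' n).det ≠ 0 := by
    simp only [hD', expDiag, Matrix.det_diagonal]
    exact Finset.prod_ne_zero_iff.2 fun s _ => by exact_mod_cast (Real.exp_pos _).ne'
  rw [Matrix.det_mul]
  exact (Matrix.isUnit_nonsing_inv_det _ (isUnit_iff_ne_zero.2 hn)).mul (isUnit_iff_ne_zero.2 h2)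

/-! ### Convergence in the Plücker representation -/

namespace PluckerRep

variable {k : ℕ} {hkd : k < d} (R : PluckerRep K d k hkd)

lemma tendsto_zero_of_dotProduct {n : ℕ} {v : ℕ → Fin n → ℝ}
    (h : Tendsto (fun p => v p ⬝ᵥ v p) atTop (𝓝 0)) : Tendsto v atTop (𝓝 0) := by
  rw [tendsto_pi_nhds]
  intro i
  have h1 : Tendsto (fun p => √(v p ⬝ᵥ v p)) atTop (𝓝 0) := by
    have := (Real.continuous_sqrt.tendsto 0).comp h
    rwa [Real.sqrt_zero] at this
  refine squeeze_zero_norm (fun p => ?_) h1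
  rw [Real.norm_eq_abs, ← Real.sqrt_sq_eq_abs]
  refine Real.sqrt_le_sqrt ?_
  rw [dotProduct, sq]
  exact Finset.single_le_sum (f := fun i => v p i * v p i) (fun i _ => mul_self_nonneg _)
    (Finset.mem_univ i)

/-- After rescaling, `top` is fixed and its orthogonal complement is contracted by at least `exp
(-gap)`. The limit is the orthogonal projection to the top line. -/
lemma tendsto_expDiag {A : ℕ → Fin d → ℝ} (hA : ∀ n, Antitone (A n))
    (hgap : Tendsto (fun n => R.gap (A n)) atTop atTop) :
    Tendsto (fun n => Real.exp (- R.topExp (A n)) • R.τ (expDiag K (A n))) atTop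
      (𝓝 ((R.top ⬝ᵥ R.top)⁻¹ • Matrix.vecMulVec R.top R.top)) := by
  have key : ∀ u : Fin R.n → ℝ, Tendsto (fun n =>
      (Real.exp (- R.topExp (A n)) • R.τ (expDiag K (A n))) *ᵥ u) atTop
      (𝓝 (((R.top ⬝ᵥ R.top)⁻¹ • Matrix.vecMulVec R.top R.top) *ᵥ u)) := by
    intro u
    obtain ⟨α, v, rfl, hv⟩ := R.exists_orthogonal u
    have h1 : ((R.top ⬝ᵥ R.top)⁻¹ • Matrix.vecMulVec R.top R.top) *ᵥ (α • R.top + v)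
        = α • R.top + 0 := by
      rw [Matrix.smul_mulVec, Matrix.vecMulVec_mulVec, dotProduct_add, hv, add_zero,
        dotProduct_smul]
      ext i
      have := R.top_dotProduct_self_pos.ne'
      simp
      field_simp
    rw [h1]
    have h2 : ∀ n, (Real.exp (- R.topExp (A n)) • R.τ (expDiag K (A n))) *ᵥ (α • R.top + v)
        = α • R.top + (Real.exp (- R.topExp (A n)) • R.τ (expDiag K (A n))) *ᵥ v := by
      intro n
      rw [Matrix.mulVec_add, Matrix.mulVec_smul, Matrix.smul_mulVec, τ_expDiag_top, smul_smul,
        smul_smul, mul_right_comm, mul_assoc, ← Real.exp_add, ← sub_eq_add_neg, sub_self, Real.exp_zero, mul_one]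
    simp only [h2]
    refine tendsto_const_nhds.add (tendsto_zero_of_dotProduct ?_)
    have h3 : Tendsto (fun n => Real.exp (- R.gap (A n)) ^ 2 * (v ⬝ᵥ v)) atTop (𝓝 0) := by
      have := (Real.tendsto_exp_atBot.comp (tendsto_neg_atTop_atBot.comp hgap)).pow 2
      have := this.mul_const (v ⬝ᵥ v)
      simpa using this
    refine squeeze_zero (fun n => ?_) (fun n => ?_) h3
    · rw [← norm_toLp_sq_real]; positivity
    · rw [Matrix.smul_mulVec, smul_dotProduct, dotProduct_smul, smul_eq_mul, smul_eq_mul]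
      have h4 := R.τ_expDiag_le (hA n) hv
      have h5 : Real.exp (- R.topExp (A n)) ^ 2 * Real.exp (R.topExp (A n) - R.gap (A n)) ^ 2
          = Real.exp (- R.gap (A n)) ^ 2 := by
        rw [← mul_pow, ← Real.exp_add]; congr 2; ring
      rw [← mul_assoc, ← sq, ← h5, mul_assoc]
      exact mul_le_mul_of_nonneg_left h4 (by positivity)
  rw [tendsto_matrix_iff]
  intro i j
  have := (tendsto_pi_nhds.1 (key (Pi.single j 1))) i
  simpa [Matrix.mulVec_single] using this

lemma τ_top_eq {ℓ : Matrix (Fin d) (Fin d) K} :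
    R.τ ℓ *ᵥ R.top = R.x (ℓ * (topMat K hkd.le * (topMat K hkd.le)ᴴ) * ℓᴴ) := R.τ_x _ _

/-- The outer factors carry the projection onto `top` to a rank one matrix whose two sides are
highest weight vectors: the image is the attracting `k`-plane, and the kernel is defined by the
repelling `(d-k)`-plane. -/
lemma tendsto_τ_cartan {ℓ m : ℕ → Matrix (Fin d) (Fin d) K} {A : ℕ → Fin d → ℝ}
    {ℓ' m' : Matrix (Fin d) (Fin d) K} (hA : ∀ n, Antitone (A n))
    (hℓ : Tendsto ℓ atTop (𝓝 ℓ')) (hm : Tendsto m atTop (𝓝 m'))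
    (hgap : Tendsto (fun n => R.gap (A n)) atTop atTop) :
    Tendsto (fun n => ((R.top ⬝ᵥ R.top) * Real.exp (- R.topExp (A n))) •
        R.τ (ℓ n * expDiag K (A n) * m n)) atTop
      (𝓝 (Matrix.vecMulVec (R.x (ℓ' * (topMat K hkd.le * (topMat K hkd.le)ᴴ) * ℓ'ᴴ))
        (R.x (m'ᴴ * (topMat K hkd.le * (topMat K hkd.le)ᴴ) * m')))) := by
  have h1 := tendsto_matrix_mul (tendsto_matrix_mul ((R.continuous_τ.tendsto ℓ').comp hℓ)
    (R.tendsto_expDiag hA hgap)) ((R.continuous_τ.tendsto m').comp hm)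
  have h2 := h1.const_smul (R.top ⬝ᵥ R.top)
  have h3 := R.top_dotProduct_self_pos.ne'
  have h4 : R.τ m'ᴴ *ᵥ R.top = R.x (m'ᴴ * (topMat K hkd.le * (topMat K hkd.le)ᴴ) * m') := by
    rw [τ_top_eq, Matrix.conjTranspose_conjTranspose]
  have h5 : (R.top ⬝ᵥ R.top) • (R.τ ℓ' * ((R.top ⬝ᵥ R.top)⁻¹ • Matrix.vecMulVec R.top R.top)
      * R.τ m') = Matrix.vecMulVec (R.x (ℓ' * (topMat K hkd.le * (topMat K hkd.le)ᴴ) * ℓ'ᴴ))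
        (R.x (m'ᴴ * (topMat K hkd.le * (topMat K hkd.le)ᴴ) * m')) := by
    rw [Matrix.mul_smul, Matrix.smul_mul, smul_smul, mul_inv_cancel₀ h3, one_smul,
      Matrix.mul_vecMulVec, Matrix.vecMulVec_mul, τ_top_eq, ← Matrix.mulVec_transpose,
      ← R.τ_conjTranspose, h4]
  rw [h5] at h2
  refine h2.congr fun n => ?_
  simp only [Function.comp_apply, Matrix.mul_smul, Matrix.smul_mul, smul_smul, map_mul]

end PluckerRep

end TransverseGroups

namespace TransverseGroups

open Matrix

variable {K : Type*} [RCLike K] {d : ℕ} {θ : Finset ℕ}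

/-! ### Limits of sequences in a divergent group -/

lemma isCompact_unitaryGroup :
    IsCompact (Matrix.unitaryGroup (Fin d) K : Set (Matrix (Fin d) (Fin d) K)) := by
  have h1 : IsCompact (Set.pi Set.univ fun _ : Fin d => Set.pi Set.univ fun _ : Fin d =>
      Metric.closedBall (0 : K) 1) :=
    isCompact_univ_pi fun _ => isCompact_univ_pi fun _ => isCompact_closedBall _ _
  refine IsCompact.of_isClosed_subset h1 ?_ ?_
  · have : (Matrix.unitaryGroup (Fin d) K : Set (Matrix (Fin d) (Fin d) K))
        = {M | M * Mᴴ = 1} := by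
      ext M
      exact Matrix.mem_unitaryGroup_iff
    rw [this]
    exact isClosed_eq (continuous_id.matrix_mul continuous_id.matrix_conjTranspose)
      continuous_const
  · intro M hM i _ j _
    rw [mem_closedBall_zero_iff]
    exact entry_norm_bound_of_unitary hM i j

lemma exists_subseq_unitaryGroup {ℓ : ℕ → Matrix (Fin d) (Fin d) K}
    (hℓ : ∀ n, ℓ n ∈ Matrix.unitaryGroup (Fin d) K) :
    ∃ ℓ' ∈ Matrix.unitaryGroup (Fin d) K, ∃ φ : ℕ → ℕ, StrictMono φ ∧
      Tendsto (ℓ ∘ φ) atTop (𝓝 ℓ') := by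
  have : FirstCountableTopology (Matrix (Fin d) (Fin d) K) :=
    inferInstanceAs (FirstCountableTopology (Fin d → Fin d → K))
  exact isCompact_unitaryGroup.tendsto_subseq hℓ

lemma tendsto_stdFlag (hθ : ∀ j ∈ θ, j ≤ d) {ℓ : ℕ → Matrix (Fin d) (Fin d) K}
    (hℓ : ∀ n, ℓ n ∈ Matrix.unitaryGroup (Fin d) K) {ℓ' : Matrix (Fin d) (Fin d) K}
    (hℓ' : ℓ' ∈ Matrix.unitaryGroup (Fin d) K) (h : Tendsto ℓ atTop (𝓝 ℓ')) :
    Tendsto (fun n => stdFlag hθ (hℓ n)) atTop (𝓝 (stdFlag hθ hℓ')) := by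
  rw [tendsto_flag_iff]
  intro j
  simp only [projMat_stdFlag]
  exact tendsto_matrix_mul (tendsto_matrix_mul h tendsto_const_nhds)
    (tendsto_matrix_conjTranspose h)

lemma tendsto_repFlag (hθ : ∀ j ∈ θ, j ≤ d) {m : ℕ → Matrix (Fin d) (Fin d) K}
    (hm : ∀ n, m n ∈ Matrix.unitaryGroup (Fin d) K) {m' : Matrix (Fin d) (Fin d) K}
    (hm' : m' ∈ Matrix.unitaryGroup (Fin d) K) (h : Tendsto m atTop (𝓝 m')) :
    Tendsto (fun n => repFlag hθ (hm n)) atTop (𝓝 (repFlag hθ hm')) :=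
  tendsto_stdFlag hθ _ _ (tendsto_matrix_mul (tendsto_matrix_conjTranspose h) tendsto_const_nhds)

lemma isTransverse_repFlag_iff (hθ : ∀ j ∈ θ, j ≤ d)
    {m : Matrix (Fin d) (Fin d) K} (hm : m ∈ Matrix.unitaryGroup (Fin d) K) {W : Submodule K (Fin d → K)}
    {j : ℕ} (hj : j ≤ d) {l : θ} (hjl : j + l = d) {Y : Matrix (Fin d) (Fin j) K} (hY : Yᴴ * Y = 1)
    (hYW : LinearMap.range Y.mulVecLin = W) :
    IsCompl W ((repFlag hθ hm).space l) ↔ ((topMat K hj)ᴴ * (m * Y)).det ≠ 0 := by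
  have hlj : (l : ℕ) + j = d := by omega
  have hWd : Module.finrank K W = j := by
    rw [← hYW, LinearMap.finrank_range_of_inj (mulVec_injective_of_orthonormal hY)]
    simp
  have hmm : m * mᴴ = 1 := Matrix.mem_unitaryGroup_iff.1 hm
  have key := isCompl_iff_det_ne_zero hWd (W' := (repFlag hθ hm).space l) (C := mᴴ * topMat K hj)
    (by rw [PartialFlag.finrank_space, hlj]) (mulVec_injective_of_orthonormal hY) hYW
  rw [Matrix.conjTranspose_mul, Matrix.conjTranspose_conjTranspose, Matrix.mul_assoc] at key
  apply key
  intro v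
  rw [mem_iff_projMat_mulVec, ← sub_eq_zero, ← neg_eq_zero, neg_sub]
  have h1 := one_sub_projMat_repFlag hθ hm (j := l) hlj
  have h2 : v - projMat ((repFlag hθ hm).space l) *ᵥ v
      = mᴴ *ᵥ (topMat K hj *ᵥ (((topMat K hj)ᴴ * m) *ᵥ v)) := by
    rw [← Matrix.one_mulVec v, Matrix.mulVec_mulVec, ← Matrix.sub_mulVec, Matrix.mul_one, h1]
    simp only [Matrix.mulVec_mulVec, Matrix.mul_assoc, Matrix.mul_one]
  rw [h2]
  refine ⟨fun h => ?_, fun h => by rw [h, Matrix.mulVec_zero, Matrix.mulVec_zero]⟩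
  have h3 := congrArg (fun w => (topMat K hj)ᴴ *ᵥ (m *ᵥ w)) h
  have h4 : (topMat K hj)ᴴ * (m * (mᴴ * (topMat K hj * ((topMat K hj)ᴴ * m))))
      = (topMat K hj)ᴴ * m := by
    rw [← Matrix.mul_assoc m, hmm, Matrix.one_mul, ← Matrix.mul_assoc,
      topMat_conjTranspose_mul_self, Matrix.one_mul]
  simpa only [Matrix.mulVec_mulVec, Matrix.mulVec_zero, h4] using h3

namespace PluckerRep

variable {k : ℕ} {hkd : k < d} (R : PluckerRep K d k hkd)

/-- The vector representing `F^k` in the Plücker representation. -/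
def vec (hk : k ∈ θ) (F : PartialFlag K d θ) : Fin R.n → ℝ := R.x (projMat (F.space ⟨k, hk⟩))

/-- The functional representing `F^{d-k}` in the Plücker representation. -/
def dual (hk' : d - k ∈ θ) (F : PartialFlag K d θ) : Fin R.n → ℝ :=
  R.x (1 - projMat (F.space ⟨d - k, hk'⟩))

end PluckerRep

/-- The sequence `γ` contracts the flags transverse to `G` to `F`, and similarly in the Plücker
representations. -/
structure IsContracting (γ : ℕ → PGL d K) (F G : PartialFlag K d θ) : Prop where
  exists_rep : ∃ B : ℕ → Matrix.GeneralLinearGroup (Fin d) K,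
    (∀ n, Matrix.ProjGenLinGroup.mk (B n) = γ n) ∧
    ∀ (j : ℕ) (hjd : j < d) (R : PluckerRep K d j hjd) (hj : j ∈ θ) (hj' : d - j ∈ θ),
      ∃ r : ℕ → ℝ, (∀ n, 0 < r n) ∧ Tendsto (fun n => r n • R.τ (B n)) atTop
        (𝓝 (Matrix.vecMulVec (R.vec hj F) (R.dual hj' G)))
  tendsto_smul : ∀ H : PartialFlag K d θ, H.IsTransverse G →
    Tendsto (fun n => γ n • H) atTop (𝓝 F)

lemma IsContracting.comp {γ : ℕ → PGL d K} {F G : PartialFlag K d θ} (h : IsContracting γ F G)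
    {φ : ℕ → ℕ} (hφ : StrictMono φ) : IsContracting (γ ∘ φ) F G := by
  obtain ⟨⟨B, hB, h1⟩, h2⟩ := h
  refine ⟨⟨B ∘ φ, fun n => hB _, fun j hjd R hj hj' => ?_⟩, fun H hH =>
    (h2 H hH).comp hφ.tendsto_atTop⟩
  obtain ⟨r, hr, h3⟩ := h1 j hjd R hj hj'
  exact ⟨r ∘ φ, fun n => hr _, h3.comp hφ.tendsto_atTop⟩

lemma isContracting_of_cartan (hθ : ∀ j ∈ θ, 1 ≤ j ∧ j < d) (hsymm : ∀ j ∈ θ, d - j ∈ θ)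
    {Γ : Subgroup (PGL d K)} (hdiv : ∀ j ∈ θ, IsDivergent j Γ) (hθ' : ∀ j ∈ θ, j ≤ d)
    {γ : ℕ → PGL d K} (hγ : ∀ n, γ n ∈ Γ) (hinj : Function.Injective γ)
    {ℓ m : ℕ → Matrix (Fin d) (Fin d) K} {A : ℕ → Fin d → ℝ}
    {ℓ' m' : Matrix (Fin d) (Fin d) K} (hA : ∀ n, Antitone (A n))
    (hℓ : ∀ n, ℓ n ∈ Matrix.unitaryGroup (Fin d) K) (hm : ∀ n, m n ∈ Matrix.unitaryGroup (Fin d) K)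
    (hℓ' : ℓ' ∈ Matrix.unitaryGroup (Fin d) K) (hm' : m' ∈ Matrix.unitaryGroup (Fin d) K)
    (hℓt : Tendsto ℓ atTop (𝓝 ℓ')) (hmt : Tendsto m atTop (𝓝 m'))
    {B : ℕ → Matrix.GeneralLinearGroup (Fin d) K} (hBγ : ∀ n, Matrix.ProjGenLinGroup.mk (B n) = γ n)
    (hBA : ∀ n, (B n : Matrix (Fin d) (Fin d) K) = ℓ n * expDiag K (A n) * m n) :
    IsContracting γ (stdFlag hθ' hℓ') (repFlag hθ' hm') := by
  have hgap : ∀ j (hj : j ∈ θ), Tendsto (fun n => A n ⟨j - 1, by have := hθ j hj; omega⟩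
      - A n ⟨j, (hθ j hj).2⟩) atTop atTop := by
    intro j hj
    refine (hdiv j hj γ hγ hinj).congr fun n => ?_
    exact simpleRoot_cartanProjection (hBγ _) (hℓ _) (hm _) (hA _) (hBA _) (hθ j hj).1 (hθ j hj).2
  refine ⟨⟨B, hBγ, fun j hjd R hj hj' => ⟨fun n => (R.top ⬝ᵥ R.top) * Real.exp (- R.topExp (A n)),
      fun n => mul_pos R.top_dotProduct_self_pos (Real.exp_pos _), ?_⟩⟩, ?_⟩
  · have h1 := R.tendsto_τ_cartan hA hℓt hmt (hgap j hj)
    simp only [← hBA] at h1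
    rw [PluckerRep.vec, PluckerRep.dual, projMat_stdFlag,
      one_sub_projMat_repFlag hθ' hm' (l := j) (by simp only; omega)]
    exact h1
  · intro H hH
    rw [tendsto_flag_iff]
    intro j
    obtain ⟨Y, hY, hYH⟩ := exists_orthonormal_matrix (H.finrank_space j)
    have hj := hθ j j.2
    have h1 := hH j ⟨d - j, hsymm j j.2⟩ (by simp only; omega)
    rw [isTransverse_repFlag_iff hθ' hm' hj.2.le (by simp only; omega) hY hYH] at h1
    have h2 := tendsto_projMat_cartan hj.1 hj.2 hA hℓ' hℓt hmt (hgap j j.2) h1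
    rw [projMat_stdFlag]
    refine h2.congr fun n => ?_
    rw [← hBγ, space_mk_smul _ _ _ hYH, hBA]

lemma revMat_mul_self : revMat K d * revMat K d = 1 := by
  have h1 : revMat K d = (revMat K d)ᴴ := by
    ext i j
    simp only [revMat, selMat, Matrix.of_apply, Matrix.conjTranspose_apply]
    by_cases hij : i = Fin.rev j
    · subst hij; simp
    · rw [if_neg hij, if_neg, star_zero]
      rintro rfl; simp at hij
  have h2 : (revMat K d)ᴴ * revMat K d = 1 := Matrix.mem_unitaryGroup_iff'.1 revMat_mem
  rwa [← h1] at h2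

/-- Sequences in a divergent group are contracting, up to the choice of a subsequence. -/
lemma exists_subseq_isContracting (hθ : ∀ j ∈ θ, 1 ≤ j ∧ j < d) (hsymm : ∀ j ∈ θ, d - j ∈ θ)
    {Γ : Subgroup (PGL d K)} (hdiv : ∀ j ∈ θ, IsDivergent j Γ)
    {γ : ℕ → PGL d K} (hγ : ∀ n, γ n ∈ Γ) (hinj : Function.Injective γ)
    {U : ℕ → PartialFlag K d θ} (hU : ∀ n, IsCartanFlag (γ n) (U n)) :
    ∃ φ : ℕ → ℕ, StrictMono φ ∧ ∃ F ∈ flagLimitSet θ Γ, ∃ G ∈ flagLimitSet θ Γ,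
      Tendsto (U ∘ φ) atTop (𝓝 F) ∧ IsContracting (γ ∘ φ) F G ∧
      IsContracting (fun n => (γ (φ n))⁻¹) G F := by
  have hθ' : ∀ j ∈ θ, j ≤ d := fun j hj => (hθ j hj).2.le
  choose ℓ hℓ m hm A hA hA0 hB hUs using fun n => (isCartanFlag_iff hθ').1 (hU n)
  choose B hBγ hBA using hB
  obtain ⟨ℓ', hℓ', φ₁, hφ₁, hℓt⟩ := exists_subseq_unitaryGroup hℓ
  obtain ⟨m', hm', φ₂, hφ₂, hmt⟩ := exists_subseq_unitaryGroup fun n => hm (φ₁ n)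
  set φ : ℕ → ℕ := φ₁ ∘ φ₂ with hφ
  have hφm : StrictMono φ := hφ₁.comp hφ₂
  have hℓt' : Tendsto (fun n => ℓ (φ n)) atTop (𝓝 ℓ') := hℓt.comp hφ₂.tendsto_atTop
  have hmt' : Tendsto (fun n => m (φ n)) atTop (𝓝 m') := hmt
  have hUt : Tendsto (fun n => U (φ n)) atTop (𝓝 (stdFlag hθ' hℓ')) := by
    simp only [hUs]
    exact tendsto_stdFlag hθ' (fun n => hℓ (φ n)) hℓ' hℓt'
  have hVt := tendsto_repFlag hθ' (fun n => hm (φ n)) hm' hmt'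
  have hV : ∀ n, IsCartanFlag (γ (φ n))⁻¹ (repFlag hθ' (hm (φ n))) := fun n =>
    isCartanFlag_inv hθ' (hℓ _) (hm _) (hA _) (hA0 _) (hBγ _) (hBA _)
  have hinj' := inv_injective.comp (hinj.comp hφm.injective)
  refine ⟨φ, hφm, stdFlag hθ' hℓ', ⟨γ ∘ φ, U ∘ φ, fun n => hγ _, hinj.comp hφm.injective,
    fun n => hU _, hUt⟩, repFlag hθ' hm', ⟨fun n => (γ (φ n))⁻¹, _, fun n => inv_mem (hγ _),
    hinj', hV, hVt⟩, hUt, ?_, ?_⟩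
  · exact isContracting_of_cartan hθ hsymm hdiv hθ' (fun n => hγ _) (hinj.comp hφm.injective)
      (fun n => hA _) (fun n => hℓ _) (fun n => hm _) hℓ' hm' hℓt' hmt' (fun n => hBγ _)
      (fun n => hBA _)
  · have hm2 : ∀ {l : Matrix (Fin d) (Fin d) K}, l ∈ Matrix.unitaryGroup (Fin d) K →
        (revMat K d)ᴴ * lᴴ ∈ Matrix.unitaryGroup (Fin d) K := fun hl =>
      mul_mem (Unitary.star_mem revMat_mem) (Unitary.star_mem hl)
    have h1 := isContracting_of_cartan (γ := fun n => (γ (φ n))⁻¹) (B := fun n => (B (φ n))⁻¹)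
      hθ hsymm hdiv hθ' (fun n => inv_mem (hγ _)) hinj'
      (A := fun n i => - A (φ n) i.rev)
      (fun n i j hij => neg_le_neg (hA _ (Fin.rev_le_rev.2 hij)))
      (fun n => mul_mem (Unitary.star_mem (hm (φ n))) (revMat_mem (K := K)))
      (fun n => hm2 (hℓ (φ n)))
      (mul_mem (Unitary.star_mem hm') (revMat_mem (K := K))) (hm2 hℓ')
      (tendsto_matrix_mul (tendsto_matrix_conjTranspose hmt') tendsto_const_nhds)
      (tendsto_matrix_mul tendsto_const_nhds (tendsto_matrix_conjTranspose hℓt'))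
      (fun n => by rw [map_inv, hBγ])
      (fun n => cartan_inv (hℓ _) (hm _) (hBA _))
    -- Inverting twice reverses the basis twice, so the repelling flag of the inverse sequence is
    -- the attracting flag of the original one.
    have h2 : star ((revMat K d)ᴴ * ℓ'ᴴ) * revMat K d = ℓ' := by
      rw [Matrix.star_eq_conjTranspose, Matrix.conjTranspose_mul, Matrix.conjTranspose_conjTranspose,
        Matrix.conjTranspose_conjTranspose, Matrix.mul_assoc, revMat_mul_self, Matrix.mul_one]
    have h3 : repFlag hθ' (hm2 hℓ') = stdFlag hθ' hℓ' := by
      rw [repFlag]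
      congr 1
    rw [h3] at h1
    exact h1

end TransverseGroups

namespace TransverseGroups

open Matrix

variable {K : Type*} [RCLike K] {d : ℕ} {θ : Finset ℕ}

/-! ### Flags as vectors and functionals. -/

namespace PluckerRep

variable {k : ℕ} {hkd : k < d} (R : PluckerRep K d k hkd)

lemma τ_smul (u : K) (M : Matrix (Fin d) (Fin d) K) : R.τ (u • M) = ‖u‖ ^ (2 * k) • R.τ M := by
  have h : u • M = (u • 1) * M := by rw [Matrix.smul_mul, Matrix.one_mul]
  rw [h, map_mul, R.τ_smul_one, Matrix.smul_mul, Matrix.one_mul]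

/-- Both sides have the same pairing with every highest weight vector, and these vectors separate
points. This makes the line of `x (B * Bᴴ)` depend only on the range of `B` when `B` has rank `k`.
-/
lemma x_mul (B : Matrix (Fin d) (Fin k) K) (M : Matrix (Fin k) (Fin k) K) :
    R.x ((B * M) * (B * M)ᴴ) = ‖M.det‖ ^ 2 • R.x (B * Bᴴ) := by
  rw [← sub_eq_zero]
  obtain ⟨c, -, hc⟩ := R.x_dotProduct
  refine R.eq_zero_of_dotProduct _ fun C => ?_
  rw [sub_dotProduct, smul_dotProduct, hc, hc, ← Matrix.mul_assoc, Matrix.det_mul, norm_mul,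
    smul_eq_mul]
  ring

lemma x_ne_zero_of_orthonormal {B : Matrix (Fin d) (Fin k) K} (hB : Bᴴ * B = 1) :
    R.x (B * Bᴴ) ≠ 0 := by
  obtain ⟨c, hc, h⟩ := R.x_dotProduct
  intro h0
  have := h B B
  rw [hB, h0, zero_dotProduct, Matrix.det_one, norm_one] at this
  linarith

variable (hk : k ∈ θ) (hk' : d - k ∈ θ)

lemma exists_vec_eq (F : PartialFlag K d θ) : ∃ B : Matrix (Fin d) (Fin k) K, Bᴴ * B = 1 ∧
    LinearMap.range B.mulVecLin = F.space ⟨k, hk⟩ ∧ R.vec hk F = R.x (B * Bᴴ) := by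
  obtain ⟨B, hB, h⟩ := exists_orthonormal_matrix (F.finrank_space ⟨k, hk⟩)
  exact ⟨B, hB, h, by rw [vec, ← h, projMat_eq_of_orthonormal hB]⟩

lemma exists_dual_eq (F : PartialFlag K d θ) : ∃ C : Matrix (Fin d) (Fin k) K, Cᴴ * C = 1 ∧
    (∀ v, v ∈ F.space ⟨d - k, hk'⟩ ↔ Cᴴ *ᵥ v = 0) ∧ R.dual hk' F = R.x (C * Cᴴ) := by
  obtain ⟨C, hC, h, h2⟩ := exists_kernel_matrix (j := k) (W := F.space ⟨d - k, hk'⟩)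
    (by rw [F.finrank_space]; simp only; omega)
  exact ⟨C, hC, h2, by rw [dual, h]⟩

lemma vec_ne_zero (F : PartialFlag K d θ) : R.vec hk F ≠ 0 := by
  obtain ⟨B, hB, -, h⟩ := R.exists_vec_eq hk F
  exact h ▸ R.x_ne_zero_of_orthonormal hB

lemma dual_ne_zero (F : PartialFlag K d θ) : R.dual hk' F ≠ 0 := by
  obtain ⟨C, hC, -, h⟩ := R.exists_dual_eq hk' F
  exact h ▸ R.x_ne_zero_of_orthonormal hC

lemma dual_dotProduct_nonneg (F : PartialFlag K d θ) (B : Matrix (Fin d) (Fin k) K) :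
    0 ≤ R.dual hk' F ⬝ᵥ R.x (B * Bᴴ) := by
  obtain ⟨C, -, -, h⟩ := R.exists_dual_eq hk' F
  obtain ⟨c, hc, h2⟩ := R.x_dotProduct
  rw [h, h2]
  positivity

lemma dual_dotProduct_vec_nonneg (F H : PartialFlag K d θ) :
    0 ≤ R.dual hk' F ⬝ᵥ R.vec hk H := by
  obtain ⟨B, -, -, h⟩ := R.exists_vec_eq hk H
  exact h ▸ R.dual_dotProduct_nonneg hk' F B

lemma dual_dotProduct_vec_ne_zero_iff (F H : PartialFlag K d θ) :
    R.dual hk' F ⬝ᵥ R.vec hk H ≠ 0 ↔ IsCompl (H.space ⟨k, hk⟩) (F.space ⟨d - k, hk'⟩) := by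
  obtain ⟨C, hC, hC2, h⟩ := R.exists_dual_eq hk' F
  obtain ⟨B, hB, hB2, h'⟩ := R.exists_vec_eq hk H
  obtain ⟨c, hc, h2⟩ := R.x_dotProduct
  rw [isCompl_iff_det_ne_zero (H.finrank_space _) (by rw [F.finrank_space]; simp only; omega)
    (mulVec_injective_of_orthonormal hB) hB2 hC2, h, h', dotProduct_comm, h2]
  simp [hc.ne']

lemma dual_dotProduct_vec_pos {F H : PartialFlag K d θ} (h : H.IsTransverse F) :
    0 < R.dual hk' F ⬝ᵥ R.vec hk H :=
  lt_of_le_of_ne (R.dual_dotProduct_vec_nonneg hk hk' F H)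
    ((R.dual_dotProduct_vec_ne_zero_iff hk hk' F H).2 (h _ _ (by simp only; omega))).symm

/-- Since `k ≤ d - k`, a flag has `F^k ⊆ F^{d-k}`, so these two subspaces are never complementary.
-/
lemma dual_dotProduct_vec_self (hk1 : 1 ≤ k) (hkk : k ≤ d - k) (F : PartialFlag K d θ) :
    R.dual hk' F ⬝ᵥ R.vec hk F = 0 := by
  by_contra h
  have h1 := (R.dual_dotProduct_vec_ne_zero_iff hk hk' F F).1 h
  have h2 := h1.disjoint.eq_bot_of_le (F.mono ⟨k, hk⟩ ⟨d - k, hk'⟩ hkk)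
  have h3 := F.finrank_space ⟨k, hk⟩
  rw [h2, finrank_bot] at h3
  simp only at h3
  omega

lemma continuous_vec : Continuous fun F : PartialFlag K d θ => R.vec hk F :=
  R.continuous_x.comp ((continuous_apply (⟨k, hk⟩ : θ)).comp isInducing_projMat.continuous)

/-- The vectors of two flags are proportional only if their `k`-dimensional parts agree. -/
lemma space_eq_of_vec_eq_smul {F H : PartialFlag K d θ} {c : ℝ}
    (h : R.vec hk F = c • R.vec hk H) : F.space ⟨k, hk⟩ = H.space ⟨k, hk⟩ := by
  apply Submodule.eq_of_le_of_finrank_eq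
  · intro v hv
    by_contra hv'
    have hd : Disjoint (H.space ⟨k, hk⟩) (Submodule.span K {v}) := by
      rw [Submodule.disjoint_span_singleton' (by rintro rfl; exact hv' (zero_mem _))]
      exact hv'
    -- A complement `W` of `H^k` through `v` separates the two planes: its functional is non-zero at
    -- `H`, hence at `F` by proportionality, although `F^k` meets `W` in `v`.
    obtain ⟨W, hW, hW2⟩ := hd.symm.exists_isCompl
    have hfr : Module.finrank K W + k = d := by
      have h1 := Submodule.finrank_add_eq_of_isCompl hW2
      rw [H.finrank_space, Module.finrank_fin_fun] at h1
      exact h1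
    obtain ⟨C, hC, -, hC2⟩ := exists_kernel_matrix hfr
    obtain ⟨B, hB, hB2, h1⟩ := R.exists_vec_eq hk F
    obtain ⟨B', hB', hB2', h1'⟩ := R.exists_vec_eq hk H
    obtain ⟨e, he, hdot⟩ := R.x_dotProduct
    have h3 : R.vec hk F ⬝ᵥ R.x (C * Cᴴ) ≠ 0 := by
      have h4 : R.vec hk H ⬝ᵥ R.x (C * Cᴴ) ≠ 0 := by
        have := (isCompl_iff_det_ne_zero (H.finrank_space _) hfr
          (mulVec_injective_of_orthonormal hB') hB2' hC2).1 hW2.symm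
        rw [h1', hdot]
        simpa [he.ne'] using this
      rw [h, smul_dotProduct, smul_eq_mul]
      refine mul_ne_zero ?_ h4
      rintro rfl
      exact R.vec_ne_zero hk F (by rw [h, zero_smul])
    have h5 : IsCompl (F.space ⟨k, hk⟩) W := by
      rw [isCompl_iff_det_ne_zero (F.finrank_space _) hfr
          (mulVec_injective_of_orthonormal hB) hB2 hC2]
      rw [h1, hdot] at h3
      intro h0
      simp [h0] at h3
    have h6 := Submodule.disjoint_def.1 h5.disjoint v hv (hW (Submodule.mem_span_singleton_self v))
    exact hv' (h6 ▸ zero_mem _)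
  · rw [F.finrank_space, H.finrank_space]

/-- Equivariance of the Plücker embedding. -/
lemma τ_vec (g : Matrix.GeneralLinearGroup (Fin d) K) (F : PartialFlag K d θ) :
    ∃ a : ℝ, 0 < a ∧ R.τ g *ᵥ R.vec hk F = a • R.vec hk (Matrix.ProjGenLinGroup.mk g • F) := by
  obtain ⟨B, hB, hB2, h⟩ := R.exists_vec_eq hk F
  obtain ⟨C, hC, hC2, h'⟩ := R.exists_vec_eq hk (Matrix.ProjGenLinGroup.mk g • F)
  rw [space_mk_smul g F _ hB2] at hC2
  have hCC : ∀ v, (C * Cᴴ) *ᵥ ((g : Matrix (Fin d) (Fin d) K) *ᵥ (B *ᵥ v))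
      = (g : Matrix (Fin d) (Fin d) K) *ᵥ (B *ᵥ v) := by
    intro v
    have : (g : Matrix (Fin d) (Fin d) K) *ᵥ (B *ᵥ v) ∈ LinearMap.range C.mulVecLin := by
      rw [hC2]
      exact ⟨v, by simp⟩
    obtain ⟨w, hw⟩ := this
    rw [← hw, Matrix.mulVecLin_apply, Matrix.mulVec_mulVec, Matrix.mul_assoc, hC, Matrix.mul_one]
  -- Both `g B` and `C` are frames of `g F^k`, and `C * Cᴴ` is the projection onto it. The change of
  -- frame is `Cᴴ g B`, and `|det|²` of it is the scaling factor.
  have hgB : (g : Matrix (Fin d) (Fin d) K) * B = C * (Cᴴ * ((g : Matrix (Fin d) (Fin d) K) * B)) := by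
    apply Matrix.mulVec_injective
    funext v
    have := hCC v
    simp only [Matrix.mulVec_mulVec, Matrix.mul_assoc] at this ⊢
    exact this.symm
  have h1 : R.τ g *ᵥ R.vec hk F = ‖(Cᴴ * ((g : Matrix (Fin d) (Fin d) K) * B)).det‖ ^ 2 •
      R.vec hk (Matrix.ProjGenLinGroup.mk g • F) := by
    rw [h, R.τ_x, mul_mul_conjTranspose_mul, hgB, R.x_mul, h', ← hgB]
  refine ⟨_, lt_of_le_of_ne (by positivity) fun h0 => ?_, h1⟩
  rw [← h0, zero_smul] at h1
  apply R.vec_ne_zero hk F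
  have h2 := congrArg (fun w => R.τ ((g⁻¹ : Matrix.GeneralLinearGroup (Fin d) K) :
    Matrix (Fin d) (Fin d) K) *ᵥ w) h1
  simp only [Matrix.mulVec_mulVec, ← map_mul, Matrix.mulVec_zero, ← Units.val_mul] at h2
  simpa using h2

end PluckerRep

/-! ### The limit set -/

lemma exists_subseq_const_or_injective {α : Type*} (u : ℕ → α) :
    ∃ φ : ℕ → ℕ, StrictMono φ ∧ ((∀ n, u (φ n) = u (φ 0)) ∨ Function.Injective (u ∘ φ)) := by
  obtain ⟨g, hg⟩ := exists_increasing_or_nonincreasing_subseq (· = ·) u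
  refine ⟨g, g.strictMono, hg.imp (fun h n => ?_) fun h => ?_⟩
  · rcases Nat.eq_zero_or_pos n with rfl | hn
    · rfl
    · exact (h 0 n hn).symm
  · intro m n hmn
    rcases lt_trichotomy m n with h1 | h1 | h1
    · exact absurd hmn (h m n h1)
    · exact h1
    · exact absurd hmn.symm (h n m h1)

/-- The coefficients are not assumed to converge. Being non-negative, they are determined by the
ratio of norms, which does converge. The non-negativity also fixes the sign in the limit. -/
lemma eq_smul_of_tendsto_smul {n : ℕ} {v w : ℕ → Fin n → ℝ} {v' w' : Fin n → ℝ} {c : ℕ → ℝ}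
    (hc : ∀ n, 0 ≤ c n) (h : ∀ n, v n = c n • w n) (hv : Tendsto v atTop (𝓝 v'))
    (hw : Tendsto w atTop (𝓝 w')) (hw' : w' ≠ 0) : v' = (‖v'‖ / ‖w'‖) • w' := by
  have h1 : Tendsto (fun n => (‖v n‖ / ‖w n‖) • w n) atTop (𝓝 ((‖v'‖ / ‖w'‖) • w')) :=
    (hv.norm.div hw.norm (norm_ne_zero_iff.2 hw')).smul hw
  refine tendsto_nhds_unique hv (h1.congr' ?_)
  filter_upwards [hw.eventually_ne hw'] with n hn
  rw [h n, norm_smul, Real.norm_eq_abs, abs_of_nonneg (hc n), mul_div_assoc,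
    div_self (norm_ne_zero_iff.2 hn), mul_one]

lemma tendsto_mulVec {n : ℕ} {M : ℕ → Matrix (Fin n) (Fin n) ℝ} {M' : Matrix (Fin n) (Fin n) ℝ}
    {w : ℕ → Fin n → ℝ} {w' : Fin n → ℝ} (hM : Tendsto M atTop (𝓝 M'))
    (hw : Tendsto w atTop (𝓝 w')) : Tendsto (fun p => M p *ᵥ w p) atTop (𝓝 (M' *ᵥ w')) := by
  rw [tendsto_pi_nhds] at hw ⊢
  intro i
  simp only [Matrix.mulVec, dotProduct]
  exact tendsto_finsetSum _ fun s _ => (tendsto_matrix_iff.1 hM i s).mul (hw s)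

lemma vecMulVec_mulVec_eq_smul {n : ℕ} (v w e : Fin n → ℝ) :
    Matrix.vecMulVec v w *ᵥ e = (w ⬝ᵥ e) • v := by
  rw [Matrix.vecMulVec_mulVec]; simp

/-- The limit set is invariant. -/
lemma smul_mem_flagLimitSet (hθ : ∀ j ∈ θ, 1 ≤ j ∧ j < d) (hsymm : ∀ j ∈ θ, d - j ∈ θ)
    {Γ : Subgroup (PGL d K)} (hdiv : ∀ j ∈ θ, IsDivergent j Γ) {g : PGL d K} (hg : g ∈ Γ)
    {F : PartialFlag K d θ} (hF : F ∈ flagLimitSet θ Γ) : g • F ∈ flagLimitSet θ Γ := by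
  obtain ⟨γ, U, hγ, hinj, hU, hUF⟩ := hF
  obtain ⟨φ, hφ, F', -, G, -, hF', hc, -⟩ := exists_subseq_isContracting hθ hsymm hdiv hγ hinj hU
  obtain rfl : F' = F := tendsto_nhds_unique hF' (hUF.comp hφ.tendsto_atTop)
  have hθ' : ∀ j ∈ θ, j ≤ d := fun j hj => (hθ j hj).2.le
  -- The Cartan flags of `g γ_n` are not the `g`-translates of those of `γ_n`; only the limits
  -- agree. This is seen by comparing the two rank one limits of the rescaled `τ(g) τ(γ_n)` and `τ(g
  -- γ_n)`.
  choose V hV using fun n => exists_isCartanFlag hθ' (g * γ (φ n))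
  obtain ⟨ψ, hψ, F₂, hF₂, G₂, -, -, hc₂, -⟩ := exists_subseq_isContracting hθ hsymm hdiv
    (γ := fun n => g * γ (φ n)) (fun n => mul_mem hg (hγ _))
    ((mul_right_injective g).comp (hinj.comp hφ.injective)) hV
  have hc₁ := hc.comp hψ
  obtain ⟨B, hB, h1⟩ := hc₁.exists_rep
  obtain ⟨C, hC, h2⟩ := hc₂.exists_rep
  obtain ⟨h, rfl⟩ := Matrix.ProjGenLinGroup.mk_surjective g
  suffices Matrix.ProjGenLinGroup.mk h • F' = F₂ by rwa [this]
  ext1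
  funext ⟨j, hj⟩
  have hj' := hsymm j hj
  set R := pluckerRep K (hθ j hj).1 (hθ j hj).2
  obtain ⟨r, hr, h3⟩ := h1 j (hθ j hj).2 R hj hj'
  obtain ⟨r₂, hr₂, h4⟩ := h2 j (hθ j hj).2 R hj hj'
  have hCB : ∀ n, ∃ u : K, u ≠ 0 ∧ (C n : Matrix (Fin d) (Fin d) K)
      = u • (((h * B n : Matrix.GeneralLinearGroup (Fin d) K)) : Matrix (Fin d) (Fin d) K) :=
    fun n => exists_smul_of_mk_eq (by rw [map_mul, hB, hC]; rfl)
  choose u hu hCu using hCB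
  -- A test vector outside the kernels of two non-zero functionals: either `dual G₂` itself or the
  -- sum of both will do.
  obtain ⟨e, he⟩ : ∃ e, R.dual hj' G₂ ⬝ᵥ e ≠ 0 ∧ R.dual hj' G ⬝ᵥ e ≠ 0 := by
    by_contra! hne
    have h5 : ∀ F : PartialFlag K d θ, R.dual hj' F ⬝ᵥ R.dual hj' F ≠ 0 := fun F h0 =>
      R.dual_ne_zero hj' F (dotProduct_self_eq_zero.1 h0)
    have h6 := hne _ (h5 G₂)
    have h7 : R.dual hj' G₂ ⬝ᵥ R.dual hj' G = 0 := by rw [dotProduct_comm]; exact h6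
    refine h5 G ?_
    have := hne (R.dual hj' G₂ + R.dual hj' G)
      (by rw [dotProduct_add, h7, add_zero]; exact h5 G₂)
    rwa [dotProduct_add, h6, zero_add] at this
  have h5 := tendsto_mulVec (tendsto_matrix_mul (tendsto_const_nhds (x := R.τ h)) h3)
    (tendsto_const_nhds (x := e))
  have h6 := tendsto_mulVec h4 (tendsto_const_nhds (x := e))
  obtain ⟨a, ha, hvec⟩ := R.τ_vec hj h F'
  have h7 : (R.τ h * Matrix.vecMulVec (R.vec hj F') (R.dual hj' G)) *ᵥ e
      = ((R.dual hj' G ⬝ᵥ e) * a) • R.vec hj (Matrix.ProjGenLinGroup.mk h • F') := by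
    rw [← Matrix.mulVec_mulVec, vecMulVec_mulVec_eq_smul, Matrix.mulVec_smul, hvec, smul_smul]
  have h8 : Matrix.vecMulVec (R.vec hj F₂) (R.dual hj' G₂) *ᵥ e
      = (R.dual hj' G₂ ⬝ᵥ e) • R.vec hj F₂ := vecMulVec_mulVec_eq_smul _ _ _
  rw [h7] at h5
  rw [h8] at h6
  have h9 := eq_smul_of_tendsto_smul
    (c := fun n => r n / (r₂ n * ‖u n‖ ^ (2 * j))) (fun n => by have := hr n; have := hr₂ n; positivity)
    (fun n => ?_) h5 h6 (smul_ne_zero he.1 (R.vec_ne_zero hj F₂))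
  · rw [smul_smul] at h9
    have h10 := congrArg (fun w => ((R.dual hj' G ⬝ᵥ e) * a)⁻¹ • w) h9
    simp only [smul_smul] at h10
    rw [inv_mul_cancel₀ (mul_ne_zero he.2 ha.ne'), one_smul] at h10
    exact R.space_eq_of_vec_eq_smul hj h10
  · have hr2 := (hr₂ n).ne'
    have hun := (norm_pos_iff.2 (hu n)).ne'
    rw [hCu, R.τ_smul, Units.val_mul, map_mul, smul_smul, Matrix.smul_mulVec, smul_smul,
      div_mul_cancel₀ _ (by positivity), Matrix.mul_smul, Matrix.smul_mulVec]

end TransverseGroups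

namespace TransverseGroups

open Matrix

/-! ### Compactness of the limit set, and faithfulness of the representation on `PGL`. -/

variable {K : Type*} [RCLike K] {d : ℕ} {θ : Finset ℕ}

/-- Every point of the limit set is the attractor of a contracting sequence. -/
lemma exists_isContracting (hθ : ∀ j ∈ θ, 1 ≤ j ∧ j < d) (hsymm : ∀ j ∈ θ, d - j ∈ θ)
    {Γ : Subgroup (PGL d K)} (hdiv : ∀ j ∈ θ, IsDivergent j Γ)
    {F : PartialFlag K d θ} (hF : F ∈ flagLimitSet θ Γ) :
    ∃ (γ : ℕ → PGL d K) (G : PartialFlag K d θ), (∀ n, γ n ∈ Γ) ∧ Function.Injective γ ∧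
      G ∈ flagLimitSet θ Γ ∧ IsContracting γ F G ∧ IsContracting (fun n => (γ n)⁻¹) G F := by
  obtain ⟨γ, U, hγ, hinj, hU, hUF⟩ := hF
  obtain ⟨φ, hφ, F', -, G, hG, hF', hc, hc'⟩ :=
    exists_subseq_isContracting hθ hsymm hdiv hγ hinj hU
  obtain rfl : F' = F := tendsto_nhds_unique hF' (hUF.comp hφ.tendsto_atTop)
  exact ⟨γ ∘ φ, G, fun n => hγ _, hinj.comp hφ.injective, hG, hc, hc'⟩

/-- This is a diagonal argument that has to keep the group elements distinct: each new one is chosen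
in a smaller neighbourhood and outside the finite set of those already chosen. -/
lemma isClosed_flagLimitSet (Γ : Subgroup (PGL d K)) : IsClosed (flagLimitSet θ Γ) := by
  classical
  have : FirstCountableTopology (Matrix (Fin d) (Fin d) K) :=
    inferInstanceAs (FirstCountableTopology (Fin d → Fin d → K))
  have : FirstCountableTopology (PartialFlag K d θ) := isInducing_projMat.firstCountableTopology
  refine isClosed_of_closure_subset fun F hF => ?_
  obtain ⟨N, hN⟩ := (𝓝 F).exists_antitone_basis
  obtain ⟨f, hf, hf'⟩ := exists_seq_of_forall_finset_exists
    (fun p : ℕ × PGL d K × PartialFlag K d θ => p.2.1 ∈ Γ ∧ IsCartanFlag p.2.1 p.2.2 ∧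
      p.2.2 ∈ N p.1) (fun p q => p.1 < q.1 ∧ p.2.1 ≠ q.2.1) (by
    intro s _
    obtain ⟨i, hi⟩ : ∃ i, ∀ x ∈ s, x.1 < i :=
      ⟨s.sup Prod.fst + 1, fun x hx => Nat.lt_succ_of_le (Finset.le_sup (f := Prod.fst) hx)⟩
    obtain ⟨F', hF', γ, U, hγ, hinj, hU, hUF⟩ :=
      mem_closure_iff_nhds.1 hF _ (interior_mem_nhds.2 (hN.1.mem_of_mem (i := i) trivial))
    have h1 : ∀ᶠ n in atTop, U n ∈ N i := hUF (mem_interior_iff_mem_nhds.1 hF')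
    have h2 : ∀ᶠ n in atTop, γ n ∉ s.image fun x => x.2.1 := by
      have := hinj.tendsto_cofinite.eventually
        (s.image fun x => x.2.1).finite_toSet.compl_mem_cofinite
      rw [Nat.cofinite_eq_atTop] at this
      exact this
    obtain ⟨n, hn1, hn2⟩ := (h1.and h2).exists
    refine ⟨(i, γ n, U n), ⟨hγ n, hU n, hn1⟩, fun x hx => ⟨hi x hx, fun h => hn2 ?_⟩⟩
    exact Finset.mem_image.2 ⟨x, hx, h⟩)
  have hmono : StrictMono fun n => (f n).1 := fun m n h => (hf' m n h).1
  refine ⟨fun n => (f n).2.1, fun n => (f n).2.2, fun n => (hf n).1, ?_, fun n => (hf n).2.1, ?_⟩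
  · intro m n hmn
    rcases lt_trichotomy m n with h | h | h
    · exact absurd hmn (hf' m n h).2
    · exact h
    · exact absurd hmn.symm (hf' n m h).2
  · exact hN.tendsto fun n => hN.2 (hmono.id_le n) (hf n).2.2

lemma isCompact_flagLimitSet (hθ : ∀ j ∈ θ, 1 ≤ j ∧ j < d) (Γ : Subgroup (PGL d K)) :
    IsCompact (flagLimitSet θ Γ) := by
  have hθ' : ∀ j ∈ θ, j ≤ d := fun j hj => (hθ j hj).2.le
  have hcomp : CompactSpace (Matrix.unitaryGroup (Fin d) K) :=
    isCompact_iff_compactSpace.1 isCompact_unitaryGroup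
  have hcont : Continuous fun ℓ : Matrix.unitaryGroup (Fin d) K => stdFlag hθ' ℓ.2 := by
    rw [isInducing_projMat.continuous_iff, continuous_pi_iff]
    intro j
    simp only [Function.comp_apply, projMat_stdFlag]
    exact (continuous_subtype_val.matrix_mul continuous_const).matrix_mul
      continuous_subtype_val.matrix_conjTranspose
  refine (isCompact_range hcont).of_isClosed_subset (isClosed_flagLimitSet Γ) ?_
  rintro F ⟨γ, U, -, -, hU, hUF⟩
  refine (isCompact_range hcont).isClosed.mem_of_tendsto hUF (Eventually.of_forall fun n => ?_)
  obtain ⟨ℓ, hℓ, -, -, -, -, -, -, h⟩ := (isCartanFlag_iff hθ').1 (hU n)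
  exact ⟨⟨ℓ, hℓ⟩, h.symm⟩

namespace PluckerRep

variable {k : ℕ} {hkd : k < d} (R : PluckerRep K d k hkd)

/-- If `g` is not scalar, some `v` and `g v` are independent, and some `P` of determinant one
carries two coordinate lines, one inside and one outside the span of the first `k`, to the lines of
`v` and `g v`. The `k`-plane of `P E` and the functional of `C = (Eᴴ P⁻¹)ᴴ` then pair to a non-zero
number, but after applying `g` a column of the determinant vanishes. So `τ(g)` moves this highest
weight line. -/
lemma exists_eq_smul_one_of_τ_eq_smul (hk1 : 1 ≤ k) {g : Matrix (Fin d) (Fin d) K} {u : ℝ}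
    (hu : u ≠ 0) (h : R.τ g = u • 1) : ∃ a : K, g = a • 1 := by
  obtain ⟨a, ha⟩ := LinearMap.exists_eq_smul_id_of_forall_notLinearIndependent
    (f := g.mulVecLin) fun v hv => by
      have hv0 : v ≠ 0 := hv.ne_zero 0
      have hgv0 : g *ᵥ v ≠ 0 := hv.ne_zero 1
      have h0 : 0 < d := by omega
      set i₀ : Fin d := ⟨0, h0⟩
      set i₁ : Fin d := ⟨k, hkd⟩
      have hi : i₀ ≠ i₁ := by simp [i₀, i₁, Fin.ext_iff]; omega
      have hs : ∀ i : Fin d, (Pi.single i 1 : Fin d → K) ≠ 0 := fun i => by simp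
      have hne : Projectivization.mk K v hv0 ≠ Projectivization.mk K (g *ᵥ v) hgv0 := by
        rw [Ne, Projectivization.mk_eq_mk_iff']
        rintro ⟨a, ha⟩
        have h1 := ((LinearIndependent.pair_iff.1 hv) 1 (-a)
          (by rw [one_smul, neg_smul, Matrix.mulVecLin_apply, ha, add_neg_cancel])).1
        exact one_ne_zero h1
      have hne' : Projectivization.mk K _ (hs i₀) ≠ Projectivization.mk K _ (hs i₁) := by
        rw [Ne, Projectivization.mk_eq_mk_iff']
        rintro ⟨a, ha⟩
        have := congrFun ha i₀
        simp [hi] at this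
      obtain ⟨P, hP0, hP1⟩ := (MulAction.is_two_pretransitive_iff (G := Matrix.SpecialLinearGroup (Fin d) K)).1
        inferInstance hne' hne
      obtain ⟨a, ha⟩ : ∃ a : K, a • v = P.1 *ᵥ Pi.single i₀ 1 :=
        (Projectivization.mk_eq_mk_iff' K _ _ _ hv0).1 hP0
      obtain ⟨b, hb⟩ : ∃ b : K, b • (P.1 *ᵥ Pi.single i₁ 1) = g *ᵥ v :=
        (Projectivization.mk_eq_mk_iff' K _ _ hgv0 _).1 hP1.symm
      set E := topMat K hkd.le with hE
      have hP : P.1⁻¹ * P.1 = 1 := Matrix.nonsing_inv_mul _ (by rw [P.2]; exact isUnit_one)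
      obtain ⟨c, hc, hdot⟩ := R.x_dotProduct
      have h1 := R.τ_x g (P.1 * E)
      rw [h, mul_mul_conjTranspose_mul, Matrix.smul_mulVec, Matrix.one_mulVec] at h1
      set C := (Eᴴ * P.1⁻¹)ᴴ with hC
      have hCB : Cᴴ * (P.1 * E) = 1 := by
        rw [hC, Matrix.conjTranspose_conjTranspose, Matrix.mul_assoc, ← Matrix.mul_assoc P.1⁻¹, hP,
          Matrix.one_mul, topMat_conjTranspose_mul_self]
      have h2 : (Cᴴ * (g * (P.1 * E))).det = 0 := by
        apply Matrix.det_eq_zero_of_column_eq_zero (⟨0, hk1⟩ : Fin k)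
        intro i
        have hE0 : E *ᵥ Pi.single (⟨0, hk1⟩ : Fin k) 1 = Pi.single i₀ 1 := by
          ext p
          rw [Matrix.mulVec_single_one, Matrix.col_apply, hE, topMat, selMat, Matrix.of_apply,
            Pi.single_apply]
          rfl
        have h3 : (Cᴴ * (g * (P.1 * E))) *ᵥ Pi.single (⟨0, hk1⟩ : Fin k) 1 = 0 := by
          rw [← Matrix.mulVec_mulVec, ← Matrix.mulVec_mulVec, ← Matrix.mulVec_mulVec, hE0, ← ha,
            Matrix.mulVec_smul, ← hb, hC, Matrix.conjTranspose_conjTranspose, smul_smul,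
            Matrix.mulVec_smul, Matrix.mulVec_mulVec, Matrix.mul_assoc, hP, Matrix.mul_one]
          have : Eᴴ *ᵥ Pi.single i₁ 1 = 0 := by
            ext s
            rw [Matrix.mulVec_single_one, Matrix.col_apply, Matrix.conjTranspose_apply, hE, topMat,
              selMat, Matrix.of_apply, if_neg, star_zero, Pi.zero_apply]
            intro h4
            have h5 : k = s := congrArg Fin.val h4
            have := s.2
            omega
          rw [this, smul_zero]
        have h4 := congrFun h3 i
        rwa [Matrix.mulVec_single_one, Matrix.col_apply, Pi.zero_apply] at h4
      have h3 := congrArg (fun w => w ⬝ᵥ R.x (C * Cᴴ)) h1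
      simp only [smul_dotProduct, hdot, hCB, h2, Matrix.det_one, norm_one, norm_zero, smul_eq_mul,
        one_pow, mul_one, ne_eq, OfNat.ofNat_ne_zero, not_false_eq_true, zero_pow, mul_zero] at h3
      exact mul_ne_zero hu hc.ne' h3
  refine ⟨a, ?_⟩
  apply Matrix.mulVec_injective
  funext v
  have := congrArg (fun f => f v) ha
  simpa [Matrix.smul_mulVec] using this

lemma toPGL_injective (hk1 : 1 ≤ k) : Function.Injective R.toPGL := by
  rw [injective_iff_map_eq_one]
  intro g hg
  obtain ⟨B, rfl⟩ := Matrix.ProjGenLinGroup.mk_surjective g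
  rw [toPGL_mk, ← Matrix.ProjGenLinGroup.mk_one] at hg
  obtain ⟨u, hu, h⟩ := exists_smul_of_mk_eq hg.symm
  rw [coe_toGL, Units.val_one] at h
  obtain ⟨a, ha⟩ := R.exists_eq_smul_one_of_τ_eq_smul hk1 hu h
  rw [Matrix.ProjGenLinGroup.mk_eq_one, Subgroup.mem_center_iff]
  intro C
  apply Units.ext
  rw [Units.val_mul, Units.val_mul, ha]
  simp

end PluckerRep

end TransverseGroups

namespace TransverseGroups

open Matrix

/-! ### The topology of real projective space -/

section RealProj

variable {n : ℕ}

lemma continuous_mk_realProj :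
    Continuous fun v : {v : Fin n → ℝ // v ≠ 0} => (Projectivization.mk ℝ v.1 v.2 : RealProj n) :=
  continuous_coinduced_rng

lemma tendsto_mk_realProj {ι : Type*} {l : Filter ι} {v : ι → Fin n → ℝ} {w : Fin n → ℝ}
    (hv : ∀ i, v i ≠ 0) (hw : w ≠ 0) (h : Tendsto v l (𝓝 w)) :
    Tendsto (fun i => (Projectivization.mk ℝ (v i) (hv i) : RealProj n)) l
      (𝓝 (Projectivization.mk ℝ w hw)) :=
  (continuous_mk_realProj.tendsto ⟨w, hw⟩).comp
    (f := fun i => (⟨v i, hv i⟩ : {v : Fin n → ℝ // v ≠ 0})) (tendsto_subtype_rng.2 h)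

lemma dotProduct_self_pos {v : Fin n → ℝ} (hv : v ≠ 0) : 0 < v ⬝ᵥ v :=
  lt_of_le_of_ne (by rw [← norm_toLp_sq_real]; positivity)
    fun h => hv (dotProduct_self_eq_zero.1 h.symm)

/-- The orthogonal projection onto a line. -/
def lineProj (v : Fin n → ℝ) : Matrix (Fin n) (Fin n) ℝ := (v ⬝ᵥ v)⁻¹ • Matrix.vecMulVec v v

lemma lineProj_smul {a : ℝ} (ha : a ≠ 0) (v : Fin n → ℝ) : lineProj (a • v) = lineProj v := by
  ext i j
  simp only [lineProj, Matrix.smul_apply, Matrix.vecMulVec_apply, Pi.smul_apply, smul_eq_mul,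
    smul_dotProduct, dotProduct_smul, mul_inv]
  field_simp

lemma lineProj_mulVec_self {v : Fin n → ℝ} (hv : v ≠ 0) : lineProj v *ᵥ v = v := by
  rw [lineProj, Matrix.smul_mulVec, vecMulVec_mulVec_eq_smul, smul_smul,
    inv_mul_cancel₀ (dotProduct_self_pos hv).ne', one_smul]

instance instT2SpaceRealProj : T2Space (RealProj n) := by
  have hcompat : ∀ (a b : {v : Fin n → ℝ // v ≠ 0}) (t : ℝ), (a : Fin n → ℝ) = t • (b : Fin n → ℝ) →
      lineProj a.1 = lineProj b.1 := by
    intro a b t h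
    rw [h, lineProj_smul]
    rintro rfl
    exact a.2 (by rw [h, zero_smul])
  set f : RealProj n → Matrix (Fin n) (Fin n) ℝ :=
    Projectivization.lift (fun v : {v : Fin n → ℝ // v ≠ 0} => lineProj v.1) hcompat with hf
  have hcont : Continuous f := by
    rw [continuous_coinduced_dom]
    have hc : ∀ i, Continuous fun v : {v : Fin n → ℝ // v ≠ 0} => v.1 i := fun i =>
      (continuous_apply i).comp continuous_subtype_val
    have h1 : Continuous fun v : {v : Fin n → ℝ // v ≠ 0} => lineProj v.1 := by
      refine Continuous.smul (Continuous.inv₀ ?_ fun v => (dotProduct_self_pos v.2).ne') ?_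
      · exact continuous_finsetSum _ fun i _ => (hc i).mul (hc i)
      · refine continuous_matrix fun i j => ?_
        simp only [Matrix.vecMulVec_apply]
        exact (hc i).mul (hc j)
    exact h1
  refine T2Space.of_injective_continuous (f := f) ?_ hcont
  intro p q hpq
  induction p using Projectivization.ind with | h v hv =>
  induction q using Projectivization.ind with | h w hw =>
  have h1 : lineProj v = lineProj w := hpq
  rw [Projectivization.mk_eq_mk_iff']
  have h2 := lineProj_mulVec_self hv
  rw [h1, lineProj, Matrix.smul_mulVec, vecMulVec_mulVec_eq_smul, smul_smul] at h2
  exact ⟨_, h2⟩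

/-- Together with the Hausdorff property this makes projective space regular, which supplies the
closed neighbourhoods in the proof of discreteness. -/
instance instCompactSpaceRealProj : CompactSpace (RealProj n) := by
  have h1 : IsCompact (Metric.sphere (0 : Fin n → ℝ) 1) := isCompact_sphere _ _
  have h2 : CompactSpace (Metric.sphere (0 : Fin n → ℝ) 1) := isCompact_iff_compactSpace.1 h1
  have h0 : ∀ v : Metric.sphere (0 : Fin n → ℝ) 1, (v : Fin n → ℝ) ≠ 0 := fun v h => by
    have := mem_sphere_zero_iff_norm.1 v.2
    rw [h, norm_zero] at this
    exact zero_ne_one this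
  set g : Metric.sphere (0 : Fin n → ℝ) 1 → RealProj n := fun v => Projectivization.mk ℝ v.1 (h0 v)
  have hg : Continuous g := continuous_mk_realProj.comp
    (f := fun v : Metric.sphere (0 : Fin n → ℝ) 1 => (⟨v.1, h0 v⟩ : {v : Fin n → ℝ // v ≠ 0}))
    (continuous_subtype_val.subtype_mk _)
  have hs : Function.Surjective g := by
    intro p
    induction p using Projectivization.ind with | h v hv =>
    refine ⟨⟨‖v‖⁻¹ • v, ?_⟩, ?_⟩
    · rw [mem_sphere_zero_iff_norm, norm_smul, norm_inv, norm_norm,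
        inv_mul_cancel₀ (norm_ne_zero_iff.2 hv)]
    · exact (Projectivization.mk_eq_mk_iff' ..).2 ⟨‖v‖⁻¹, rfl⟩
  exact hs.compactSpace hg

end RealProj

/-! ### Properly convex domains defined by positivity -/

section DualDomain

variable {n : ℕ}

/-- The open convex cone on which all functionals in `S` are positive. -/
def posCone (S : Set (Fin n → ℝ)) : Set (Fin n → ℝ) := {X | ∀ s ∈ S, 0 < s ⬝ᵥ X}

/-- The projectivization of `posCone S`. -/
def posDomain (S : Set (Fin n → ℝ)) : Set (RealProj n) :=
  {p | ∃ (v : Fin n → ℝ) (hv : v ≠ 0), v ∈ posCone S ∧ Projectivization.mk ℝ v hv = p}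

variable {S : Set (Fin n → ℝ)}

lemma continuous_dotProduct_left (s : Fin n → ℝ) : Continuous fun v : Fin n → ℝ => s ⬝ᵥ v :=
  continuous_finsetSum _ fun i _ => by fun_prop

lemma continuous_dotProduct_right (v : Fin n → ℝ) : Continuous fun s : Fin n → ℝ => s ⬝ᵥ v :=
  continuous_finsetSum _ fun i _ => by fun_prop

lemma posCone_smul {v : Fin n → ℝ} (hv : v ∈ posCone S) {a : ℝ} (ha : 0 < a) : a • v ∈ posCone S :=
  fun s hs => by rw [dotProduct_smul, smul_eq_mul]; exact mul_pos ha (hv s hs)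

lemma mk_mem_posDomain_iff {v : Fin n → ℝ} (hv : v ≠ 0) :
    (Projectivization.mk ℝ v hv : RealProj n) ∈ posDomain S ↔ v ∈ posCone S ∨ -v ∈ posCone S := by
  constructor
  · rintro ⟨w, hw, hwS, h⟩
    obtain ⟨a, ha⟩ := (Projectivization.mk_eq_mk_iff' ..).1 h.symm
    have ha0 : a ≠ 0 := by rintro rfl; exact hv (by rw [← ha, zero_smul])
    rcases ha0.lt_or_gt with h1 | h1
    · right
      rw [← ha, ← neg_smul]
      exact posCone_smul hwS (neg_pos.2 h1)
    · left
      rw [← ha]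
      exact posCone_smul hwS h1
  · rintro (h | h)
    · exact ⟨v, hv, h, rfl⟩
    · exact ⟨-v, neg_ne_zero.2 hv, h, (Projectivization.mk_eq_mk_iff' ..).2 ⟨-1, by simp⟩⟩

lemma isOpen_posCone (hS : IsCompact S) : IsOpen (posCone S) := by
  have hc : Continuous fun p : (Fin n → ℝ) × (Fin n → ℝ) => p.1 ⬝ᵥ p.2 :=
    continuous_finsetSum _ fun i _ => by fun_prop
  rw [isOpen_iff_mem_nhds]
  intro X hX
  have := hS.eventually_forall_of_forall_eventually (x₀ := X)
    (P := fun X s => 0 < s ⬝ᵥ X) fun s hs => by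
      have h1 : Continuous fun p : (Fin n → ℝ) × (Fin n → ℝ) => p.2 ⬝ᵥ p.1 :=
        hc.comp continuous_swap
      exact h1.continuousAt.eventually (lt_mem_nhds (hX s hs))
  exact this

lemma isOpen_posDomain (hS : IsCompact S) : IsOpen (posDomain S) := by
  rw [isOpen_coinduced]
  have : (fun v : {v : Fin n → ℝ // v ≠ 0} => (Projectivization.mk ℝ v.1 v.2 : RealProj n)) ⁻¹'
      posDomain S = (fun v : {v : Fin n → ℝ // v ≠ 0} => v.1) ⁻¹' posCone S ∪
        (fun v : {v : Fin n → ℝ // v ≠ 0} => -v.1) ⁻¹' posCone S := by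
    ext v
    exact mk_mem_posDomain_iff v.2
  rw [this]
  exact ((isOpen_posCone hS).preimage continuous_subtype_val).union
    ((isOpen_posCone hS).preimage continuous_subtype_val.neg)

/-- A compact set of functionals that contains, up to scaling, a neighbourhood of a functional and
is positive on some vector defines a properly convex domain. -/
lemma isProperlyConvexDomain_posDomain (hS : IsCompact S) {X₀ : Fin n → ℝ} (hX₀ : X₀ ∈ posCone S)
    (hX₀0 : X₀ ≠ 0) {t : Fin n → ℝ} {ε : ℝ} (hε : 0 < ε)
    (hbox : ∀ b : Fin n → ℝ, (∀ i, |b i - t i| ≤ ε) → ∃ c : ℝ, 0 < c ∧ c • b ∈ S) :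
    IsProperlyConvexDomain (posDomain S) := by
  have hpos : ∀ b : Fin n → ℝ, (∀ i, |b i - t i| ≤ ε) → ∀ v ∈ posCone S, 0 < b ⬝ᵥ v := by
    intro b hb v hv
    obtain ⟨c, hc, h⟩ := hbox b hb
    have := hv _ h
    rw [smul_dotProduct, smul_eq_mul] at this
    exact pos_of_mul_pos_right this hc.le
  have ht : ∀ v ∈ posCone S, 0 < t ⬝ᵥ v := hpos t fun i => by rw [sub_self, abs_zero]; exact hε.le
  -- The centre of the box defines the chart; it is positive on the cone, so the chart contains the
  -- domain.
  set f : Module.Dual ℝ (Fin n → ℝ) := dotProductBilin ℝ ℝ t with hf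
  have hft : ∀ v, f v = t ⬝ᵥ v := fun v => rfl
  have hchart : chartImage f (posDomain S) = {v | t ⬝ᵥ v = 1 ∧ v ∈ posCone S} := by
    ext v
    constructor
    · rintro ⟨h1, hv, h2⟩
      refine ⟨h1, ((mk_mem_posDomain_iff hv).1 h2).resolve_right fun h3 => ?_⟩
      have := ht _ h3
      rw [dotProduct_neg, ← hft, h1] at this
      linarith
    · rintro ⟨h1, h2⟩
      have hv : v ≠ 0 := by rintro rfl; rw [dotProduct_zero] at h1; exact zero_ne_one h1
      exact ⟨h1, hv, (mk_mem_posDomain_iff hv).2 (Or.inl h2)⟩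
  refine ⟨isOpen_posDomain hS, ⟨_, (mk_mem_posDomain_iff hX₀0).2 (Or.inl hX₀)⟩, f, ?_, ?_, ?_⟩
  · intro v hv h
    rw [hft]
    rcases (mk_mem_posDomain_iff hv).1 h with h | h
    · exact (ht v h).ne'
    · have := ht _ h
      rw [dotProduct_neg] at this
      linarith
  · rw [hchart]
    rintro v ⟨hv1, hv2⟩ w ⟨hw1, hw2⟩ a b ha hb hab
    refine ⟨?_, fun s hs => ?_⟩
    · rw [dotProduct_add, dotProduct_smul, dotProduct_smul, hv1, hw1, smul_eq_mul, smul_eq_mul,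
        mul_one, mul_one, hab]
    · rw [dotProduct_add, dotProduct_smul, dotProduct_smul, smul_eq_mul, smul_eq_mul]
      have h1 := hv2 s hs
      have h2 := hw2 s hs
      rcases ha.eq_or_lt with rfl | ha
      · rw [zero_add] at hab
        rw [hab]; linarith
      · have := mul_pos ha h1
        have := mul_nonneg hb h2.le
        linarith
  · rw [hchart]
    refine (Metric.isBounded_closedBall (x := (0 : Fin n → ℝ)) (r := ε⁻¹)).subset ?_
    rintro v ⟨hv1, hv2⟩
    rw [mem_closedBall_zero_iff, pi_norm_le_iff_of_nonneg (by positivity)]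
    intro i
    -- Moving the centre by `±ε` in one coordinate stays in the box. With `t ⬝ᵥ v = 1` this yields
    -- `|v i| ≤ 1 / ε`.
    have key : ∀ e : ℝ, |e| = ε → 0 < 1 + e * v i := by
      intro e he
      have := hpos (t + Pi.single i e) (fun j => by
        rw [Pi.add_apply, add_sub_cancel_left, Pi.single_apply]
        split_ifs
        · exact he.le
        · rw [abs_zero]; exact hε.le) v hv2
      rwa [add_dotProduct, hv1, single_dotProduct] at this
    have h1 := key ε (abs_of_pos hε)
    have h2 := key (-ε) (by rw [abs_neg, abs_of_pos hε])
    rw [Real.norm_eq_abs, abs_le]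
    constructor
    · rw [neg_le, inv_eq_one_div, le_div_iff₀ hε]; linarith
    · rw [inv_eq_one_div, le_div_iff₀ hε]; linarith

/-- A product of two pairings is unchanged, up to a positive factor, by rescaling the representative
with either sign. So it expresses on lines, as a closed condition, that all functionals in `S` have
the same weak sign. -/
lemma closure_posDomain_subset : closure (posDomain S) ⊆
    {p | ∀ (v : Fin n → ℝ) (hv : v ≠ 0), Projectivization.mk ℝ v hv = p →
      ∀ s ∈ S, ∀ s' ∈ S, 0 ≤ (s ⬝ᵥ v) * (s' ⬝ᵥ v)} := by
  have hmk : ∀ (v w : Fin n → ℝ) (hv : v ≠ 0) (hw : w ≠ 0),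
      (Projectivization.mk ℝ v hv : RealProj n) = Projectivization.mk ℝ w hw →
      (∀ s ∈ S, ∀ s' ∈ S, 0 ≤ (s ⬝ᵥ w) * (s' ⬝ᵥ w)) →
      ∀ s ∈ S, ∀ s' ∈ S, 0 ≤ (s ⬝ᵥ v) * (s' ⬝ᵥ v) := by
    intro v w hv hw h h1 s hs s' hs'
    obtain ⟨a, rfl⟩ := (Projectivization.mk_eq_mk_iff' ..).1 h
    have := mul_nonneg (sq_nonneg a) (h1 s hs s' hs')
    rw [dotProduct_smul, dotProduct_smul, smul_eq_mul, smul_eq_mul]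
    linarith
  refine closure_minimal ?_ ?_
  · rintro p ⟨w, hw, hwS, rfl⟩ v hv h
    exact hmk v w hv hw h fun s hs s' hs' => (mul_pos (hwS s hs) (hwS s' hs')).le
  · rw [isClosed_coinduced]
    have : (fun v : {v : Fin n → ℝ // v ≠ 0} => (Projectivization.mk ℝ v.1 v.2 : RealProj n)) ⁻¹'
        {p | ∀ (v : Fin n → ℝ) (hv : v ≠ 0), Projectivization.mk ℝ v hv = p →
          ∀ s ∈ S, ∀ s' ∈ S, 0 ≤ (s ⬝ᵥ v) * (s' ⬝ᵥ v)}
        = (fun v : {v : Fin n → ℝ // v ≠ 0} => v.1) ⁻¹'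
          {w | ∀ s ∈ S, ∀ s' ∈ S, 0 ≤ (s ⬝ᵥ w) * (s' ⬝ᵥ w)} := by
      ext v
      exact ⟨fun h => h v.1 v.2 rfl, fun h w hw hwv => hmk w v.1 hw v.2 hwv h⟩
    rw [this]
    refine IsClosed.preimage continuous_subtype_val ?_
    simp only [Set.ofPred_forall]
    refine isClosed_iInter fun s => isClosed_iInter fun _ => isClosed_iInter fun s' =>
      isClosed_iInter fun _ => isClosed_le continuous_const ?_
    exact (continuous_dotProduct_left s).mul (continuous_dotProduct_left s')

/-- A vector in the closed dual cone can be moved into the open cone in every direction that is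
positive on the functionals vanishing at the vector. -/
lemma exists_add_smul_mem_posCone (hS : IsCompact S) {x w : Fin n → ℝ} (hx : ∀ s ∈ S, 0 ≤ s ⬝ᵥ x)
    (hw : ∀ s ∈ S, s ⬝ᵥ x = 0 → 0 < s ⬝ᵥ w) :
    ∃ δ : ℝ, 0 < δ ∧ ∀ a : ℝ, 0 < a → a ≤ δ → x + a • w ∈ posCone S := by
  obtain ⟨M, hM⟩ := hS.exists_bound_of_continuousOn (continuous_dotProduct_right w).continuousOn
  have hS' : IsCompact (S ∩ {s | s ⬝ᵥ w ≤ 0}) :=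
    hS.inter_right (isClosed_le (continuous_dotProduct_right w) continuous_const)
  -- Only the functionals with `s ⬝ᵥ w ≤ 0` can lose positivity. They form a compact set on which `s
  -- ⬝ᵥ x` does not vanish, so it is bounded below by some `m > 0`.
  obtain ⟨m, hm, hm2⟩ : ∃ m : ℝ, 0 < m ∧ ∀ s ∈ S ∩ {s | s ⬝ᵥ w ≤ 0}, m ≤ s ⬝ᵥ x := by
    rcases (S ∩ {s | s ⬝ᵥ w ≤ 0}).eq_empty_or_nonempty with h | h
    · exact ⟨1, one_pos, fun s hs => by rw [h] at hs; exact hs.elim⟩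
    · obtain ⟨s₀, hs₀, hmin⟩ := hS'.exists_isMinOn h (continuous_dotProduct_right x).continuousOn
      refine ⟨s₀ ⬝ᵥ x, lt_of_le_of_ne (hx _ hs₀.1) fun h0 => ?_, fun s hs => hmin hs⟩
      exact absurd hs₀.2 (not_le.2 (hw _ hs₀.1 h0.symm))
  refine ⟨m / (|M| + 1), by positivity, fun a ha haδ s hs => ?_⟩
  rw [dotProduct_add, dotProduct_smul, smul_eq_mul]
  rcases le_or_gt (s ⬝ᵥ w) 0 with h | h
  · have h1 := hm2 s ⟨hs, h⟩
    have h2 := hM s hs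
    rw [Real.norm_eq_abs] at h2
    have h3 : a * (|M| + 1) ≤ m := (le_div_iff₀ (by positivity)).1 haδ
    have h4 : - |M| ≤ s ⬝ᵥ w := (neg_le_neg (h2.trans (le_abs_self M))).trans (neg_abs_le _)
    nlinarith
  · have := hx s hs
    have := mul_pos ha h
    linarith

/-- Boundary points of `posDomain S` at which, up to scaling, a single functional of `S` vanishes. -/
structure IsStrictBoundary (S : Set (Fin n → ℝ)) (x f : Fin n → ℝ) : Prop where
  ne_zero : x ≠ 0
  nonneg : ∀ s ∈ S, 0 ≤ s ⬝ᵥ x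
  mem : f ∈ S
  eq_zero : f ⬝ᵥ x = 0
  unique : ∀ s ∈ S, s ⬝ᵥ x = 0 → ∃ c : ℝ, 0 < c ∧ s = c • f

lemma IsStrictBoundary.not_mem {x f : Fin n → ℝ} (h : IsStrictBoundary S x f) :
    (Projectivization.mk ℝ x h.ne_zero : RealProj n) ∉ posDomain S := by
  rw [mk_mem_posDomain_iff]
  rintro (h1 | h1)
  · exact (h1 f h.mem).ne' h.eq_zero
  · exact (h1 f h.mem).ne' (by rw [dotProduct_neg, h.eq_zero, neg_zero])

lemma IsStrictBoundary.mem_frontier (hS : IsCompact S) {X₀ : Fin n → ℝ} (hX₀ : X₀ ∈ posCone S)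
    {x f : Fin n → ℝ} (h : IsStrictBoundary S x f) :
    (Projectivization.mk ℝ x h.ne_zero : RealProj n) ∈ frontier (posDomain S) := by
  rw [(isOpen_posDomain hS).frontier_eq]
  refine ⟨?_, h.not_mem⟩
  have hmem : ∀ m : ℕ, x + ((m : ℝ) + 1)⁻¹ • X₀ ∈ posCone S := fun m s hs => by
    rw [dotProduct_add, dotProduct_smul, smul_eq_mul]
    have := h.nonneg s hs
    have := mul_pos (a := ((m : ℝ) + 1)⁻¹) (by positivity) (hX₀ s hs)
    linarith
  have hne : ∀ m : ℕ, x + ((m : ℝ) + 1)⁻¹ • X₀ ≠ 0 := fun m h0 => by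
    have := hmem m f h.mem
    rw [h0, dotProduct_zero] at this
    exact lt_irrefl _ this
  have ht : Tendsto (fun m : ℕ => x + ((m : ℝ) + 1)⁻¹ • X₀) atTop (𝓝 x) := by
    have h1 : Tendsto (fun m : ℕ => ((m : ℝ) + 1)⁻¹) atTop (𝓝 0) := by
      simpa only [one_div] using tendsto_one_div_add_atTop_nhds_zero_nat (𝕜 := ℝ)
    have := (tendsto_const_nhds (x := x)).add (h1.smul_const X₀)
    simpa using this
  exact mem_closure_of_tendsto (tendsto_mk_realProj hne h.ne_zero ht)
    (Eventually.of_forall fun m => ⟨_, hne m, hmem m, rfl⟩)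

/-- A supporting hyperplane at `x` must be the kernel of `f`. If it contained a `w` with `f ⬝ᵥ w ≠
0`, a small step from `x` along `w` or `-w` would enter the open cone, because every functional of
`S` vanishing at `x` is a positive multiple of `f`. -/
lemma IsStrictBoundary.isC1Point (hS : IsCompact S) {X₀ : Fin n → ℝ} (hX₀ : X₀ ∈ posCone S)
    {x f : Fin n → ℝ} (h : IsStrictBoundary S x f) :
    IsC1Point (posDomain S) (Projectivization.mk ℝ x h.ne_zero) := by
  refine ⟨h.mem_frontier hS hX₀, ?_⟩
  set φ : Module.Dual ℝ (Fin n → ℝ) := dotProductBilin ℝ ℝ f with hφ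
  have hφv : ∀ v, φ v = f ⬝ᵥ v := fun v => rfl
  have hf0 : φ ≠ 0 := fun h0 => by
    have h1 := hX₀ f h.mem
    rw [← hφv, h0] at h1
    exact lt_irrefl _ h1
  have hfr : Module.finrank ℝ (LinearMap.ker φ) + 1 = n := by
    rw [Module.Dual.finrank_ker_add_one_of_ne_zero hf0, Module.finrank_fin_fun]
  refine ⟨LinearMap.ker φ, ⟨hfr, ?_, ?_⟩, ?_⟩
  · rw [Projectivization.submodule_mk, Submodule.span_singleton_le_iff_mem]
    exact h.eq_zero
  · rintro p ⟨v, hv, hvS, rfl⟩ hle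
    rw [Projectivization.submodule_mk, Submodule.span_singleton_le_iff_mem] at hle
    exact (hvS f h.mem).ne' hle
  · rintro H ⟨hH, hxH, hHΩ⟩
    rw [Projectivization.submodule_mk, Submodule.span_singleton_le_iff_mem] at hxH
    have hneg : ∀ w ∈ H, ¬ 0 < f ⬝ᵥ w := by
      intro w hw hfw
      obtain ⟨δ, hδ, h1⟩ := exists_add_smul_mem_posCone hS (w := w) h.nonneg (by
        intro s hs hsx
        obtain ⟨c, hc, rfl⟩ := h.unique s hs hsx
        rw [smul_dotProduct, smul_eq_mul]
        exact mul_pos hc hfw)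
      have h2 := h1 δ hδ le_rfl
      have hne : x + δ • w ≠ 0 := fun h0 => by
        have := h2 f h.mem
        rw [h0, dotProduct_zero] at this
        exact lt_irrefl _ this
      refine hHΩ _ ⟨_, hne, h2, rfl⟩ ?_
      rw [Projectivization.submodule_mk, Submodule.span_singleton_le_iff_mem]
      exact H.add_mem hxH (H.smul_mem _ hw)
    apply Submodule.eq_of_le_of_finrank_eq
    · intro w hw
      have h1 := hneg w hw
      have h2 := hneg (-w) (H.neg_mem hw)
      rw [dotProduct_neg] at h2
      change f ⬝ᵥ w = 0
      linarith
    · omega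

/-- No functional in `S` vanishes at both `x` and `y`, since one vanishing at `x` is a positive
multiple of `f`, which is positive at `y`. Positive combinations of `x` and `y` therefore lie in the
open cone. -/
lemma IsStrictBoundary.openProjSegment_subset {x f y f' : Fin n → ℝ}
    (h : IsStrictBoundary S x f) (h' : IsStrictBoundary S y f')
    (hfy : 0 < f ⬝ᵥ y) (hfx : 0 < f' ⬝ᵥ x) :
    openProjSegment (posDomain S) (Projectivization.mk ℝ x h.ne_zero)
      (Projectivization.mk ℝ y h'.ne_zero) ⊆ posDomain S := by
  rintro p ⟨⟨u, v, hu, hv, hux, hvy, hcl, w, hw, hw0, rfl⟩, hp⟩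
  obtain ⟨α, rfl⟩ := (Projectivization.mk_eq_mk_iff' ..).1 hux
  obtain ⟨β, rfl⟩ := (Projectivization.mk_eq_mk_iff' ..).1 hvy
  have hα : α ≠ 0 := by rintro rfl; exact hu (zero_smul ..)
  have hβ : β ≠ 0 := by rintro rfl; exact hv (zero_smul ..)
  obtain ⟨hw0', hwc⟩ := hcl w hw
  obtain ⟨a, b, ha, hb, hab, rfl⟩ := hw
  rw [Set.mem_insert_iff, Set.mem_singleton_iff, not_or] at hp
  have ha' : 0 < a := lt_of_le_of_ne ha fun h0 => hp.2 <| by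
    subst h0
    exact (Projectivization.mk_eq_mk_iff' ..).2 ⟨b * β, by rw [zero_smul, zero_add, smul_smul]⟩
  have hb' : 0 < b := lt_of_le_of_ne hb fun h0 => hp.1 <| by
    subst h0
    exact (Projectivization.mk_eq_mk_iff' ..).2 ⟨a * α, by rw [zero_smul, add_zero, smul_smul]⟩
  have hdot : ∀ s : Fin n → ℝ, s ⬝ᵥ (a • α • x + b • β • y)
      = a * (α * (s ⬝ᵥ x)) + b * (β * (s ⬝ᵥ y)) := fun s => by
    simp only [dotProduct_add, dotProduct_smul, smul_eq_mul]
  -- A projective line has two arcs between `x` and `y`. Comparing the signs of `f` and `f'` at an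
  -- interior point of the given segment shows that the lifts `α x`, `β y` have `α β > 0`, so it is
  -- the arc of positive combinations.
  have h1 := closure_posDomain_subset hwc _ hw0' rfl f h.mem f' h'.mem
  rw [hdot, hdot, h.eq_zero, h'.eq_zero, mul_zero, mul_zero, mul_zero, mul_zero, zero_add,
    add_zero] at h1
  have hαβ : 0 < α * β := by
    have h2 : 0 ≤ (α * β) * (a * b * (f ⬝ᵥ y) * (f' ⬝ᵥ x)) := by linarith
    have h3 : 0 < a * b * (f ⬝ᵥ y) * (f' ⬝ᵥ x) := by positivity
    exact lt_of_le_of_ne (nonneg_of_mul_nonneg_left h2 h3) (mul_ne_zero hα hβ).symm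
  have key : ∀ s ∈ S, 0 < s ⬝ᵥ x ∨ 0 < s ⬝ᵥ y := by
    intro s hs
    rcases (h.nonneg s hs).eq_or_lt with h2 | h2
    · right
      obtain ⟨c, hc, rfl⟩ := h.unique s hs h2.symm
      rw [smul_dotProduct, smul_eq_mul]
      exact mul_pos hc hfy
    · exact Or.inl h2
  have hpos : ∀ c e : ℝ, 0 < c → 0 < e → ∀ s ∈ S, 0 < c * (s ⬝ᵥ x) + e * (s ⬝ᵥ y) := by
    intro c e hc he s hs
    rcases key s hs with h2 | h2
    · have := mul_pos hc h2
      have := mul_nonneg he.le (h'.nonneg s hs)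
      linarith
    · have := mul_nonneg hc.le (h.nonneg s hs)
      have := mul_pos he h2
      linarith
  rw [mk_mem_posDomain_iff]
  rcases hα.lt_or_gt with h2 | h2
  · right
    have h3 : β < 0 := by nlinarith
    intro s hs
    rw [dotProduct_neg, hdot]
    have := hpos (a * -α) (b * -β) (mul_pos ha' (neg_pos.2 h2)) (mul_pos hb' (neg_pos.2 h3)) s hs
    linarith
  · left
    have h3 : 0 < β := pos_of_mul_pos_right hαβ h2.le
    intro s hs
    rw [hdot]
    have := hpos (a * α) (b * β) (mul_pos ha' h2) (mul_pos hb' h3) s hs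
    linarith

lemma openProjSegment_self (Ω : Set (RealProj n)) (x : RealProj n) : openProjSegment Ω x x = ∅ := by
  rw [Set.eq_empty_iff_forall_notMem]
  rintro p ⟨⟨u, v, hu, hv, hux, hvx, -, w, ⟨a, b, -, -, -, rfl⟩, hw0, rfl⟩, hp⟩
  refine hp (Or.inl ?_)
  obtain ⟨α, rfl⟩ := (Projectivization.mk_eq_mk_iff' ..).1 (hvx.trans hux.symm)
  rw [← hux]
  exact (Projectivization.mk_eq_mk_iff' ..).2 ⟨a + b * α, by rw [add_smul, smul_smul]⟩

end DualDomain

end TransverseGroups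

namespace TransverseGroups

open Matrix

variable {K : Type*} [RCLike K] {d : ℕ} {θ : Finset ℕ}

lemma mulVec_dotProduct {n : ℕ} (M : Matrix (Fin n) (Fin n) ℝ) (s v : Fin n → ℝ) :
    (Mᵀ *ᵥ s) ⬝ᵥ v = s ⬝ᵥ (M *ᵥ v) := by
  rw [Matrix.mulVec_transpose, Matrix.dotProduct_mulVec]

lemma tendsto_transpose {n : ℕ} {M : ℕ → Matrix (Fin n) (Fin n) ℝ} {M' : Matrix (Fin n) (Fin n) ℝ}
    (h : Tendsto M atTop (𝓝 M')) : Tendsto (fun p => (M p)ᵀ) atTop (𝓝 M'ᵀ) :=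
  tendsto_matrix_iff.2 fun i j => tendsto_matrix_iff.1 h j i

/-! ### The dual cone: limits of the translates of the box. -/

namespace PluckerRep

variable {k : ℕ} {hkd : k < d} (R : PluckerRep K d k hkd)

lemma τ_inv_mul (g : Matrix.GeneralLinearGroup (Fin d) K) :
    R.τ ((g⁻¹ : Matrix.GeneralLinearGroup (Fin d) K) : Matrix (Fin d) (Fin d) K) * R.τ g = 1 := by
  rw [← map_mul, ← Units.val_mul, inv_mul_cancel, Units.val_one, map_one]

lemma τ_mul_inv (g : Matrix.GeneralLinearGroup (Fin d) K) :
    R.τ g * R.τ ((g⁻¹ : Matrix.GeneralLinearGroup (Fin d) K) : Matrix (Fin d) (Fin d) K) = 1 := by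
  rw [← map_mul, ← Units.val_mul, mul_inv_cancel, Units.val_one, map_one]

lemma τ_mulVec_ne_zero (g : Matrix.GeneralLinearGroup (Fin d) K) {v : Fin R.n → ℝ} (hv : v ≠ 0) :
    R.τ g *ᵥ v ≠ 0 := fun h => hv <| by
  have := congrArg (fun w => R.τ ((g⁻¹ : Matrix.GeneralLinearGroup (Fin d) K) :
    Matrix (Fin d) (Fin d) K) *ᵥ w) h
  simpa only [Matrix.mulVec_mulVec, τ_inv_mul, Matrix.one_mulVec, Matrix.mulVec_zero] using this

lemma τ_transpose_mulVec_ne_zero (g : Matrix.GeneralLinearGroup (Fin d) K) {v : Fin R.n → ℝ}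
    (hv : v ≠ 0) : (R.τ g)ᵀ *ᵥ v ≠ 0 := fun h => hv <| by
  have := congrArg (fun w => (R.τ ((g⁻¹ : Matrix.GeneralLinearGroup (Fin d) K) :
    Matrix (Fin d) (Fin d) K))ᵀ *ᵥ w) h
  simpa only [Matrix.mulVec_mulVec, ← Matrix.transpose_mul, τ_mul_inv, Matrix.transpose_one,
    Matrix.one_mulVec, Matrix.mulVec_zero] using this

lemma exists_τ_eq_smul {g h : Matrix.GeneralLinearGroup (Fin d) K}
    (hgh : Matrix.ProjGenLinGroup.mk g = Matrix.ProjGenLinGroup.mk h) :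
    ∃ c : ℝ, 0 < c ∧ R.τ h = c • R.τ g := by
  obtain ⟨u, hu, h1⟩ := exists_smul_of_mk_eq hgh
  exact ⟨‖u‖ ^ (2 * k), pow_pos (norm_pos_iff.2 hu) _, by rw [h1, τ_smul]⟩

/-- The normalized translates under `Γ` of the functionals near `t`. -/
def translates (Γ : Subgroup (PGL d K)) (t : Fin R.n → ℝ) (ε : ℝ) : Set (Fin R.n → ℝ) :=
  {s | ‖s‖ = 1 ∧ ∃ (g : Matrix.GeneralLinearGroup (Fin d) K) (b : Fin R.n → ℝ),
    Matrix.ProjGenLinGroup.mk g ∈ Γ ∧ (∀ i, |b i - t i| ≤ ε) ∧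
    ∃ c : ℝ, 0 < c ∧ s = c • ((R.τ g)ᵀ *ᵥ b)}

lemma isCompact_closure_translates (Γ : Subgroup (PGL d K)) (t : Fin R.n → ℝ) (ε : ℝ) :
    IsCompact (closure (R.translates Γ t ε)) := by
  refine (isCompact_sphere (0 : Fin R.n → ℝ) 1).closure_of_subset ?_
  intro s hs
  exact mem_sphere_zero_iff_norm.2 hs.1

lemma norm_eq_one_of_mem_closure {Γ : Subgroup (PGL d K)} {t : Fin R.n → ℝ} {ε : ℝ}
    {s : Fin R.n → ℝ} (hs : s ∈ closure (R.translates Γ t ε)) : ‖s‖ = 1 :=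
  closure_minimal (t := {s : Fin R.n → ℝ | ‖s‖ = 1}) (fun _ h => h.1)
    (isClosed_eq continuous_norm continuous_const) hs

/-- The functionals near `t` are positive on all highest weight vectors. -/
def IsPositiveBox (t : Fin R.n → ℝ) (ε : ℝ) : Prop :=
  0 < ε ∧ ∀ b : Fin R.n → ℝ, (∀ i, |b i - t i| ≤ ε) →
    ∀ B : Matrix (Fin d) (Fin k) K, R.x (B * Bᴴ) ≠ 0 → 0 < b ⬝ᵥ R.x (B * Bᴴ)

variable {R} {t : Fin R.n → ℝ} {ε : ℝ}

lemma IsPositiveBox.ne_zero (hbox : R.IsPositiveBox t ε) {b : Fin R.n → ℝ}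
    (hb : ∀ i, |b i - t i| ≤ ε) : b ≠ 0 := by
  rintro rfl
  have := hbox.2 0 hb (topMat K hkd.le)
    (R.x_ne_zero_of_orthonormal (topMat_conjTranspose_mul_self hkd.le))
  rw [zero_dotProduct] at this
  exact lt_irrefl _ this

lemma IsPositiveBox.self_mem (hbox : R.IsPositiveBox t ε) (i : Fin R.n) : |t i - t i| ≤ ε := by
  rw [sub_self, abs_zero]; exact hbox.1.le

lemma IsPositiveBox.dotProduct_vec_pos (hbox : R.IsPositiveBox t ε) {b : Fin R.n → ℝ}
    (hb : ∀ i, |b i - t i| ≤ ε) (hk : k ∈ θ) (F : PartialFlag K d θ) : 0 < b ⬝ᵥ R.vec hk F := by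
  obtain ⟨B, hB, -, h⟩ := R.exists_vec_eq hk F
  rw [h]
  exact hbox.2 b hb B (R.x_ne_zero_of_orthonormal hB)

lemma IsPositiveBox.normalize_mem (hbox : R.IsPositiveBox t ε) {Γ : Subgroup (PGL d K)}
    {g : Matrix.GeneralLinearGroup (Fin d) K} (hg : Matrix.ProjGenLinGroup.mk g ∈ Γ)
    {b : Fin R.n → ℝ} (hb : ∀ i, |b i - t i| ≤ ε) {c : ℝ} (hc : 0 < c) :
    ‖c • ((R.τ g)ᵀ *ᵥ b)‖⁻¹ • (c • ((R.τ g)ᵀ *ᵥ b)) ∈ R.translates Γ t ε := by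
  have h : c • ((R.τ g)ᵀ *ᵥ b) ≠ 0 :=
    smul_ne_zero hc.ne' (R.τ_transpose_mulVec_ne_zero g (hbox.ne_zero hb))
  have h1 := norm_pos_iff.2 h
  refine ⟨by rw [norm_smul, norm_inv, norm_norm, inv_mul_cancel₀ h1.ne'], g, b, hg, hb,
    ‖c • ((R.τ g)ᵀ *ᵥ b)‖⁻¹ * c, by positivity, by rw [smul_smul]⟩

lemma IsPositiveBox.exists_smul_mem (hbox : R.IsPositiveBox t ε) (Γ : Subgroup (PGL d K))
    (b : Fin R.n → ℝ) (hb : ∀ i, |b i - t i| ≤ ε) :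
    ∃ c : ℝ, 0 < c ∧ c • b ∈ closure (R.translates Γ t ε) := by
  have h := hbox.normalize_mem (Γ := Γ) (g := 1) (by rw [map_one]; exact one_mem _) hb one_pos
  rw [Units.val_one, map_one, Matrix.transpose_one, Matrix.one_mulVec, one_smul] at h
  exact ⟨_, inv_pos.2 (norm_pos_iff.2 (hbox.ne_zero hb)), subset_closure h⟩

lemma IsPositiveBox.dotProduct_nonneg (hbox : R.IsPositiveBox t ε) {Γ : Subgroup (PGL d K)}
    {s : Fin R.n → ℝ} (hs : s ∈ closure (R.translates Γ t ε)) (B : Matrix (Fin d) (Fin k) K) :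
    0 ≤ s ⬝ᵥ R.x (B * Bᴴ) := by
  refine closure_minimal (t := {s : Fin R.n → ℝ | 0 ≤ s ⬝ᵥ R.x (B * Bᴴ)}) ?_
    (isClosed_le continuous_const (continuous_dotProduct_right _)) hs
  rintro _ ⟨-, g, b, -, hb, c, hc, rfl⟩
  change 0 ≤ (c • ((R.τ g)ᵀ *ᵥ b)) ⬝ᵥ R.x (B * Bᴴ)
  rw [smul_dotProduct, mulVec_dotProduct, R.τ_x, mul_mul_conjTranspose_mul, smul_eq_mul]
  refine mul_nonneg hc.le ?_
  by_cases h : R.x ((g : Matrix (Fin d) (Fin d) K) * B * ((g : Matrix (Fin d) (Fin d) K) * B)ᴴ) = 0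
  · rw [h, dotProduct_zero]
  · exact (hbox.2 b hb _ h).le

lemma IsPositiveBox.dotProduct_vec_nonneg (hbox : R.IsPositiveBox t ε) {Γ : Subgroup (PGL d K)}
    {s : Fin R.n → ℝ} (hs : s ∈ closure (R.translates Γ t ε)) (hk : k ∈ θ) (F : PartialFlag K d θ) :
    0 ≤ s ⬝ᵥ R.vec hk F := by
  obtain ⟨B, -, -, h⟩ := R.exists_vec_eq hk F
  exact h ▸ hbox.dotProduct_nonneg hs B

/-- The positive cone of the translates is non-empty. -/
lemma IsPositiveBox.exists_mem_posCone (hbox : R.IsPositiveBox t ε) (Γ : Subgroup (PGL d K)) :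
    ∃ X₀ : Fin R.n → ℝ, X₀ ∈ posCone (closure (R.translates Γ t ε)) ∧ X₀ ≠ 0 := by
  -- The point is a sum of finitely many highest weight vectors with full span. A functional in the
  -- closure is non-negative on each; if it vanished on the sum it would vanish on all highest
  -- weight vectors and be zero, contradicting norm one.
  obtain ⟨T, hT, hspan⟩ := Submodule.fg_span_iff_fg_span_finset_subset
    (Set.range fun B : Matrix (Fin d) (Fin k) K => R.x (B * Bᴴ)) |>.1
    (IsNoetherian.noetherian (Submodule.span ℝ _))
  have hmem : ∑ v ∈ T, v ∈ posCone (closure (R.translates Γ t ε)) := by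
    intro s hs
    have hnn : ∀ v ∈ T, 0 ≤ s ⬝ᵥ v := by
      intro v hv
      obtain ⟨B, rfl⟩ := hT hv
      exact hbox.dotProduct_nonneg hs B
    rw [dotProduct_sum]
    refine lt_of_le_of_ne (Finset.sum_nonneg hnn) fun h0 => ?_
    have h1 := (Finset.sum_eq_zero_iff_of_nonneg hnn).1 h0.symm
    have h2 : Submodule.span ℝ (T : Set (Fin R.n → ℝ)) ≤
        LinearMap.ker (dotProductBilin ℝ ℝ s) := Submodule.span_le.2 fun v hv => h1 v hv
    have h3 : s = 0 := R.eq_zero_of_dotProduct s fun B =>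
      h2 (hspan ▸ Submodule.subset_span ⟨B, rfl⟩)
    have h4 := R.norm_eq_one_of_mem_closure hs
    rw [h3, norm_zero] at h4
    exact zero_ne_one h4
  refine ⟨_, hmem, fun h0 => ?_⟩
  obtain ⟨c, -, hc⟩ := hbox.exists_smul_mem Γ t hbox.self_mem
  have := hmem _ hc
  rw [h0, dotProduct_zero] at this
  exact lt_irrefl _ this

lemma tendsto_normalize {n : ℕ} {w : ℕ → Fin n → ℝ} {w' : Fin n → ℝ} (hw : Tendsto w atTop (𝓝 w'))
    (hw' : w' ≠ 0) : Tendsto (fun p => ‖w p‖⁻¹ • w p) atTop (𝓝 (‖w'‖⁻¹ • w')) :=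
  (hw.norm.inv₀ (norm_ne_zero_iff.2 hw')).smul hw

/-- The positive cone of the translates is invariant. -/
lemma IsPositiveBox.τ_mulVec_mem_posCone (hbox : R.IsPositiveBox t ε) {Γ : Subgroup (PGL d K)}
    {g : Matrix.GeneralLinearGroup (Fin d) K} (hg : Matrix.ProjGenLinGroup.mk g ∈ Γ)
    {X : Fin R.n → ℝ} (hX : X ∈ posCone (closure (R.translates Γ t ε))) :
    R.τ g *ᵥ X ∈ posCone (closure (R.translates Γ t ε)) := by
  intro s hs
  have hs0 : s ≠ 0 := by
    have := R.norm_eq_one_of_mem_closure hs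
    rintro rfl
    rw [norm_zero] at this
    exact zero_ne_one this
  have hne := R.τ_transpose_mulVec_ne_zero g hs0
  have key : ‖(R.τ g)ᵀ *ᵥ s‖⁻¹ • ((R.τ g)ᵀ *ᵥ s) ∈ closure (R.translates Γ t ε) := by
    -- The transposes act on the right: `τ(g)ᵀ τ(h)ᵀ = τ(h g)ᵀ`. So they permute the translates up
    -- to normalization, and the closure inherits this.
    obtain ⟨u, hu, hus⟩ := mem_closure_iff_seq_limit.1 hs
    refine mem_closure_of_tendsto (tendsto_normalize (tendsto_mulVec tendsto_const_nhds hus) hne)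
      (Eventually.of_forall fun n => ?_)
    obtain ⟨-, h, b, hh, hb, c, hc, hun⟩ := hu n
    rw [hun, Matrix.mulVec_smul, Matrix.mulVec_mulVec, ← Matrix.transpose_mul, ← map_mul,
      ← Units.val_mul]
    exact hbox.normalize_mem (by rw [map_mul]; exact mul_mem hh hg) hb hc
  have h1 := hX _ key
  rw [smul_dotProduct, mulVec_dotProduct, smul_eq_mul] at h1
  exact pos_of_mul_pos_right h1 (by positivity)

section Divergent

variable {Γ : Subgroup (PGL d K)} (hk' : d - k ∈ θ)

/-- Take a sequence in `Γ` with `F` as repelling flag and `G` as attracting flag. The rescaled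
transposes send `t` to vectors converging to `(t ⬝ᵥ vec G) • dual F`, and the coefficient is
positive because `t` is in the box. -/
lemma IsPositiveBox.dual_mem (hθ : ∀ j ∈ θ, 1 ≤ j ∧ j < d) (hsymm : ∀ j ∈ θ, d - j ∈ θ)
    (hdiv : ∀ j ∈ θ, IsDivergent j Γ) (hk : k ∈ θ) (hbox : R.IsPositiveBox t ε)
    {F : PartialFlag K d θ} (hF : F ∈ flagLimitSet θ Γ) :
    ‖R.dual hk' F‖⁻¹ • R.dual hk' F ∈ closure (R.translates Γ t ε) := by
  obtain ⟨γ, G, hγ, -, -, -, hc⟩ := exists_isContracting hθ hsymm hdiv hF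
  obtain ⟨B, hB, h1⟩ := hc.exists_rep
  obtain ⟨r, hr, h2⟩ := h1 k hkd R hk hk'
  have h3 := tendsto_mulVec (tendsto_transpose h2) (tendsto_const_nhds (x := t))
  have hpos := hbox.dotProduct_vec_pos hbox.self_mem hk G
  have h4 : (Matrix.vecMulVec (R.vec hk G) (R.dual hk' F))ᵀ *ᵥ t
      = (t ⬝ᵥ R.vec hk G) • R.dual hk' F := by
    rw [Matrix.transpose_vecMulVec, vecMulVec_mulVec_eq_smul, dotProduct_comm]
  rw [h4] at h3
  have h5 := tendsto_normalize h3 (smul_ne_zero hpos.ne' (R.dual_ne_zero hk' F))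
  have h6 : ‖(t ⬝ᵥ R.vec hk G) • R.dual hk' F‖⁻¹ • ((t ⬝ᵥ R.vec hk G) • R.dual hk' F)
      = ‖R.dual hk' F‖⁻¹ • R.dual hk' F := by
    rw [norm_smul, smul_smul, Real.norm_eq_abs, abs_of_pos hpos, mul_inv, mul_right_comm,
      inv_mul_cancel₀ hpos.ne', one_mul]
  rw [h6] at h5
  refine mem_closure_of_tendsto h5 (Eventually.of_forall fun n => ?_)
  rw [Matrix.transpose_smul, Matrix.smul_mulVec]
  exact hbox.normalize_mem (by rw [hB]; exact inv_mem (hγ n)) hbox.self_mem (hr n)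

lemma exists_subseq_box (hbox : R.IsPositiveBox t ε) {b : ℕ → Fin R.n → ℝ}
    (hb : ∀ n i, |b n i - t i| ≤ ε) : ∃ b' : Fin R.n → ℝ, (∀ i, |b' i - t i| ≤ ε) ∧
      ∃ φ : ℕ → ℕ, StrictMono φ ∧ Tendsto (b ∘ φ) atTop (𝓝 b') := by
  have hiff : ∀ c : Fin R.n → ℝ, c ∈ Metric.closedBall t ε ↔ ∀ i, |c i - t i| ≤ ε := fun c => by
    rw [Metric.mem_closedBall, dist_pi_le_iff hbox.1.le]
    rfl
  obtain ⟨b', hb', φ, hφ, h⟩ := (isCompact_closedBall t ε).tendsto_subseq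
    (fun n => (hiff (b n)).2 (hb n))
  exact ⟨b', (hiff b').1 hb', φ, hφ, h⟩

/-- The limits of translates are translates, or functionals defined by limit flags. -/
lemma IsPositiveBox.mem_closure_translates (hθ : ∀ j ∈ θ, 1 ≤ j ∧ j < d)
    (hsymm : ∀ j ∈ θ, d - j ∈ θ) (hdiv : ∀ j ∈ θ, IsDivergent j Γ) (hk : k ∈ θ)
    (hbox : R.IsPositiveBox t ε) {s : Fin R.n → ℝ} (hs : s ∈ closure (R.translates Γ t ε)) :
    (∃ (g : Matrix.GeneralLinearGroup (Fin d) K) (b : Fin R.n → ℝ), (∀ i, |b i - t i| ≤ ε) ∧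
      ∃ c : ℝ, 0 < c ∧ s = c • ((R.τ g)ᵀ *ᵥ b)) ∨
    ∃ G ∈ flagLimitSet θ Γ, ∃ c : ℝ, 0 < c ∧ s = c • R.dual hk' G := by
  have hs1 := R.norm_eq_one_of_mem_closure hs
  obtain ⟨u, hu, hus⟩ := mem_closure_iff_seq_limit.1 hs
  choose hu1 g b hg hb c hc hu using hu
  obtain ⟨φ, hφ, h1⟩ := exists_subseq_const_or_injective fun n => Matrix.ProjGenLinGroup.mk (g n)
  have hus' := hus.comp hφ.tendsto_atTop
  -- If the group element is constant along a subsequence, compactness of the box makes the limit a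
  -- translate. Otherwise the elements are distinct, a subsequence contracts, and the transposed
  -- rank one limit sends every box functional to a positive multiple of `dual G`.
  rcases h1 with h1 | h1
  · left
    obtain ⟨b', hb', ψ, hψ, hbt⟩ := exists_subseq_box hbox fun n => hb (φ n)
    choose e he hτ using fun n => R.exists_τ_eq_smul (h1 n).symm
    have h2 := tendsto_mulVec (tendsto_const_nhds (x := (R.τ (g (φ 0)))ᵀ)) hbt
    have hne := R.τ_transpose_mulVec_ne_zero (g (φ 0)) (hbox.ne_zero hb')
    have h3 := eq_smul_of_tendsto_smul (c := fun n => c (φ (ψ n)) * e (ψ n))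
      (fun n => (mul_pos (hc _) (he _)).le) (fun n => ?_) (hus'.comp hψ.tendsto_atTop) h2 hne
    · refine ⟨g (φ 0), b', hb', _, ?_, h3⟩
      rw [hs1]
      exact div_pos one_pos (norm_pos_iff.2 hne)
    · simp only [Function.comp_apply]
      rw [hu, hτ, Matrix.transpose_smul, Matrix.smul_mulVec, smul_smul]
  · right
    have hθ' : ∀ j ∈ θ, j ≤ d := fun j hj => (hθ j hj).2.le
    choose U hU using fun n => exists_isCartanFlag hθ' (Matrix.ProjGenLinGroup.mk (g (φ n)))
    obtain ⟨ψ, hψ, F, -, G, hG, -, hcon, -⟩ :=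
      exists_subseq_isContracting hθ hsymm hdiv (fun n => hg (φ n)) h1 hU
    obtain ⟨b', hb', χ, hχ, hbt⟩ := exists_subseq_box hbox fun n => hb (φ (ψ n))
    obtain ⟨B, hB, h2⟩ := (hcon.comp hχ).exists_rep
    obtain ⟨r, hr, h3⟩ := h2 k hkd R hk hk'
    have h4 := tendsto_mulVec (tendsto_transpose h3) hbt
    have hpos := hbox.dotProduct_vec_pos hb' hk F
    have h5 : (Matrix.vecMulVec (R.vec hk F) (R.dual hk' G))ᵀ *ᵥ b'
        = (b' ⬝ᵥ R.vec hk F) • R.dual hk' G := by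
      rw [Matrix.transpose_vecMulVec, vecMulVec_mulVec_eq_smul, dotProduct_comm]
    rw [h5] at h4
    choose e he hτ using fun n => R.exists_τ_eq_smul (hB n)
    have hne := smul_ne_zero hpos.ne' (R.dual_ne_zero hk' G)
    have h6 := eq_smul_of_tendsto_smul (c := fun n => c (φ (ψ (χ n))) * e n / r n)
      (fun n => (div_pos (mul_pos (hc _) (he _)) (hr _)).le) (fun n => ?_)
      ((hus'.comp hψ.tendsto_atTop).comp hχ.tendsto_atTop) h4 hne
    · rw [smul_smul] at h6
      refine ⟨G, hG, _, ?_, h6⟩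
      rw [hs1]
      exact mul_pos (div_pos one_pos (norm_pos_iff.2 hne)) hpos
    · have hr0 := (hr n).ne'
      simp only [Function.comp_apply]
      rw [hu, hτ n, Matrix.transpose_smul, Matrix.smul_mulVec, smul_smul, Matrix.transpose_smul,
        Matrix.smul_mulVec, smul_smul, div_mul_cancel₀ _ hr0]

/-- Translates of the box are strictly positive at `vec F`, since group elements carry it to
positive multiples of highest weight vectors. The remaining functionals come from limit flags `G`,
and by transversality only `G = F` can vanish there. The condition `k ≤ d - k` ensures that `dual F`
does vanish. -/
lemma IsPositiveBox.isStrictBoundary (hθ : ∀ j ∈ θ, 1 ≤ j ∧ j < d)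
    (hsymm : ∀ j ∈ θ, d - j ∈ θ) (hΓ : IsTransverseSubgroup θ Γ) (hk : k ∈ θ) (hkk : k ≤ d - k)
    (hbox : R.IsPositiveBox t ε) {F : PartialFlag K d θ} (hF : F ∈ flagLimitSet θ Γ) :
    IsStrictBoundary (closure (R.translates Γ t ε)) (R.vec hk F)
      (‖R.dual hk' F‖⁻¹ • R.dual hk' F) where
  ne_zero := R.vec_ne_zero hk F
  nonneg s hs := hbox.dotProduct_vec_nonneg hs hk F
  mem := hbox.dual_mem hk' hθ hsymm hΓ.1 hk hF
  eq_zero := by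
    rw [smul_dotProduct, R.dual_dotProduct_vec_self hk hk' (hθ k hk).1 hkk, smul_zero]
  unique s hs h := by
    rcases hbox.mem_closure_translates hk' hθ hsymm hΓ.1 hk hs with
      ⟨g, b, hb, c, hc, rfl⟩ | ⟨G, hG, c, hc, rfl⟩
    · exfalso
      obtain ⟨a, ha, h1⟩ := R.τ_vec hk g F
      have h2 := hbox.dotProduct_vec_pos hb hk (Matrix.ProjGenLinGroup.mk g • F)
      rw [smul_dotProduct, mulVec_dotProduct, h1, dotProduct_smul, smul_eq_mul, smul_eq_mul] at h
      have : 0 < c * (a * (b ⬝ᵥ R.vec hk (Matrix.ProjGenLinGroup.mk g • F))) := by positivity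
      exact this.ne' h
    · have hGF : G = F := by
        by_contra hne
        have h1 := R.dual_dotProduct_vec_pos hk hk' (hΓ.2 F hF G hG fun h => hne h.symm)
        rw [smul_dotProduct, smul_eq_mul] at h
        exact (mul_pos hc h1).ne' h
      subst hGF
      have hn := norm_pos_iff.2 (R.dual_ne_zero hk' G)
      exact ⟨c * ‖R.dual hk' G‖, mul_pos hc hn, by rw [smul_smul, mul_inv_cancel_right₀ hn.ne']⟩

end Divergent

end PluckerRep

end TransverseGroups

namespace TransverseGroups

open Matrix

/-! ### Topology of the projective linear group -/

section PGLTopology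

variable {n : ℕ}

lemma continuous_smul_realProj (p : RealProj n) : Continuous fun g : PGL n ℝ => g • p := by
  rw [continuous_coinduced_dom]
  induction p using Projectivization.ind with | h v hv =>
  have hne : ∀ g : Matrix.GeneralLinearGroup (Fin n) ℝ,
      (g : Matrix (Fin n) (Fin n) ℝ) *ᵥ v ≠ 0 := fun g h => hv <| by
    have := congrArg (fun w => ((g⁻¹ : Matrix.GeneralLinearGroup (Fin n) ℝ) :
      Matrix (Fin n) (Fin n) ℝ) *ᵥ w) h
    simpa only [Matrix.mulVec_mulVec, ← Units.val_mul, inv_mul_cancel, Units.val_one,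
      Matrix.one_mulVec, Matrix.mulVec_zero] using this
  have h1 : Continuous fun g : Matrix.GeneralLinearGroup (Fin n) ℝ =>
      (g : Matrix (Fin n) (Fin n) ℝ) *ᵥ v :=
    Units.continuous_val.matrix_mulVec continuous_const
  exact continuous_mk_realProj.comp (f := fun g : Matrix.GeneralLinearGroup (Fin n) ℝ =>
    (⟨(g : Matrix (Fin n) (Fin n) ℝ) *ᵥ v, hne g⟩ : {v : Fin n → ℝ // v ≠ 0})) (h1.subtype_mk _)

/-- The preimage of a point in the general linear group is a coset of the centre, which is closed as
a centralizer. -/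
instance instT1SpacePGL : T1Space (PGL n ℝ) := by
  refine ⟨fun p => ?_⟩
  obtain ⟨g, rfl⟩ := Matrix.ProjGenLinGroup.mk_surjective p
  rw [isClosed_coinduced]
  have h1 : IsClosed (Subgroup.center (Matrix.GeneralLinearGroup (Fin n) ℝ) :
      Set (Matrix.GeneralLinearGroup (Fin n) ℝ)) := by
    have := Set.isClosed_centralizer (Set.univ : Set (Matrix.GeneralLinearGroup (Fin n) ℝ))
    rwa [Set.centralizer_univ] at this
  have h2 : (Matrix.ProjGenLinGroup.mk : Matrix.GeneralLinearGroup (Fin n) ℝ → PGL n ℝ) ⁻¹'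
      {Matrix.ProjGenLinGroup.mk g} = (fun h => g⁻¹ * h) ⁻¹'
        (Subgroup.center (Matrix.GeneralLinearGroup (Fin n) ℝ) :
          Set (Matrix.GeneralLinearGroup (Fin n) ℝ)) := by
    ext h
    rw [Set.mem_preimage, Set.mem_singleton_iff, Set.mem_preimage, SetLike.mem_coe,
      ← Matrix.ProjGenLinGroup.mk_eq_one, map_mul, map_inv, inv_mul_eq_one, eq_comm]
  rw [h2]
  exact h1.preimage (continuous_const_mul g⁻¹)

/-- A subset of a T₁ space is discrete if every point has a neighbourhood meeting it in a finite
set. -/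
lemma discreteTopology_of_finite_inter {X : Type*} [TopologicalSpace X] [T1Space X] {A : Set X}
    (h : ∀ a ∈ A, ∃ O : Set X, IsOpen O ∧ a ∈ O ∧ (O ∩ A).Finite) : DiscreteTopology A := by
  rw [discreteTopology_iff_isOpen_singleton]
  rintro ⟨a, ha⟩
  obtain ⟨O, hO, haO, hfin⟩ := h a ha
  have h1 : IsClosed ((O ∩ A) \ {a}) := (hfin.subset Set.sdiff_subset).isClosed
  have h2 : ({⟨a, ha⟩} : Set A) = Subtype.val ⁻¹' (O \ ((O ∩ A) \ {a})) := by
    ext ⟨b, hb⟩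
    simp only [Set.mem_singleton_iff, Subtype.mk.injEq, Set.mem_preimage, Set.mem_sdiff,
      Set.mem_inter_iff]
    constructor
    · rintro rfl
      exact ⟨haO, fun h => h.2 rfl⟩
    · rintro ⟨hbO, h⟩
      by_contra hne
      exact h ⟨⟨hbO, hb⟩, hne⟩
  rw [h2]
  exact (hO.sdiff h1).preimage continuous_subtype_val

end PGLTopology

variable {K : Type*} [RCLike K] {d : ℕ} {θ : Finset ℕ}

/-! ### The domain, its orbital limit set and projective visibility. -/

namespace PluckerRep

variable {k : ℕ} {hkd : k < d} {R : PluckerRep K d k hkd} {t : Fin R.n → ℝ} {ε : ℝ}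

lemma toPGL_smul_mk (g : Matrix.GeneralLinearGroup (Fin d) K) {v : Fin R.n → ℝ} (hv : v ≠ 0) :
    R.toPGL (Matrix.ProjGenLinGroup.mk g) • (Projectivization.mk ℝ v hv : RealProj R.n)
      = Projectivization.mk ℝ (R.τ g *ᵥ v) (R.τ_mulVec_ne_zero g hv) := rfl

variable (R) in
/-- The point of projective space representing `F^k`. -/
def point (hk : k ∈ θ) (F : PartialFlag K d θ) : RealProj R.n :=
  Projectivization.mk ℝ (R.vec hk F) (R.vec_ne_zero hk F)

lemma continuous_point (hk : k ∈ θ) :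
    Continuous fun F : PartialFlag K d θ => R.point hk F :=
  continuous_mk_realProj.comp (f := fun F : PartialFlag K d θ =>
    (⟨R.vec hk F, R.vec_ne_zero hk F⟩ : {v : Fin R.n → ℝ // v ≠ 0}))
    ((R.continuous_vec hk).subtype_mk _)

lemma toPGL_smul_point (hk : k ∈ θ) (γ : PGL d K) (F : PartialFlag K d θ) :
    R.toPGL γ • R.point hk F = R.point hk (γ • F) := by
  obtain ⟨g, rfl⟩ := Matrix.ProjGenLinGroup.mk_surjective γ
  obtain ⟨a, -, h⟩ := R.τ_vec hk g F
  rw [point, toPGL_smul_mk]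
  exact (Projectivization.mk_eq_mk_iff' ..).2 ⟨a, h.symm⟩

/-- The properly convex domain on which a transverse group acts. -/
abbrev domain (R : PluckerRep K d k hkd) (Γ : Subgroup (PGL d K)) (t : Fin R.n → ℝ) (ε : ℝ) :
    Set (RealProj R.n) :=
  posDomain (closure (R.translates Γ t ε))

lemma IsPositiveBox.isProperlyConvexDomain (hbox : R.IsPositiveBox t ε) (Γ : Subgroup (PGL d K)) :
    IsProperlyConvexDomain (R.domain Γ t ε) := by
  obtain ⟨X₀, hX₀, hX₀0⟩ := hbox.exists_mem_posCone Γ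
  exact isProperlyConvexDomain_posDomain (R.isCompact_closure_translates Γ t ε) hX₀ hX₀0 hbox.1
    (hbox.exists_smul_mem Γ)

lemma IsPositiveBox.smul_mem_domain (hbox : R.IsPositiveBox t ε) {Γ : Subgroup (PGL d K)}
    {γ : PGL d K} (hγ : γ ∈ Γ) {p : RealProj R.n} (hp : p ∈ R.domain Γ t ε) :
    R.toPGL γ • p ∈ R.domain Γ t ε := by
  obtain ⟨g, rfl⟩ := Matrix.ProjGenLinGroup.mk_surjective γ
  obtain ⟨v, hv, hvS, rfl⟩ := hp
  exact ⟨_, R.τ_mulVec_ne_zero g hv, hbox.τ_mulVec_mem_posCone hγ hvS, rfl⟩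

lemma IsPositiveBox.map_le_autGroup (hbox : R.IsPositiveBox t ε) (Γ : Subgroup (PGL d K)) :
    Γ.map R.toPGL ≤ autGroup (R.domain Γ t ε) := by
  rintro _ ⟨γ, hγ, rfl⟩
  refine MulAction.mem_stabilizer_set.2 fun p => ⟨fun h => ?_, hbox.smul_mem_domain hγ⟩
  have := hbox.smul_mem_domain (inv_mem hγ) h
  rwa [map_inv, inv_smul_smul] at this

section Transverse

variable {Γ : Subgroup (PGL d K)}

/-- Contracting sequences contract the domain to a boundary point. -/
lemma IsPositiveBox.tendsto_smul (hθ : ∀ j ∈ θ, 1 ≤ j ∧ j < d) (hsymm : ∀ j ∈ θ, d - j ∈ θ)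
    (hdiv : ∀ j ∈ θ, IsDivergent j Γ) (hk : k ∈ θ) (hbox : R.IsPositiveBox t ε)
    {γ : ℕ → PGL d K} {F G : PartialFlag K d θ} (hG : G ∈ flagLimitSet θ Γ)
    (hc : IsContracting γ F G) {p : RealProj R.n} (hp : p ∈ R.domain Γ t ε) :
    Tendsto (fun n => R.toPGL (γ n) • p) atTop (𝓝 (R.point hk F)) := by
  have hk' := hsymm k hk
  obtain ⟨X, hX, hXS, rfl⟩ := hp
  obtain ⟨B, hB, h1⟩ := hc.exists_rep
  obtain ⟨r, hr, h2⟩ := h1 k hkd R hk hk'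
  have h3 := tendsto_mulVec h2 (tendsto_const_nhds (x := X))
  rw [vecMulVec_mulVec_eq_smul] at h3
  have hpos : 0 < R.dual hk' G ⬝ᵥ X := by
    have := hXS _ (hbox.dual_mem hk' hθ hsymm hdiv hk hG)
    rw [smul_dotProduct, smul_eq_mul] at this
    exact pos_of_mul_pos_right this (by positivity)
  have hne : ∀ n, (r n • R.τ (B n)) *ᵥ X ≠ 0 := fun n => by
    rw [Matrix.smul_mulVec]
    exact smul_ne_zero (hr n).ne' (R.τ_mulVec_ne_zero _ hX)
  have hne' := smul_ne_zero hpos.ne' (R.vec_ne_zero hk F)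
  have h4 := tendsto_mk_realProj hne hne' h3
  have h5 : (Projectivization.mk ℝ _ hne' : RealProj R.n) = R.point hk F :=
    (Projectivization.mk_eq_mk_iff' ..).2 ⟨_, rfl⟩
  rw [h5] at h4
  refine h4.congr fun n => ?_
  rw [← hB, toPGL_smul_mk]
  exact (Projectivization.mk_eq_mk_iff' ..).2 ⟨r n, by rw [Matrix.smul_mulVec]⟩

/-- If the vectors of `F ≠ G` were proportional, `dual G` would vanish at `vec F` because it
vanishes at `vec G`, against transversality. Thus the `k`-dimensional part alone determines a limit
flag. -/
lemma point_injOn (hθ : ∀ j ∈ θ, 1 ≤ j ∧ j < d) (hsymm : ∀ j ∈ θ, d - j ∈ θ)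
    (hΓ : IsTransverseSubgroup θ Γ) (hk : k ∈ θ) (hkk : k ≤ d - k)
    {F G : PartialFlag K d θ} (hF : F ∈ flagLimitSet θ Γ) (hG : G ∈ flagLimitSet θ Γ)
    (h : R.point hk F = R.point hk G) : F = G := by
  by_contra hne
  have hk' := hsymm k hk
  obtain ⟨a, ha⟩ := (Projectivization.mk_eq_mk_iff' ..).1 h
  have h1 := R.dual_dotProduct_vec_pos hk hk' (hΓ.2 F hF G hG hne)
  rw [← ha, dotProduct_smul, R.dual_dotProduct_vec_self hk hk' (hθ k hk).1 hkk, smul_zero] at h1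
  exact lt_irrefl _ h1

lemma IsPositiveBox.point_not_mem (hθ : ∀ j ∈ θ, 1 ≤ j ∧ j < d) (hsymm : ∀ j ∈ θ, d - j ∈ θ)
    (hΓ : IsTransverseSubgroup θ Γ) (hk : k ∈ θ) (hkk : k ≤ d - k) (hbox : R.IsPositiveBox t ε)
    {F : PartialFlag K d θ} (hF : F ∈ flagLimitSet θ Γ) : R.point hk F ∉ R.domain Γ t ε :=
  (hbox.isStrictBoundary (hsymm k hk) hθ hsymm hΓ hk hkk hF).not_mem

/-- Along a subsequence, an orbit sequence is constant, or the group elements are contracting. -/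
lemma exists_subseq_const_or_isContracting (hθ : ∀ j ∈ θ, 1 ≤ j ∧ j < d)
    (hsymm : ∀ j ∈ θ, d - j ∈ θ) (hdiv : ∀ j ∈ θ, IsDivergent j Γ) {γ : ℕ → PGL d K}
    (hγ : ∀ n, γ n ∈ Γ) : ∃ φ : ℕ → ℕ, StrictMono φ ∧ ((∀ n, γ (φ n) = γ (φ 0)) ∨
      ∃ F ∈ flagLimitSet θ Γ, ∃ G ∈ flagLimitSet θ Γ, IsContracting (γ ∘ φ) F G ∧
        IsContracting (fun n => (γ (φ n))⁻¹) G F) := by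
  obtain ⟨φ, hφ, h | h⟩ := exists_subseq_const_or_injective γ
  · exact ⟨φ, hφ, Or.inl h⟩
  · have hθ' : ∀ j ∈ θ, j ≤ d := fun j hj => (hθ j hj).2.le
    choose U hU using fun n => exists_isCartanFlag hθ' (γ (φ n))
    obtain ⟨ψ, hψ, F, hF, G, hG, -, hc, hc'⟩ :=
      exists_subseq_isContracting hθ hsymm hdiv (fun n => hγ (φ n)) h hU
    exact ⟨φ ∘ ψ, hφ.comp hψ, Or.inr ⟨F, hF, G, hG, hc, hc'⟩⟩

/-- An orbit sequence converging to the boundary cannot be constant along a subsequence, since the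
open domain is invariant. So it has a contracting subsequence, which attracts the domain to the
point of a limit flag. Conversely every limit flag is the attractor of such a sequence. -/
lemma IsPositiveBox.orbitalLimitSet_eq (hθ : ∀ j ∈ θ, 1 ≤ j ∧ j < d) (hsymm : ∀ j ∈ θ, d - j ∈ θ)
    (hΓ : IsTransverseSubgroup θ Γ) (hk : k ∈ θ) (hkk : k ≤ d - k) (hbox : R.IsPositiveBox t ε) :
    orbitalLimitSet (R.domain Γ t ε) (Γ.map R.toPGL) = R.point hk '' flagLimitSet θ Γ := by
  have hopen : IsOpen (R.domain Γ t ε) := (hbox.isProperlyConvexDomain Γ).1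
  obtain ⟨X₀, hX₀, hX₀0⟩ := hbox.exists_mem_posCone Γ
  ext z
  constructor
  · rintro ⟨hz, p, hp, γ₀, hγ₀, hlim⟩
    choose γ hγ hγe using hγ₀
    rw [hopen.frontier_eq] at hz
    obtain ⟨φ, hφ, h | ⟨F, hF, G, hG, hc, -⟩⟩ :=
      exists_subseq_const_or_isContracting hθ hsymm hΓ.1 hγ
    · refine absurd ?_ hz.2
      have h1 := hlim.comp hφ.tendsto_atTop
      have h2 : z = R.toPGL (γ (φ 0)) • p := by
        refine tendsto_nhds_unique h1 (tendsto_const_nhds.congr fun n => ?_)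
        rw [Function.comp_apply, ← hγe, h n]
      rw [h2]
      exact hbox.smul_mem_domain (hγ _) hp
    · refine ⟨F, hF, ?_⟩
      refine tendsto_nhds_unique (hbox.tendsto_smul hθ hsymm hΓ.1 hk hG hc hp) ?_
      refine (hlim.comp hφ.tendsto_atTop).congr fun n => ?_
      rw [Function.comp_apply, Function.comp_apply, hγe]
  · rintro ⟨F, hF, rfl⟩
    obtain ⟨γ, G, hγ, -, hG, hc, -⟩ := exists_isContracting hθ hsymm hΓ.1 hF
    refine ⟨(hbox.isStrictBoundary (hsymm k hk) hθ hsymm hΓ hk hkk hF).mem_frontier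
      (R.isCompact_closure_translates Γ t ε) hX₀, _, ⟨X₀, hX₀0, hX₀, rfl⟩, fun n => R.toPGL (γ n),
      fun n => ⟨γ n, hγ n, rfl⟩, ?_⟩
    exact hbox.tendsto_smul hθ hsymm hΓ.1 hk hG hc ⟨X₀, hX₀0, hX₀, rfl⟩

/-- Infinitely many elements moving `p` into one closed subset of the domain would contain a
contracting sequence, whose limit point is outside the domain. -/
lemma IsPositiveBox.discreteTopology_map (hθ : ∀ j ∈ θ, 1 ≤ j ∧ j < d)
    (hsymm : ∀ j ∈ θ, d - j ∈ θ) (hΓ : IsTransverseSubgroup θ Γ) (hk : k ∈ θ) (hkk : k ≤ d - k)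
    (hbox : R.IsPositiveBox t ε) : DiscreteTopology (Γ.map R.toPGL) := by
  obtain ⟨hopen, ⟨p, hp⟩, -⟩ := hbox.isProperlyConvexDomain Γ
  refine discreteTopology_of_finite_inter (A := (Γ.map R.toPGL : Set (PGL R.n ℝ))) ?_
  rintro _ ⟨γ, hγ, rfl⟩
  obtain ⟨N, hN, hNc, hNΩ⟩ := exists_mem_nhds_isClosed_subset
    (hopen.mem_nhds (hbox.smul_mem_domain hγ hp))
  refine ⟨(fun g => g • p) ⁻¹' interior N, isOpen_interior.preimage (continuous_smul_realProj p),
    mem_interior_iff_mem_nhds.2 hN, ?_⟩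
  by_contra hinf
  set e := Set.Infinite.natEmbedding _ hinf with he
  have hmem : ∀ n, ((e n : PGL R.n ℝ) • p ∈ interior N) ∧ ∃ γ ∈ Γ, R.toPGL γ = e n :=
    fun n => (e n).2
  choose hN' γ' hγ' hγe using hmem
  obtain ⟨φ, hφ, h | ⟨F, hF, G, hG, hc, -⟩⟩ :=
    exists_subseq_const_or_isContracting hθ hsymm hΓ.1 hγ'
  · have h1 : e (φ 1) = e (φ 0) := Subtype.ext (by rw [← hγe, ← hγe, h 1])
    have h2 := e.injective h1
    exact absurd (hφ.injective h2) one_ne_zero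
  · refine hbox.point_not_mem hθ hsymm hΓ hk hkk hF (hNΩ ?_)
    refine hNc.mem_of_tendsto (hbox.tendsto_smul hθ hsymm hΓ.1 hk hG hc hp)
      (Eventually.of_forall fun n => ?_)
    rw [Function.comp_apply, hγe]
    exact interior_subset (hN' _)

lemma IsPositiveBox.isProjectivelyVisible (hθ : ∀ j ∈ θ, 1 ≤ j ∧ j < d)
    (hsymm : ∀ j ∈ θ, d - j ∈ θ) (hΓ : IsTransverseSubgroup θ Γ) (hk : k ∈ θ) (hkk : k ≤ d - k)
    (hbox : R.IsPositiveBox t ε) :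
    IsProjectivelyVisible (R.domain Γ t ε) (Γ.map R.toPGL) where
  discrete := hbox.discreteTopology_map hθ hsymm hΓ hk hkk
  le_autGroup := hbox.map_le_autGroup Γ
  visible := by
    rw [hbox.orbitalLimitSet_eq hθ hsymm hΓ hk hkk]
    rintro _ ⟨F, hF, rfl⟩ _ ⟨G, hG, rfl⟩
    have hk' := hsymm k hk
    by_cases hFG : F = G
    · rw [hFG, openProjSegment_self]
      exact Set.empty_subset _
    · have hpos : ∀ {F G : PartialFlag K d θ}, F ∈ flagLimitSet θ Γ → G ∈ flagLimitSet θ Γ →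
          F ≠ G → 0 < (‖R.dual hk' G‖⁻¹ • R.dual hk' G) ⬝ᵥ R.vec hk F := fun {F G} hF hG hne => by
        rw [smul_dotProduct, smul_eq_mul]
        exact mul_pos (inv_pos.2 (norm_pos_iff.2 (R.dual_ne_zero hk' G)))
          (R.dual_dotProduct_vec_pos hk hk' (hΓ.2 F hF G hG hne))
      exact (hbox.isStrictBoundary hk' hθ hsymm hΓ hk hkk hF).openProjSegment_subset
        (hbox.isStrictBoundary hk' hθ hsymm hΓ hk hkk hG) (hpos hG hF (Ne.symm hFG)) (hpos hF hG hFG)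
  isC1Point := by
    rw [hbox.orbitalLimitSet_eq hθ hsymm hΓ hk hkk]
    rintro _ ⟨F, hF, rfl⟩
    obtain ⟨X₀, hX₀, -⟩ := hbox.exists_mem_posCone Γ
    exact (hbox.isStrictBoundary (hsymm k hk) hθ hsymm hΓ hk hkk hF).isC1Point
      (R.isCompact_closure_translates Γ t ε) hX₀

end Transverse

end PluckerRep

end TransverseGroups

namespace TransverseGroups

open Matrix

variable {K : Type*} [RCLike K] {d : ℕ} {θ : Finset ℕ}

/-! ### The limit map and the transverse representation. -/

namespace PluckerRep

variable {k : ℕ} {hkd : k < d} {R : PluckerRep K d k hkd} {t : Fin R.n → ℝ} {ε : ℝ}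
  {Γ : Subgroup (PGL d K)}

/-- The limit set of the image is homeomorphic to the limit set. -/
lemma IsPositiveBox.exists_homeomorph (hθ : ∀ j ∈ θ, 1 ≤ j ∧ j < d) (hsymm : ∀ j ∈ θ, d - j ∈ θ)
    (hΓ : IsTransverseSubgroup θ Γ) (hk : k ∈ θ) (hkk : k ≤ d - k) (hbox : R.IsPositiveBox t ε) :
    ∃ e : flagLimitSet θ Γ ≃ₜ orbitalLimitSet (R.domain Γ t ε) (Γ.map R.toPGL),
      ∀ F, (e F : RealProj R.n) = R.point hk (F : PartialFlag K d θ) := by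
  have hcomp : CompactSpace (flagLimitSet θ Γ) :=
    isCompact_iff_compactSpace.1 (isCompact_flagLimitSet hθ Γ)
  have heq := hbox.orbitalLimitSet_eq hθ hsymm hΓ hk hkk
  set f : flagLimitSet θ Γ → orbitalLimitSet (R.domain Γ t ε) (Γ.map R.toPGL) := fun F =>
    ⟨R.point hk F.1, heq ▸ Set.mem_image_of_mem _ F.2⟩ with hf
  have hcont : Continuous f := ((continuous_point hk).comp continuous_subtype_val).subtype_mk _
  have hbij : Function.Bijective f := by
    constructor
    · intro F G h
      exact Subtype.ext (point_injOn hθ hsymm hΓ hk hkk F.2 G.2 (congrArg Subtype.val h))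
    · rintro ⟨z, hz⟩
      have hz' := hz
      rw [heq] at hz'
      obtain ⟨F, hF, rfl⟩ := hz'
      exact ⟨⟨F, hF⟩, rfl⟩
  -- A continuous bijection from a compact space to a Hausdorff space is a homeomorphism.
  exact ⟨Continuous.homeoOfEquivCompactToT2 (f := Equiv.ofBijective f hbij) hcont, fun F => rfl⟩

lemma IsPositiveBox.isTransverseRepWithLimitMap (hθ : ∀ j ∈ θ, 1 ≤ j ∧ j < d)
    (hsymm : ∀ j ∈ θ, d - j ∈ θ) (hΓ : IsTransverseSubgroup θ Γ) (hk : k ∈ θ) (hkk : k ≤ d - k)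
    (hbox : R.IsPositiveBox t ε)
    {e : flagLimitSet θ Γ ≃ₜ orbitalLimitSet (R.domain Γ t ε) (Γ.map R.toPGL)}
    (he : ∀ F, (e F : RealProj R.n) = R.point hk (F : PartialFlag K d θ))
    {ρ : Γ.map R.toPGL →* PGL d K} (hρΓ : ∀ γ, ρ γ ∈ Γ) (hρ : ∀ γ, R.toPGL (ρ γ) = γ) :
    IsTransverseRepWithLimitMap (R.domain Γ t ε) (Γ.map R.toPGL) ρ
      (fun x => (e.symm x : PartialFlag K d θ)) where
  isEmbedding := IsEmbedding.subtypeVal.comp e.symm.isEmbedding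
  equivariant γ x := by
    obtain ⟨F, rfl⟩ := e.surjective x
    have h1 : (γ : PGL R.n ℝ) • (e F : RealProj R.n)
        = e ⟨ρ γ • F.1, smul_mem_flagLimitSet hθ hsymm hΓ.1 (hρΓ γ) F.2⟩ := by
      rw [he, he, ← hρ, toPGL_smul_point]
    refine ⟨h1 ▸ Subtype.property _, ?_⟩
    simp only [h1, Subtype.coe_eta, Homeomorph.symm_apply_apply]
  transverse := by
    rintro _ ⟨x, rfl⟩ _ ⟨y, rfl⟩ hne
    exact hΓ.2 _ (e.symm x).2 _ (e.symm y).2 hne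
  dynamics b hb γ x y hx hy H hH := by
    obtain ⟨F, rfl⟩ := e.surjective x
    obtain ⟨G, rfl⟩ := e.surjective y
    simp only [Homeomorph.symm_apply_apply] at hH ⊢
    rw [he] at hx hy
    -- It suffices that every subsequence has a further one with the right limit. A contracting one
    -- attracts `b` to the point of `F'`, its inverses to that of `G'`; as points determine limit
    -- flags, these are the prescribed `F` and `G`.
    refine tendsto_of_subseq_tendsto fun ns hns => ?_
    obtain ⟨φ, hφ, h | ⟨F', hF', G', hG', hc, hc'⟩⟩ :=
      exists_subseq_const_or_isContracting hθ hsymm hΓ.1 (γ := fun n => ρ (γ (ns n)))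
        (fun n => hρΓ _)
    · exfalso
      refine hbox.point_not_mem hθ hsymm hΓ hk hkk F.2 ?_
      have h2 : R.point hk F.1 = R.toPGL (ρ (γ (ns (φ 0)))) • b := by
        refine tendsto_nhds_unique (hx.comp (hns.comp hφ.tendsto_atTop))
          (tendsto_const_nhds.congr fun n => ?_)
        simp only [Function.comp_apply]
        rw [← hρ (γ (ns (φ n))), h n]
      rw [h2]
      exact hbox.smul_mem_domain (hρΓ _) hb
    · have hF : F' = F := by
        refine point_injOn (R := R) hθ hsymm hΓ hk hkk hF' F.2 ?_
        refine tendsto_nhds_unique (hbox.tendsto_smul hθ hsymm hΓ.1 hk hG' hc hb) ?_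
        refine (hx.comp (hns.comp hφ.tendsto_atTop)).congr fun n => ?_
        simp only [Function.comp_apply, hρ]
      have hG : G' = G := by
        refine point_injOn (R := R) hθ hsymm hΓ hk hkk hG' G.2 ?_
        refine tendsto_nhds_unique (hbox.tendsto_smul hθ hsymm hΓ.1 hk hF' hc' hb) ?_
        refine (hy.comp (hns.comp hφ.tendsto_atTop)).congr fun n => ?_
        simp only [Function.comp_apply, map_inv, hρ]
      refine ⟨φ, ?_⟩
      rw [← hF]
      exact hc.tendsto_smul H (hG ▸ hH)

variable (R) in
/-- The inverse of the Plücker representation on the image of `Γ`. -/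
def repOfInjective (hR : Function.Injective R.toPGL) (Γ : Subgroup (PGL d K)) :
    Γ.map R.toPGL →* PGL d K :=
  Γ.subtype.comp (Γ.equivMapOfInjective R.toPGL hR).symm.toMonoidHom

lemma toPGL_repOfInjective (hR : Function.Injective R.toPGL) (γ : Γ.map R.toPGL) :
    R.toPGL (R.repOfInjective hR Γ γ) = γ := by
  have := (Γ.equivMapOfInjective R.toPGL hR).apply_symm_apply γ
  exact congrArg Subtype.val this

lemma simpleRoot_one_toPGL_eq (hk1 : 1 ≤ k) (γ : PGL d K) :
    simpleRoot 1 (cartanProjection (R.toPGL γ)) = simpleRoot k (cartanProjection γ) := by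
  obtain ⟨ℓ, hℓ, m, hm, A, hA, -, B, hB, hBA⟩ := exists_cartan γ
  rw [R.simpleRoot_one_toPGL hB hℓ hm hA hBA R.two_le_n,
    simpleRoot_cartanProjection hB hℓ hm hA hBA hk1 hkd]
  rfl

end PluckerRep

end TransverseGroups

end

theorem mainTheorem8 {K : Type*} [RCLike K] {d : ℕ} (θ : Finset ℕ)
    (hθ : ∀ k ∈ θ, 1 ≤ k ∧ k < d) (hsymm : ∀ k ∈ θ, d - k ∈ θ)
    (Γ : Subgroup (TransverseGroups.PGL d K)) (hΓ : TransverseGroups.IsTransverseSubgroup θ Γ)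
    (k : ℕ) (hk : k ∈ θ) (hkd : k ≤ d - k) :
    ∃ (d₀ : ℕ) (Ω : Set (TransverseGroups.RealProj d₀))
      (Γ₀ : Subgroup (TransverseGroups.PGL d₀ ℝ)) (ρ : Γ₀ →* TransverseGroups.PGL d K)
      (ξ : TransverseGroups.orbitalLimitSet Ω Γ₀ → TransverseGroups.PartialFlag K d θ),
      2 ≤ d₀ ∧
      TransverseGroups.IsProperlyConvexDomain Ω ∧
      TransverseGroups.IsProjectivelyVisible Ω Γ₀ ∧
      Function.Injective ρ ∧
      TransverseGroups.IsTransverseRepWithLimitMap Ω Γ₀ ρ ξ ∧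
      ρ.range = Γ ∧
      Set.range ξ = TransverseGroups.flagLimitSet θ Γ ∧
      ∀ γ : Γ₀,
        TransverseGroups.simpleRoot 1
            (TransverseGroups.cartanProjection (γ : TransverseGroups.PGL d₀ ℝ)) =
          TransverseGroups.simpleRoot k (TransverseGroups.cartanProjection (ρ γ)) := by
  obtain ⟨hk1, hkd'⟩ := hθ k hk
  let R := TransverseGroups.pluckerRep K hk1 hkd'
  obtain ⟨t, ε, hε, hpos⟩ := R.exists_pos
  have hbox : R.IsPositiveBox t ε := ⟨hε, hpos⟩
  have hR := R.toPGL_injective hk1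
  obtain ⟨e, he⟩ := hbox.exists_homeomorph hθ hsymm hΓ hk hkd
  -- Both the representation and the limit map are inverses: of `toPGL` on `Γ`, and of the
  -- homeomorphism from the limit set onto the orbital limit set.
  refine ⟨R.n, R.domain Γ t ε, Γ.map R.toPGL, R.repOfInjective hR Γ,
    fun x => (e.symm x : TransverseGroups.PartialFlag K d θ), R.two_le_n,
    hbox.isProperlyConvexDomain Γ, hbox.isProjectivelyVisible hθ hsymm hΓ hk hkd, ?_,
    hbox.isTransverseRepWithLimitMap hθ hsymm hΓ hk hkd he (fun γ => Subtype.property _)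
      (TransverseGroups.PluckerRep.toPGL_repOfInjective hR), ?_, ?_, fun γ => ?_⟩
  · exact Subtype.val_injective.comp (MulEquiv.injective _)
  · ext γ
    constructor
    · rintro ⟨γ₀, rfl⟩
      exact Subtype.property _
    · intro hγ
      refine ⟨⟨R.toPGL γ, γ, hγ, rfl⟩, hR ?_⟩
      rw [TransverseGroups.PluckerRep.toPGL_repOfInjective]
  · ext F
    constructor
    · rintro ⟨x, rfl⟩
      exact Subtype.property _
    · intro hF
      exact ⟨e ⟨F, hF⟩, by simp only [Homeomorph.symm_apply_apply]⟩
  · rw [← TransverseGroups.PluckerRep.simpleRoot_one_toPGL_eq (R := R) hk1,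
      TransverseGroups.PluckerRep.toPGL_repOfInjective]
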